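/- For a commutative ring element $q$ put $(q)_n=\prod_{k=1}^n(1-q^k)$ and $f(q)=\sum_{n\ge 0}(q)_n$ (a finite sum if $q$ is a root of unity). Let $F(x)=e^{-1/(24x)}f(e^{-1/x})=\sum_{n\ge0}a_nx^{-n}\in\mathbb Q[[1/x]]$ (the sum converges formally, since $(e^{-1/x})_n$ is divisible by $x^{-n}$), and let $G(p)=\sum_{n\ge 0}a_{n+1}\,p^n/n!$ be its Borel transform. Then $G$ converges near $p=0$ and continues analytically to the open upper and to the open lower half-plane, and for $\operatorname{Re}x>0$ its lateral Laplace transforms $(\mathcal L^{\mathrm{mur}}G)(x)$ and $(\mathcal L^{\mathrm{mul}}G)(x)$ exist. Here $(\mathcal L^{\mathrm{mur}}G)(x)=\int e^{-xp}G(p)\,dp$, where $G$ is continued above the positive real axis and the integral is taken along any ray $\arg p=\theta$, $0<\theta<\pi/2$, with $\operatorname{Re}(xe^{i\theta})>0$; it does not depend on $\theta$. Likewise $(\mathcal L^{\mathrm{mul}}G)(x)$ is defined by continuation below the positive real axis and rays $\arg p=-\theta$, $0<\theta<\pi/2$, with $\operatorname{Re}(xe^{-i\theta})>0$. The Dirichlet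 series associated to $F$ is the function $$\delta(x)=\tfrac12\big((\mathcal L^{\mathrm{mur}}G)(x)-(\mathcal L^{\mathrm{mul}}G)(x)\big),\qquad \operatorname{Re}x>0 .$$ Let $\chi$ be the primitive character of conductor $12$ ($\chi(n)=1$ if $n\equiv 1,11$, $\chi(n)=-1$ if $n\equiv5,7$, and $\chi(n)=0$ otherwise, modulo $12$), let $\tilde\eta(z)=\sum_{n\ge1}\chi(n)\,n\,e^{\pi i n^2z/12}$ for $\operatorname{Im}z>0$, let $\phi(\alpha)=e^{\pi i\alpha/12}f(e^{2\pi i\alpha})$ for $\alpha\in\mathbb Q$, and let $\zeta_{24}=e^{2\pi i/24}$. Powers are principal: $w^s=e^{s\log w}$ with $\arg w\in(-\pi,\pi]$. Then: (a) For $\operatorname{Re}x>0$, $\ \delta(x)=i\sqrt2\,(\pi x)^{3/2}\,\tilde\eta(2\pi i x)$. (b) $\delta$ is a lacunary series with natural boundary the line $\operatorname{Re}x=0$. That is, on $\operatorname{Re}x>0$, $x^{-3/2}\delta(x)$ is the sum of a convergent Dirichlet series $\sum_n c_ne^{-\lambda_nx}$ with all $c_n\neq0$, $0\le\lambda_0<\lambda_1<\cdots$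 and $\lambda_{n+1}-\lambda_n\to\infty$; and $\delta$ is analytic on $\operatorname{Re}x>0$, but cannot be continued analytically to a neighbourhood of any point of the line $\operatorname{Re}x=0$. (c) $\delta$ has radial limits at $\frac1{2\pi i}\mathbb Q$: for every $\xi\in\frac1{2\pi i}\mathbb Q$ the limit of $\delta(\xi+t)$ as $t\to0^+$ ($t$ real) exists. For every nonzero $\alpha\in\mathbb Q$, its value at $\xi=-\frac1{2\pi i\alpha}$ is $$\delta\Big(-\frac1{2\pi i\alpha}\Big)=\zeta_{24}^3\,\alpha^{-3/2}\,\phi(-1/\alpha).$$ -/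

import Mathlib

namespace KZ

/-- The `q`-factorial `(q)_n = (1 - q)(1 - q^2) ⋯ (1 - q^n)`, with `(q)_0 = 1`. -/
def qFactorial {R : Type*} [CommRing R] (q : R) (n : ℕ) : R :=
  ∏ k ∈ Finset.range n, (1 - q ^ (k + 1))

/-- The formal power series `e^{c X}`, where `X` stands for `1/x`. -/
noncomputable def expSeries (c : ℂ) : PowerSeries ℂ :=
  PowerSeries.rescale c (PowerSeries.exp ℂ)

/-- `(e^{-X})_n` is divisible by `X^n`; so the sum `∑_n (e^{-X})_n` converges formally, and its
coefficient at `X^m` only involves the terms with `n ≤ m`. -/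
theorem X_pow_dvd_qFactorial (n : ℕ) :
    (PowerSeries.X : PowerSeries ℂ) ^ n ∣ qFactorial (expSeries (-1)) n := by
  unfold qFactorial
  have h : ∀ k ∈ Finset.range n,
      (PowerSeries.X : PowerSeries ℂ) ∣ 1 - expSeries (-1) ^ (k + 1) := by
    intro k _
    have h1 : PowerSeries.constantCoeff (expSeries (-1)) = 1 := by
      rw [← PowerSeries.coeff_zero_eq_constantCoeff_apply, expSeries, PowerSeries.coeff_rescale,
        PowerSeries.coeff_exp]
      simp
    rw [PowerSeries.X_dvd_iff, map_sub, map_pow, h1]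
    simp
  simpa using Finset.prod_dvd_prod_of_dvd _ _ h

/-- The formal power series `f(e^{-X}) = ∑_{n ≥ 0} (e^{-X})_n`. -/
noncomputable def fFormal : PowerSeries ℂ :=
  PowerSeries.mk fun m =>
    PowerSeries.coeff m (∑ n ∈ Finset.range (m + 1), qFactorial (expSeries (-1)) n)

/-- The coefficient at `X^m` of every later partial sum of `∑_n (e^{-X})_n` is that of
`fFormal`. -/
theorem coeff_fFormal (m N : ℕ) (hN : m < N) :
    PowerSeries.coeff m (∑ n ∈ Finset.range N, qFactorial (expSeries (-1)) n)
      = PowerSeries.coeff m fFormal := by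
  rw [fFormal, PowerSeries.coeff_mk, map_sum, map_sum]
  symm
  apply Finset.sum_subset
  · intro n hn
    simp only [Finset.mem_range] at *
    omega
  · intro n _ hn
    simp only [Finset.mem_range] at hn
    exact (PowerSeries.X_pow_dvd_iff.mp (X_pow_dvd_qFactorial n)) m (by omega)

/-- The formal power series `F(x) = e^{-1/(24 x)} f(e^{-1/x})` in the variable `X = 1/x`. -/
noncomputable def F : PowerSeries ℂ := expSeries (-1 / 24) * fFormal

/-- The formal Borel transform `∑ aₙ x^{-n} ↦ ∑ a_{n+1} pⁿ / n!`. -/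
noncomputable def borel (A : PowerSeries ℂ) : PowerSeries ℂ :=
  PowerSeries.mk fun n => PowerSeries.coeff (n + 1) A / (n.factorial : ℂ)

/-- `g` is an analytic continuation, to the union of a disc around `0` and the set `H`,
of the germ at `0` with Taylor series `B`. It is unique on that set when `H` is an open half-plane
with `0` on its boundary. -/
def IsContinuation (B : PowerSeries ℂ) (H : Set ℂ) (g : ℂ → ℂ) : Prop :=
  ∃ r : ℝ, 0 < r ∧ DifferentiableOn ℂ g (Metric.ball 0 r ∪ H) ∧
    ∀ p ∈ Metric.ball (0 : ℂ) r, HasSum (fun n : ℕ => PowerSeries.coeff n B * p ^ n) (g p)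

/-- The Laplace integral `∫ e^{-x p} g(p) dp` along the ray from `0` to `∞` of angle `θ` converges
absolutely to `L`. -/
def HasRayLaplace (g : ℂ → ℂ) (θ : ℝ) (x L : ℂ) : Prop :=
  MeasureTheory.IntegrableOn
    (fun t : ℝ => Complex.exp (-(x * (t * Complex.exp (Complex.I * θ))))
      * g (t * Complex.exp (Complex.I * θ)) * Complex.exp (Complex.I * θ)) (Set.Ioi 0) ∧
  ∫ t in Set.Ioi (0 : ℝ), Complex.exp (-(x * (t * Complex.exp (Complex.I * θ))))
      * g (t * Complex.exp (Complex.I * θ)) * Complex.exp (Complex.I * θ) = L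

/-- The lateral Laplace transform at `x` of the Borel transform of `A` exists and equals `L`.
For `σ = 1` the Borel transform is continued along paths from `0` to `∞` that avoid the
positive real axis from above, for `σ = -1` from below. The integral is taken along any
ray of angle `σ θ`, `0 < θ < π / 2`, on which `e^{-x p}` decays. -/
def HasLateralLaplace (A : PowerSeries ℂ) (σ : ℝ) (x L : ℂ) : Prop :=
  ∃ g : ℂ → ℂ, IsContinuation (borel A) {p : ℂ | 0 < σ * p.im} g ∧
    ∀ θ ∈ Set.Ioo (0 : ℝ) (Real.pi / 2),
      0 < (x * Complex.exp (Complex.I * ((σ * θ : ℝ) : ℂ))).re → HasRayLaplace g (σ * θ) x L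

/-- `δ` is the Dirichlet series associated to the formal power series `A`: on `Re x > 0` it is half
the difference of the lateral Laplace transforms from above and from below. This determines
`δ` on `Re x > 0`; its values elsewhere are irrelevant. -/
def IsAssociatedDirichletSeries (A : PowerSeries ℂ) (δ : ℂ → ℂ) : Prop :=
  ∀ x : ℂ, 0 < x.re → ∃ Lup Ldown : ℂ,
    HasLateralLaplace A 1 x Lup ∧ HasLateralLaplace A (-1) x Ldown ∧ δ x = (Lup - Ldown) / 2

/-- The primitive character of conductor `12`. -/
def chi (n : ℕ) : ℂ :=
  if n % 12 = 1 ∨ n % 12 = 11 then 1 else if n % 12 = 5 ∨ n % 12 = 7 then -1 else 0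

/-- The Eichler integral `η̃(z) = ∑_{n ≥ 1} χ(n) n e^{π i n² z / 12}`, for `Im z > 0`
(the term `n = 0` vanishes). -/
noncomputable def etaTilde (z : ℂ) : ℂ :=
  ∑' n : ℕ, chi n * n * Complex.exp (Real.pi * Complex.I * (n : ℂ) ^ 2 * z / 12)

/-- `f(q) = ∑_{n ≥ 0} (q)_n`, a finite sum when `q` is a root of unity. -/
noncomputable def fRoot (q : ℂ) : ℂ := ∑' n : ℕ, qFactorial q n

/-- `φ(α) = e^{π i α / 12} f(e^{2 π i α})` for rational `α`. -/
noncomputable def phi (α : ℚ) : ℂ :=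
  Complex.exp (Real.pi * Complex.I * (α : ℂ) / 12)
    * fRoot (Complex.exp (2 * Real.pi * Complex.I * (α : ℂ)))

/-- `ζ_k = e^{2 π i / k}`. -/
noncomputable def zeta (k : ℕ) : ℂ := Complex.exp (2 * Real.pi * Complex.I / k)

/-- On `Re x > 0`, `D` is the sum of a lacunary Dirichlet series `∑ aₙ e^{-λₙ x}`: all
`aₙ` are nonzero, the `λₙ` are nonnegative and strictly increasing, and the gaps
`λₙ₊₁ - λₙ` tend to infinity (so that `λₙ / n → ∞` too). -/
def IsLacunaryDirichletSeries (D : ℂ → ℂ) : Prop :=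
  ∃ (a : ℕ → ℂ) (l : ℕ → ℝ), (∀ n, a n ≠ 0) ∧ 0 ≤ l 0 ∧ StrictMono l ∧
    Filter.Tendsto (fun n => l (n + 1) - l n) Filter.atTop Filter.atTop ∧
    ∀ x : ℂ, 0 < x.re → HasSum (fun n => a n * Complex.exp (-((l n : ℂ) * x))) (D x)

/-- `δ` is analytic on `Re x > 0`, and cannot be analytically continued to a
neighbourhood of any point of the line `Re x = 0`. -/
def HasNaturalBoundaryImaginaryAxis (δ : ℂ → ℂ) : Prop :=
  DifferentiableOn ℂ δ {x : ℂ | 0 < x.re} ∧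
  ∀ ξ : ℂ, ξ.re = 0 → ¬ ∃ g : ℂ → ℂ, AnalyticAt ℂ g ξ ∧
    ∀ᶠ x in nhdsWithin ξ {x : ℂ | 0 < x.re}, g x = δ x

/-- `δ` has the radial limit `L` at the point `ξ` of the line `Re x = 0`. -/
def HasRadialLimit (δ : ℂ → ℂ) (ξ L : ℂ) : Prop :=
  Filter.Tendsto (fun t : ℝ => δ (ξ + t)) (nhdsWithin 0 (Set.Ioi 0)) (nhds L)

end KZ

/-! Put q = e^{-t} with t = 1/x. The partial sums S(x) = (1 - x) ∑ (qx; q)_n x^n satisfy S(x) + q²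
x³ S(qx) = 1 - q x² up to a remainder (`zagierSum_add`). The theta series ∑ χ(n) x^{(n-1)/2}
q^{(n²-1)/24} formally solves the same equation, because χ(n + 6) = -χ(n). Taking the derivative at
x = 1 gives e^{-t/24} f(e^{-t}) = -½ ∑ χ(n) n e^{-n² t/24}, where the divergent sums ∑ χ(n) n^j are
read as Taylor coefficients of sinh(2y)/cosh(3y), up to sign. The umbral functional N^j ↦ r_j (N
stands for -n) makes this rigorous, with the outcome in `coeff_F_eq`.

The r_j are combinations of Bernoulli polynomial values. They vanish for even j, and Fourier series
turn the odd ones into multiples of L(χ, 2k+2) (`hasSum_coeff_F`). Hence the Borel transform is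
(54√3/π⁴) ∑ χ(n) n^{-4} (1 - 6p/(π² n²))^{-5/2}, with branch points π² n²/6 on the positive axis
only (`isContinuation_borelSum`).

Laplace transforms of (1 - cp)^{-5/2} along two rays differ by a solution of a first-order linear
equation in x, hence by a multiple of x^{3/2} e^{-x/c}. The multiple is 0 if the rays lie on the
same side of the positive axis (`lapInt_sub_lapInt`). Summing over n gives the formula for δ and its
existence and uniqueness on Re x > 0 (`isAssociatedDirichletSeries_iff`).

For the radial limits, χ(n) e^{πi n² β/12} is periodic in n with vanishing moments of order 0 and 1,
so its Gaussian regularization has a limit determined by the second moment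
(`tendsto_tsum_mul_gauss`). The same functional equation at a root of unity closes up after finitely
many steps and evaluates these moments by f(ζ) (`sum_moments`), whence η̃ → -2φ(β)
(`tendsto_etaTilde`).

For the natural boundary, integrating η̃ over a short vertical segment against a smooth window times
a character isolates one coefficient. The coefficients are unbounded while the gaps between the
exponents keep the cross terms bounded, so η̃ is unbounded near every boundary point
(`not_bounded_near`). -/

namespace KZ

/-! ### Exponential power series. -/

open PowerSeries in
/-- The power series `e^{c t}` in `t` over a commutative `ℚ`-algebra. -/
noncomputable def expS {R : Type*} [CommRing R] [Algebra ℚ R] (c : R) : PowerSeries R :=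
  rescale c (exp R)

section expS

variable {R : Type*} [CommRing R] [Algebra ℚ R]

theorem expS_mul_expS (a b : R) : expS a * expS b = expS (a + b) :=
  PowerSeries.exp_mul_exp_eq_exp_add a b

theorem coeff_expS (c : R) (n : ℕ) :
    PowerSeries.coeff n (expS c) = c ^ n * algebraMap ℚ R (1 / n.factorial) := by
  rw [expS, PowerSeries.coeff_rescale, PowerSeries.coeff_exp]

theorem expS_zero : expS (0 : R) = 1 := by
  ext n
  rw [coeff_expS, PowerSeries.coeff_one]
  by_cases h : n = 0 <;> simp [h]

theorem expS_pow (a : R) (n : ℕ) : expS a ^ n = expS (n * a) := by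
  induction n with
  | zero => simp [expS_zero]
  | succ n ih => rw [pow_succ, ih, expS_mul_expS]; congr 1; push_cast; ring

theorem map_expS {S : Type*} [CommRing S] [Algebra ℚ S] (f : R →+* S) (c : R) :
    PowerSeries.map f (expS c) = expS (f c) := by
  ext n
  rw [PowerSeries.coeff_map, coeff_expS, coeff_expS, map_mul, map_pow]
  congr 1
  exact RingHom.map_rat_algebraMap f _

theorem X_dvd_one_sub_expS (c : R) : (PowerSeries.X : PowerSeries R) ∣ 1 - expS c := by
  rw [PowerSeries.X_dvd_iff, map_sub, ← PowerSeries.coeff_zero_eq_constantCoeff_apply (expS c),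
    coeff_expS]
  simp

theorem expSeries_eq_expS (c : ℂ) : expSeries c = expS c := rfl

end expS

/-! ### Zagier's functional equation for the partial sums. -/

section qShift

variable {R : Type*} [CommRing R]

/-- The shifted `q`-factorial `(1 - q x)(1 - q² x) ⋯ (1 - qⁿ x)`. -/
def qShift (q x : R) (n : ℕ) : R := ∏ k ∈ Finset.range n, (1 - q ^ (k + 1) * x)

/-- The partial sum `∑_{n < N} (x; q)_{n+1} xⁿ`. -/
def zagierSum (q x : R) (N : ℕ) : R :=
  (1 - x) * ∑ n ∈ Finset.range N, qShift q x n * x ^ n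

theorem qShift_succ (q x : R) (n : ℕ) :
    qShift q x (n + 1) = qShift q x n * (1 - q ^ (n + 1) * x) := Finset.prod_range_succ _ _

theorem qShift_mul (q x : R) (n : ℕ) :
    (1 - q * x) * qShift q (q * x) n = qShift q x (n + 1) := by
  unfold qShift
  rw [Finset.prod_range_succ', mul_comm]
  congr 1
  · exact Finset.prod_congr rfl fun k _ => by ring
  · ring

theorem zagierSum_mul (q x : R) (N : ℕ) :
    zagierSum q (q * x) N = ∑ n ∈ Finset.range N, qShift q x (n + 1) * (q * x) ^ n := by
  rw [zagierSum, Finset.mul_sum]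
  exact Finset.sum_congr rfl fun n _ => by rw [← mul_assoc, qShift_mul]

/-- The functional equation of the partial sums. -/
theorem zagierSum_add (q x : R) (N : ℕ) :
    zagierSum q x N + q ^ 2 * x ^ 3 * zagierSum q (q * x) N
      = 1 - q * x ^ 2 - qShift q x N * x ^ N * (1 - q ^ (N + 1) * x ^ 2) := by
  rw [zagierSum_mul, zagierSum]
  -- The summands of index N on the left contribute exactly the difference of two consecutive
  -- remainders, so the sum telescopes.
  induction N with
  | zero => simp [qShift]
  | succ N ih =>
    rw [Finset.sum_range_succ, Finset.sum_range_succ]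
    simp only [qShift_succ] at ih ⊢
    linear_combination ih

theorem qShift_one (q : R) (n : ℕ) : qShift q 1 n = qFactorial q n := by
  simp [qShift, qFactorial]

theorem map_zagierSum {S : Type*} [CommRing S] (f : R →+* S) (q x : R) (N : ℕ) :
    f (zagierSum q x N) = zagierSum (f q) (f x) N := by
  simp [zagierSum, qShift, map_sum, map_prod]

end qShift

/-! ### The umbral functional and its shift rule. -/

section umbral

open Polynomial

variable (r : ℕ → ℂ) {A : Type*} [CommRing A] [Algebra ℂ A]

/-- The umbral functional `N^j ↦ r_j`. -/
noncomputable def umbral : A[X] →ₗ[A] A :=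
  Polynomial.lsum fun j => (algebraMap ℂ A (r j)) • LinearMap.id

theorem umbral_monomial (j : ℕ) (a : A) :
    umbral r (monomial j a) = algebraMap ℂ A (r j) * a := by
  simp [umbral, Polynomial.lsum_apply, Algebra.smul_def]

theorem umbral_X_pow (j : ℕ) : umbral r (X ^ j : A[X]) = algebraMap ℂ A (r j) := by
  rw [X_pow_eq_monomial, umbral_monomial, mul_one]

theorem umbral_C_mul (a : A) (P : A[X]) : umbral r (C a * P) = a * umbral r P := by
  rw [← smul_eq_C_mul, map_smul, smul_eq_mul]

theorem umbral_map {B : Type*} [CommRing B] [Algebra ℂ B] (f : A →ₐ[ℂ] B) (P : A[X]) :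
    umbral r (P.map (f : A →+* B)) = f (umbral r P) := by
  induction P using Polynomial.induction_on' with
  | add p q hp hq => simp [Polynomial.map_add, hp, hq]
  | monomial n a => simp [umbral_monomial]

/-- Multiplying the generating series by e^{-6y} is the binomial shift N ↦ N - 6; this is the
coefficient of y^j/j! in the hypothesis. -/
theorem umbral_shift_X_pow
    (h : PowerSeries.mk (fun j => r j / (j.factorial : ℂ)) * (1 + expS (-6))
      = expS (-1) - expS (-5)) (j : ℕ) :
    r j + umbral r (((X : ℂ[X]) + C (-6)) ^ j) = (-1) ^ j - (-5) ^ j := by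
  have h1 := congrArg (PowerSeries.coeff j) h
  rw [mul_add, mul_one, map_add, PowerSeries.coeff_mk, PowerSeries.coeff_mul, map_sub,
    Finset.Nat.sum_antidiagonal_eq_sum_range_succ_mk] at h1
  simp only [coeff_expS, PowerSeries.coeff_mk] at h1
  have hj : (j.factorial : ℂ) ≠ 0 := by exact_mod_cast j.factorial_ne_zero
  have h2 : umbral r (((X : ℂ[X]) + C (-6)) ^ j)
      = j.factorial * ∑ k ∈ Finset.range j.succ, r k / (k.factorial : ℂ) *
        ((-6) ^ (j - k) * algebraMap ℚ ℂ (1 / (j - k).factorial)) := by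
    rw [add_pow, map_sum, Finset.mul_sum]
    refine Finset.sum_congr rfl fun k hk => ?_
    have hk' : k ≤ j := Nat.lt_succ_iff.mp (Finset.mem_range.mp hk)
    have e : (X : ℂ[X]) ^ k * C (-6) ^ (j - k) * (j.choose k : ℂ[X])
        = C ((-6) ^ (j - k) * (j.choose k : ℂ)) * X ^ k := by
      simp only [map_mul, map_pow, map_natCast]; ring
    rw [e, umbral_C_mul, umbral_X_pow, Nat.cast_choose ℂ hk']
    have h3 : (k.factorial : ℂ) ≠ 0 := by exact_mod_cast k.factorial_ne_zero
    have h4 : ((j - k).factorial : ℂ) ≠ 0 := by exact_mod_cast (j - k).factorial_ne_zero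
    simp only [Algebra.algebraMap_self, RingHom.id_apply, map_div₀, map_one, map_natCast]
    field_simp
  rw [h2]
  have h5 : algebraMap ℚ ℂ (1 / j.factorial) = 1 / (j.factorial : ℂ) := by simp
  rw [h5] at h1
  have h6 : (j.factorial : ℂ) * (1 / (j.factorial : ℂ)) = 1 := by field_simp
  have h7 : (j.factorial : ℂ) * (r j / (j.factorial : ℂ)) = r j := by field_simp
  linear_combination (j.factorial : ℂ) * h1 - h7 + ((-1) ^ j - (-5) ^ j) * h6

/-- Expanding (e^{-y} - e^{-5y})/(1 + e^{-6y}) = ∑ χ(n) e^{-ny} shows that r_j plays the role of ∑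
χ(n) (-n)^j. Since χ(n + 6) = -χ(n), adding the shift by 6 leaves only n = 1 and n = 5. -/
theorem umbral_shift
    (h : PowerSeries.mk (fun j => r j / (j.factorial : ℂ)) * (1 + expS (-6))
      = expS (-1) - expS (-5)) (P : A[X]) :
    umbral r P + umbral r (taylorAlgHom (-6) P) = P.eval (-1) - P.eval (-5) := by
  induction P using Polynomial.induction_on' with
  | add p q hp hq =>
    simp only [map_add, eval_add]
    linear_combination hp + hq
  | monomial n a =>
    have e : taylorAlgHom (-6) (monomial n a)
        = C a * (((X : ℂ[X]) + C (-6)) ^ n).map (algebraMap ℂ A) := by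
      have e6 : algebraMap ℂ A (-6) = -6 := by rw [map_neg, map_ofNat]
      rw [Polynomial.map_pow, Polynomial.map_add, map_X, map_C, e6]
      exact taylor_monomial _ _ _
    have e2 := umbral_map r (Algebra.ofId ℂ A) (((X : ℂ[X]) + C (-6)) ^ n)
    have e3 := congrArg (algebraMap ℂ A) (umbral_shift_X_pow r h n)
    rw [e, umbral_C_mul, umbral_monomial]
    change umbral r (map (algebraMap ℂ A) _) = algebraMap ℂ A _ at e2
    rw [e2, eval_monomial, eval_monomial]
    have e4 : algebraMap ℂ A ((-1) ^ n) = (-1) ^ n := by rw [map_pow, map_neg, map_one]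
    have e5 : algebraMap ℂ A ((-5) ^ n) = (-5) ^ n := by rw [map_pow, map_neg, map_ofNat]
    rw [map_add, map_sub, e4, e5] at e3
    linear_combination a * e3

/-- The umbral functional applied to the coefficients of a power series. -/
noncomputable def umbralSeries (f : PowerSeries A[X]) : PowerSeries A :=
  PowerSeries.mk fun k => umbral r (PowerSeries.coeff k f)

theorem umbralSeries_map_C_mul (a : PowerSeries A) (f : PowerSeries A[X]) :
    umbralSeries r (PowerSeries.map C a * f) = a * umbralSeries r f := by
  ext k
  simp [umbralSeries, PowerSeries.coeff_mul, umbral_C_mul]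

end umbral

/-! ### The formal theta expansion of F. -/

section formal

open Polynomial

/-- The exponent `M (1 + N) / 2 + (1 - N²) / 24`, a polynomial in `N` over `ℂ[M]`. -/
noncomputable def thetaExponent : ℂ[X][X] :=
  C X * (C (1 / 2) * (1 + X) : ℂ[X]).map C + (C (1 / 24) * (1 - X ^ 2) : ℂ[X]).map C

/-- A translation keeps the leading coefficient, so the leading coefficient of the sum is twice that
of p. -/
theorem eq_zero_of_add_taylor_eq_zero (p : ℂ[X]) (h : p + taylorAlgHom 1 p = 0) : p = 0 := by
  have h1 : p.coeff p.natDegree + (taylor 1 p).coeff p.natDegree = 0 := by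
    have := congrArg (fun f : ℂ[X] => f.coeff p.natDegree) h
    simpa using this
  have h2 : (taylor 1 p).coeff p.natDegree = p.leadingCoeff := by
    rw [← leadingCoeff_taylor 1 p, leadingCoeff, natDegree_taylor]
  rw [h2] at h1
  have h3 : (2 : ℂ) * p.leadingCoeff = 0 := by rw [two_mul]; exact h1
  exact leadingCoeff_eq_zero.mp ((mul_eq_zero.mp h3).resolve_left two_ne_zero)

/-- Uniqueness for the functional equation. -/
theorem coeff_eq_zero_of_functional (H G : PowerSeries ℂ[X])
    (hG : PowerSeries.coeff 0 G = 1) (K : ℕ)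
    (h : ∀ k < K, PowerSeries.coeff k
      (H + G * PowerSeries.map (taylorAlgHom (1 : ℂ) : ℂ[X] →+* ℂ[X]) H) = 0) :
    ∀ k < K, PowerSeries.coeff k H = 0 := by
  intro k
  induction k using Nat.strong_induction_on with
  | _ k ih =>
    intro hk
    have h1 := h k hk
    -- The lower coefficients of H vanish by induction and G has constant term 1, so only the index
    -- (0, k) survives.
    rw [map_add, PowerSeries.coeff_mul, Finset.sum_eq_single (0, k)] at h1
    · rw [hG, one_mul, PowerSeries.coeff_map] at h1
      exact eq_zero_of_add_taylor_eq_zero _ h1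
    · rintro ⟨i, j⟩ hij hne
      have hij' : i + j = k := by simpa using hij
      have hj : j < k := by
        rcases Nat.eq_zero_or_pos i with h0 | h0
        · exact absurd (by simp [h0, ← hij'] : ((i, j) : ℕ × ℕ) = (0, k)) hne
        · omega
      rw [PowerSeries.coeff_map, ih j hj (by omega), map_zero, mul_zero]
    · intro hn
      exact absurd (by simp) hn

variable (r : ℕ → ℂ)

/-- With x = e^{-Mt}, replacing x by qx is M ↦ M + 1. Completing the square, `thetaExponent` at M +
1 plus -2 - 3M equals `thetaExponent` with N ↦ N - 6, so `umbral_shift` applies. The values at N =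
-1 and N = -5 are 0 and -1 - 2M. -/
theorem umbralSeries_functional
    (h : PowerSeries.mk (fun j => r j / (j.factorial : ℂ)) * (1 + expS (-6))
      = expS (-1) - expS (-5)) :
    umbralSeries r (expS thetaExponent) + expS (-2 - 3 * X : ℂ[X]) *
      PowerSeries.map (taylorAlgHom (1 : ℂ) : ℂ[X] →+* ℂ[X]) (umbralSeries r (expS thetaExponent))
      = 1 - expS (-1 - 2 * X) := by
  have e1 : PowerSeries.map (taylorAlgHom (1 : ℂ) : ℂ[X] →+* ℂ[X])
      (umbralSeries r (expS thetaExponent))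
      = umbralSeries r (expS (thetaExponent.map (taylorAlgHom (1 : ℂ) : ℂ[X] →+* ℂ[X]))) := by
    rw [← coe_mapRingHom, ← map_expS]
    ext1 k
    simp only [umbralSeries, PowerSeries.coeff_map, PowerSeries.coeff_mk, coe_mapRingHom,
      umbral_map]
    rfl
  have e2 : C (-2 - 3 * X : ℂ[X]) + thetaExponent.map (taylorAlgHom (1 : ℂ) : ℂ[X] →+* ℂ[X])
      = taylorAlgHom (-6) thetaExponent := by
    have t1 : (taylorAlgHom (1 : ℂ) : ℂ[X] →+* ℂ[X]) X = X + 1 := by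
      change taylor 1 X = _
      simp
    have t2 : ∀ a : ℂ, (taylorAlgHom (1 : ℂ) : ℂ[X] →+* ℂ[X]) (C a) = C a := by
      intro a
      change taylor 1 (C a) = _
      simp
    have t3 : ∀ a : ℂ[X], taylorAlgHom (-6 : ℂ[X]) (C a) = C a := by
      intro a
      change taylor _ (C a) = _
      simp
    have t4 : taylorAlgHom (-6 : ℂ[X]) X = X - 6 := by
      change taylor _ X = _
      rw [taylor_X, C_neg, ← sub_eq_add_neg, map_ofNat]
    simp only [thetaExponent, Polynomial.map_add, Polynomial.map_mul, Polynomial.map_sub,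
      Polynomial.map_pow, Polynomial.map_one, map_C, map_X, t1, t2, t3, t4, map_add, map_mul,
      map_sub, map_pow, map_one, map_neg, map_ofNat]
    have c1 : (C (C (1 / 2 : ℂ)) : ℂ[X][X]) * 2 = 1 := by
      rw [← map_ofNat (C : ℂ[X] →+* ℂ[X][X]), ← map_ofNat (C : ℂ →+* ℂ[X]), ← C_mul, ← C_mul]
      norm_num
    have c2 : (C (C (1 / 24 : ℂ)) : ℂ[X][X]) * 24 = 1 := by
      rw [← map_ofNat (C : ℂ[X] →+* ℂ[X][X]), ← map_ofNat (C : ℂ →+* ℂ[X]), ← C_mul, ← C_mul]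
      norm_num
    have c3 : (C (C (1 / 2 : ℂ)) : ℂ[X][X]) = 12 * C (C (1 / 24 : ℂ)) := by
      linear_combination 12 * C (C (1 / 24 : ℂ)) * c1 - C (C (1 / 2 : ℂ)) * c2
    rw [c3]
    linear_combination (2 + 3 * C X) * c2
  have e3 : expS (-2 - 3 * X : ℂ[X]) *
      umbralSeries r (expS (thetaExponent.map (taylorAlgHom (1 : ℂ) : ℂ[X] →+* ℂ[X])))
      = umbralSeries r (expS (taylorAlgHom (-6) thetaExponent)) := by
    rw [← umbralSeries_map_C_mul, map_expS, expS_mul_expS, e2]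
  have e4 : (thetaExponent).eval (-1) = 0 := by
    simp [thetaExponent]
  have e5 : (thetaExponent).eval (-5) = -1 - 2 * X := by
    simp only [thetaExponent, eval_add, eval_mul, eval_C, Polynomial.map_mul, Polynomial.map_add,
      Polynomial.map_sub, map_C, map_X, Polynomial.map_one, Polynomial.map_pow, eval_sub,
      eval_one, eval_X, eval_pow]
    have c1 : (C (1 / 2 : ℂ) : ℂ[X]) * 2 = 1 := by
      rw [← map_ofNat (C : ℂ →+* ℂ[X]), ← C_mul]; norm_num
    have c2 : (C (1 / 24 : ℂ) : ℂ[X]) * 24 = 1 := by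
      rw [← map_ofNat (C : ℂ →+* ℂ[X]), ← C_mul]; norm_num
    linear_combination -2 * X * c1 - c2
  rw [e1, e3]
  have e6 : PowerSeries.map (evalRingHom (-1 : ℂ[X])) (expS thetaExponent)
      - PowerSeries.map (evalRingHom (-5 : ℂ[X])) (expS thetaExponent)
      = 1 - expS (-1 - 2 * X) := by
    rw [map_expS, map_expS, coe_evalRingHom, coe_evalRingHom, e4, e5, expS_zero]
  rw [← e6]
  have e7 : expS (taylorAlgHom (-6 : ℂ[X]) thetaExponent)
      = PowerSeries.map (taylorAlgHom (-6 : ℂ[X]) : ℂ[X][X] →+* ℂ[X][X]) (expS thetaExponent) := by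
    rw [map_expS]; rfl
  rw [e7]
  ext1 k
  simp only [umbralSeries, map_add, map_sub, PowerSeries.coeff_mk, PowerSeries.coeff_map,
    coe_evalRingHom]
  exact umbral_shift r h _

/-- Both sides solve the same functional equation modulo t^K, and its solution is unique there. -/
theorem coeff_zagierSum_eq
    (h : PowerSeries.mk (fun j => r j / (j.factorial : ℂ)) * (1 + expS (-6))
      = expS (-1) - expS (-5)) (K k : ℕ) (hk : k < K) :
    PowerSeries.coeff k (zagierSum (expS (-1 : ℂ[X])) (expS (-X)) K)
      = umbral r (PowerSeries.coeff k (expS thetaExponent)) := by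
  have key := coeff_eq_zero_of_functional
    (zagierSum (expS (-1 : ℂ[X])) (expS (-X)) K - umbralSeries r (expS thetaExponent))
    (expS (-2 - 3 * X)) (by simp [coeff_expS]) K ?_ k hk
  · rw [map_sub, sub_eq_zero] at key
    rw [key, umbralSeries, PowerSeries.coeff_mk]
  · intro j hj
    have h1 := zagierSum_add (expS (-1 : ℂ[X])) (expS (-X)) K
    have h2 := umbralSeries_functional r h
    have h3 : PowerSeries.map (taylorAlgHom (1 : ℂ) : ℂ[X] →+* ℂ[X])
        (zagierSum (expS (-1 : ℂ[X])) (expS (-X)) K)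
        = zagierSum (expS (-1 : ℂ[X])) (expS (-1) * expS (-X)) K := by
      have t1 : (taylorAlgHom (1 : ℂ) : ℂ[X] →+* ℂ[X]) X = X + 1 := by
        change taylor 1 X = _
        simp
      rw [map_zagierSum, map_expS, map_expS, expS_mul_expS]
      simp only [map_neg, map_one, t1]
      congr 2
      ring
    have h4 : expS (-1 : ℂ[X]) ^ 2 * expS (-X) ^ 3 = expS (-2 - 3 * X) := by
      rw [expS_pow, expS_pow, expS_mul_expS]; congr 1; push_cast; ring
    have h5 : expS (-1 : ℂ[X]) * expS (-X) ^ 2 = expS (-1 - 2 * X) := by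
      rw [expS_pow, expS_mul_expS]; congr 1; push_cast; ring
    rw [h4, h5] at h1
    rw [map_sub, h3]
    -- Each of the K factors of `qShift` is 1 minus an exponential, hence divisible by t.
    have h6 : (PowerSeries.X : PowerSeries ℂ[X]) ^ K ∣
        qShift (expS (-1 : ℂ[X])) (expS (-X)) K * expS (-X) ^ K
          * (1 - expS (-1) ^ (K + 1) * expS (-X) ^ 2) := by
      refine Dvd.dvd.mul_right (Dvd.dvd.mul_right ?_ _) _
      have := Finset.prod_dvd_prod_of_dvd (s := Finset.range K)
        (fun _ => (PowerSeries.X : PowerSeries ℂ[X]))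
        (fun k => 1 - expS (-1 : ℂ[X]) ^ (k + 1) * expS (-X)) (fun k _ => by
          simp only [expS_pow, expS_mul_expS]
          exact X_dvd_one_sub_expS _)
      simpa [qShift] using this
    have h7 := (PowerSeries.X_pow_dvd_iff.mp h6) j hj
    have h8 : zagierSum (expS (-1 : ℂ[X])) (expS (-X)) K - umbralSeries r (expS thetaExponent)
        + expS (-2 - 3 * X) * (zagierSum (expS (-1 : ℂ[X])) (expS (-1) * expS (-X)) K
          - PowerSeries.map (taylorAlgHom (1 : ℂ) : ℂ[X] →+* ℂ[X])
            (umbralSeries r (expS thetaExponent)))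
        = -(qShift (expS (-1 : ℂ[X])) (expS (-X)) K * expS (-X) ^ K
          * (1 - expS (-1) ^ (K + 1) * expS (-X) ^ 2)) := by
      linear_combination h1 - h2
    rw [h8, map_neg, h7, neg_zero]

/-- The exponent is Mα + β, and the part of (Mα + β)^{k+1} linear in M is (k+1) M α β^k. -/
theorem coeff_one_umbral_pow (k : ℕ) :
    (umbral r (thetaExponent ^ (k + 1))).coeff 1
      = (k + 1) * umbral r ((C (1 / 2) * (1 + X) : ℂ[X]) * (C (1 / 24) * (1 - X ^ 2)) ^ k) := by
  have umb : ∀ P : ℂ[X], umbral r (P.map (C : ℂ →+* ℂ[X])) = C (umbral r P) := fun P =>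
    umbral_map r (Algebra.ofId ℂ ℂ[X]) P
  rw [thetaExponent, add_comm]
  set α : ℂ[X] := C (1 / 2) * (1 + X)
  set β : ℂ[X] := C (1 / 24) * (1 - X ^ 2)
  obtain ⟨Z, hZ⟩ := powAddExpansion (β.map (C : ℂ →+* ℂ[X])) (C X * α.map C) (k + 1)
  have e : β.map C ^ (k + 1) + ((k + 1 : ℕ) : ℂ[X][X]) * β.map C ^ (k + 1 - 1) * (C X * α.map C)
      + Z * (C X * α.map C) ^ 2
      = (β ^ (k + 1)).map C + C X * (((k + 1 : ℂ[X]) * (α * β ^ k)).map C)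
        + C (X ^ 2) * (Z * α.map C ^ 2) := by
    simp only [Polynomial.map_mul, Polynomial.map_pow, Polynomial.map_add, map_pow,
      Polynomial.map_natCast, Polynomial.map_one, Nat.add_sub_cancel]
    push_cast
    ring
  rw [hZ, e, map_add, map_add, umb, umbral_C_mul, umbral_C_mul, umb, coeff_add, coeff_add,
    coeff_C, coeff_X_mul, coeff_C_zero]
  have e2 : (X ^ 2 * umbral r (Z * α.map C ^ 2)).coeff 1 = 0 := by
    rw [coeff_X_pow_mul']; simp
  have e3 : ((k + 1 : ℂ[X]) * (α * β ^ k)) = C (k + 1 : ℂ) * (α * β ^ k) := by simp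
  rw [e2, e3, umbral_C_mul]
  simp

/-- The coefficient of M is minus the derivative at x = 1 scaled by t. On the q-side the prefactor 1
- e^{-Mt} = Mt - ⋯ supplies the M, so the remaining factor may be taken at x = 1, where it is ∑
(q)_n. -/
theorem coeff_fFormal_eq_umbral
    (h : PowerSeries.mk (fun j => r j / (j.factorial : ℂ)) * (1 + expS (-6))
      = expS (-1) - expS (-5)) :
    fFormal = umbralSeries r (PowerSeries.C (C (1 / 2) * (1 + X) : ℂ[X])
      * expS (C (1 / 24) * (1 - X ^ 2))) := by
  ext1 k
  rw [umbralSeries, PowerSeries.coeff_mk, PowerSeries.coeff_C_mul, coeff_expS]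
  -- The prefactor costs one power of t, so the coefficient of t^k in f is read off at t^{k+1}.
  have h1 := congrArg (fun p : ℂ[X] => p.coeff 1) (coeff_zagierSum_eq r h (k + 2) (k + 1) (by omega))
  simp only [coeff_expS] at h1
  have alg : ∀ q : ℚ, algebraMap ℚ ℂ[X][X] q = C (C (q : ℂ)) := fun q => rfl
  have alg' : ∀ q : ℚ, algebraMap ℚ ℂ[X] q = C (q : ℂ) := fun q => rfl
  rw [alg, mul_comm (thetaExponent ^ _), umbral_C_mul, coeff_C_mul, coeff_one_umbral_pow] at h1
  rw [alg', ← mul_assoc, mul_comm _ (C _), umbral_C_mul]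
  have hfac : (((1 / ((k + 1).factorial : ℚ) : ℚ)) : ℂ) * (k + 1) = ((1 / (k.factorial : ℚ) : ℚ) : ℂ) := by
    push_cast [Nat.factorial_succ]
    have : (k : ℂ) + 1 ≠ 0 := by exact_mod_cast Nat.succ_ne_zero k
    field_simp
  rw [← hfac, mul_assoc, ← h1]
  rw [zagierSum, PowerSeries.coeff_mul, finsetSum_coeff, Finset.sum_eq_single (1, k)]
  · have e0 : ∀ m : ℕ, (PowerSeries.coeff m (∑ n ∈ Finset.range (k + 2),
        qShift (expS (-1 : ℂ[X])) (expS (-X)) n * expS (-X) ^ n)).coeff 0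
        = PowerSeries.coeff m (∑ n ∈ Finset.range (k + 2), qFactorial (expSeries (-1)) n) := by
      intro m
      have : PowerSeries.map (constantCoeff : ℂ[X] →+* ℂ) (∑ n ∈ Finset.range (k + 2),
          qShift (expS (-1 : ℂ[X])) (expS (-X)) n * expS (-X) ^ n)
          = ∑ n ∈ Finset.range (k + 2), qFactorial (expSeries (-1)) n := by
        rw [map_sum]
        refine Finset.sum_congr rfl fun n _ => ?_
        rw [map_mul, map_pow, map_expS, map_neg, constantCoeff_apply, coeff_X_zero, neg_zero,
          expS_zero, one_pow, mul_one, ← qShift_one, expSeries_eq_expS]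
        simp [qShift, map_prod, map_expS, expS_zero]
      rw [← this, PowerSeries.coeff_map, constantCoeff_apply]
    have e1 : PowerSeries.coeff 1 (1 - expS (-X : ℂ[X])) = X := by
      rw [map_sub, coeff_expS, PowerSeries.coeff_one]
      simp
    rw [e1, coeff_X_mul, e0, coeff_fFormal k (k + 2) (by omega)]
  · rintro ⟨i, j⟩ hij hne
    have hij' : i + j = k + 1 := by simpa using hij
    rcases Nat.lt_or_ge i 2 with hi | hi
    · interval_cases i
      · have : PowerSeries.coeff 0 (1 - expS (-X : ℂ[X])) = 0 := by
          rw [map_sub, coeff_expS]; simp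
        simp only [this, zero_mul, coeff_zero]
      · exact absurd (by simp; omega) hne
    · have : PowerSeries.coeff i (1 - expS (-X : ℂ[X])) = X ^ i * (-(-1) ^ i * algebraMap ℚ ℂ[X] (1 / i.factorial)) := by
        rw [map_sub, coeff_expS, PowerSeries.coeff_one, if_neg (by omega), neg_pow]
        ring
      simp only [this]
      -- For i ≥ 2 the term carries M^i and has no part linear in M.
      rw [mul_assoc, coeff_X_pow_mul', if_neg (by omega)]
  · intro hn
    exact absurd (by simp; omega) hn

/-- The factor e^{-t/24} cancels the constant 1/24 in the exponent and leaves (1 + N)/2 · e^{-t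
N²/24}. -/
theorem coeff_F_eq
    (h : PowerSeries.mk (fun j => r j / (j.factorial : ℂ)) * (1 + expS (-6))
      = expS (-1) - expS (-5)) (k : ℕ) :
    PowerSeries.coeff k F = (r (2 * k) + r (2 * k + 1)) / 2 * (-1 / 24) ^ k / k.factorial := by
  have e1 : F = umbralSeries r (PowerSeries.C (C (1 / 2) * (1 + X) : ℂ[X])
      * expS (C (-1 / 24) * X ^ 2)) := by
    rw [F, coeff_fFormal_eq_umbral r h, expSeries_eq_expS, ← umbralSeries_map_C_mul, map_expS,
      mul_left_comm, expS_mul_expS]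
    congr 3
    rw [mul_sub, mul_one, ← add_sub_assoc, ← C_add, show (-1 / 24 + 1 / 24 : ℂ) = 0 by norm_num,
      C_0, zero_sub, ← neg_mul, ← C_neg]
    norm_num
  have alg' : ∀ q : ℚ, algebraMap ℚ ℂ[X] q = C (q : ℂ) := fun q => rfl
  rw [e1, umbralSeries, PowerSeries.coeff_mk, PowerSeries.coeff_C_mul, coeff_expS, alg']
  have e2 : (C (1 / 2) * (1 + X) * ((C (-1 / 24) * X ^ 2) ^ k * C ((1 / (k.factorial : ℚ) : ℚ) : ℂ)) : ℂ[X])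
      = C (1 / 2 * (-1 / 24) ^ k * ((1 / (k.factorial : ℚ) : ℚ) : ℂ)) * (X ^ (2 * k) + X ^ (2 * k + 1)) := by
    simp only [map_mul, map_pow, mul_pow]
    ring
  rw [e2, umbral_C_mul, map_add, umbral_X_pow, umbral_X_pow]
  push_cast
  simp only [Algebra.algebraMap_self, RingHom.id_apply]
  ring

end formal

/-! ### The coefficients of F as values of L(χ, 2k+2). -/

theorem _root_.HasSum.of_eq {ι : Type*} {f g : ι → ℂ} {a b : ℂ} (h : HasSum f a)
    (hfg : ∀ i, f i = g i) (hab : a = b) : HasSum g b := by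
  rw [← funext hfg, ← hab]; exact h

/-- The alternating sum of the `n`-th Bernoulli polynomial over the residues prime to `12`. -/
noncomputable def bernoulliChi (n : ℕ) : ℚ :=
  (Polynomial.bernoulli n).eval (1 / 12) - (Polynomial.bernoulli n).eval (5 / 12)
    - (Polynomial.bernoulli n).eval (7 / 12) + (Polynomial.bernoulli n).eval (11 / 12)

/-- The Taylor coefficients `r_j` of `∑ r_j y^j / j! = sinh (2 y) / cosh (3 y)`. -/
noncomputable def moment (j : ℕ) : ℂ :=
  (-12) ^ (j + 1) / 12 / (j + 1) * (bernoulliChi (j + 1) : ℂ)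

open PowerSeries in
-- This is the Bernoulli generating function with variable -12y, combined over the four residues
-- prime to 12. It shows that `moment` satisfies the hypothesis of the umbral lemmas.
theorem moment_generating_function :
    PowerSeries.mk (fun j => moment j / (j.factorial : ℂ)) * (1 + expS (-6))
      = expS (-1) - expS (-5) := by
  have gen : ∀ q : ℚ, rescale (-12 : ℂ)
      (mk fun n => (((1 / (n.factorial : ℚ)) * (Polynomial.bernoulli n).eval q : ℚ) : ℂ))
        * (expS (-12) - 1) = C (-12) * X * expS (-12 * q : ℂ) := by
    intro q
    have h := congrArg (rescale (-12 : ℂ))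
      (Polynomial.bernoulli_generating_function (A := ℂ) (q : ℂ))
    rw [map_mul, map_sub, map_one, map_mul, rescale_X, rescale_rescale] at h
    rw [mul_comm (-12 : ℂ) (q : ℂ)]
    refine Eq.trans ?_ h
    congr 3
    ext n
    rw [map_smul]
    have : (Polynomial.aeval (q : ℂ)) (Polynomial.bernoulli n)
        = (((Polynomial.bernoulli n).eval q : ℚ) : ℂ) :=
      Polynomial.aeval_algebraMap_apply_eq_algebraMap_eval q _
    rw [this, Algebra.smul_def]
    push_cast
    simp
  have h1 := gen (1 / 12)
  have h5 := gen (5 / 12)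
  have h7 := gen (7 / 12)
  have h11 := gen (11 / 12)
  set R : PowerSeries ℂ := PowerSeries.mk (fun j => moment j / (j.factorial : ℂ)) with hR
  have e : rescale (-12 : ℂ) (mk fun n => (((1 / (n.factorial : ℚ)) * bernoulliChi n : ℚ) : ℂ))
      = C 12 * X * R := by
    ext n
    rw [coeff_rescale, coeff_mk, mul_assoc, coeff_C_mul]
    cases n with
    | zero => simp [bernoulliChi]
    | succ j =>
      rw [coeff_succ_X_mul, hR, coeff_mk, moment, Nat.factorial_succ]
      have : (j : ℂ) + 1 ≠ 0 := by exact_mod_cast Nat.succ_ne_zero j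
      have h3 : (j.factorial : ℂ) ≠ 0 := by exact_mod_cast j.factorial_ne_zero
      push_cast
      field_simp
  have e' : (mk fun n => (((1 / (n.factorial : ℚ)) * bernoulliChi n : ℚ) : ℂ))
      = (mk fun n => (((1 / (n.factorial : ℚ)) * (Polynomial.bernoulli n).eval (1 / 12) : ℚ) : ℂ))
      - (mk fun n => (((1 / (n.factorial : ℚ)) * (Polynomial.bernoulli n).eval (5 / 12) : ℚ) : ℂ))
      - (mk fun n => (((1 / (n.factorial : ℚ)) * (Polynomial.bernoulli n).eval (7 / 12) : ℚ) : ℂ))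
      + (mk fun n =>
        (((1 / (n.factorial : ℚ)) * (Polynomial.bernoulli n).eval (11 / 12) : ℚ) : ℂ)) := by
    ext n
    simp only [coeff_mk, map_add, map_sub, bernoulliChi]
    push_cast
    ring
  rw [e', map_add, map_sub, map_sub] at e
  have a1 : (-12 * ((1 / 12 : ℚ) : ℂ)) = -1 := by push_cast; norm_num
  have a5 : (-12 * ((5 / 12 : ℚ) : ℂ)) = -5 := by push_cast; norm_num
  have a7 : (-12 * ((7 / 12 : ℚ) : ℂ)) = -6 + -1 := by push_cast; norm_num
  have a11 : (-12 * ((11 / 12 : ℚ) : ℂ)) = -6 + -5 := by push_cast; norm_num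
  rw [a1] at h1
  rw [a5] at h5
  rw [a7, ← expS_mul_expS] at h7
  rw [a11, ← expS_mul_expS] at h11
  have a12 : expS (-12 : ℂ) = expS (-6) * expS (-6) := by
    rw [expS_mul_expS]; norm_num
  have aC : C (-12 : ℂ) = -C 12 := map_neg _ _
  rw [aC, a12] at h1 h5 h7 h11
  -- The combined identity has e^{-12y} - 1 = (e^{-6y} - 1)(e^{-6y} + 1) on one side and (e^{-y} -
  -- e^{-5y})(1 - e^{-6y}) on the other; the common factor cancels.
  have hne : (C (12 : ℂ) * X * (expS (-6) - 1)) ≠ 0 := by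
    have hc : (C (12 : ℂ)) ≠ 0 := by
      rw [Ne, map_eq_zero_iff _ C_injective]; norm_num
    refine mul_ne_zero (mul_ne_zero hc X_ne_zero) fun h => ?_
    have := congrArg (coeff 1) h
    rw [map_sub, coeff_expS, coeff_one] at this
    norm_num at this
  apply mul_left_cancel₀ hne
  linear_combination -(expS (-6) * expS (-6) - 1) * e + h1 - h5 - h7 + h11

/-- The reflection B_n(1 - x) = -B_n(x) for odd n pairs 1/12 with 11/12 and 5/12 with 7/12. -/
theorem moment_even (k : ℕ) : moment (2 * k) = 0 := by
  have h1 := Polynomial.bernoulli_eval_one_sub (2 * k + 1) (1 / 12)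
  have h5 := Polynomial.bernoulli_eval_one_sub (2 * k + 1) (5 / 12)
  rw [Odd.neg_one_pow ⟨k, rfl⟩] at h1 h5
  norm_num at h1 h5
  have : bernoulliChi (2 * k + 1) = 0 := by
    rw [bernoulliChi, h1, h5]; norm_num
  rw [moment, this]
  simp

/-- The finite Fourier transform of the even primitive character χ is χ times its Gauss sum √12 =
2√3. -/
theorem chi_eq_cos (n : ℕ) :
    ((Real.cos (2 * Real.pi * n * (1 / 12)) - Real.cos (2 * Real.pi * n * (5 / 12))
      - Real.cos (2 * Real.pi * n * (7 / 12)) + Real.cos (2 * Real.pi * n * (11 / 12)) : ℝ) : ℂ)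
      = 2 * (Real.sqrt 3 : ℂ) * chi n := by
  set x := Real.pi * n / 6 with hx
  have e1 : 2 * Real.pi * n * (1 / 12) = x := by rw [hx]; ring
  have e5 : 2 * Real.pi * n * (5 / 12) = n * Real.pi - x := by rw [hx]; ring
  have e7 : 2 * Real.pi * n * (7 / 12) = x + n * Real.pi := by rw [hx]; ring
  have e11 : 2 * Real.pi * n * (11 / 12) = n * (2 * Real.pi) - x := by rw [hx]; ring
  rw [e1, e5, e7, e11, Real.cos_nat_mul_pi_sub, Real.cos_add_nat_mul_pi,
    Real.cos_nat_mul_two_pi_sub]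
  obtain ⟨s, m, hs, hn⟩ : ∃ s m, s < 12 ∧ n = s + 12 * m :=
    ⟨n % 12, n / 12, Nat.mod_lt _ (by norm_num), (Nat.mod_add_div n 12).symm⟩
  have ex : x = s * (Real.pi / 6) + m * (2 * Real.pi) := by
    rw [hx, hn]; push_cast; ring
  have hmod : n % 12 = s := by omega
  have hpow : (-1 : ℝ) ^ n = (-1) ^ s := by
    rw [hn, pow_add, pow_mul]; norm_num
  rw [ex, Real.cos_add_nat_mul_two_pi, hpow, chi, hmod]
  have c1 := Real.cos_pi_div_six
  have c3 : Real.cos (3 * (Real.pi / 6)) = 0 := by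
    rw [show 3 * (Real.pi / 6) = Real.pi / 2 by ring, Real.cos_pi_div_two]
  have c5 : Real.cos (5 * (Real.pi / 6)) = -(Real.sqrt 3 / 2) := by
    rw [show 5 * (Real.pi / 6) = Real.pi - Real.pi / 6 by ring, Real.cos_pi_sub, c1]
  have c7 : Real.cos (7 * (Real.pi / 6)) = -(Real.sqrt 3 / 2) := by
    rw [show 7 * (Real.pi / 6) = Real.pi / 6 + Real.pi by ring, Real.cos_add_pi, c1]
  have c9 : Real.cos (9 * (Real.pi / 6)) = 0 := by
    rw [show 9 * (Real.pi / 6) = Real.pi / 2 + Real.pi by ring, Real.cos_add_pi,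
      Real.cos_pi_div_two, neg_zero]
  have c11 : Real.cos (11 * (Real.pi / 6)) = Real.sqrt 3 / 2 := by
    rw [show 11 * (Real.pi / 6) = 2 * Real.pi - Real.pi / 6 by ring, Real.cos_two_pi_sub, c1]
  interval_cases s <;> norm_num [c1, c3, c5, c7, c9, c11] <;> ring

/-- Fourier series of B_{2k+2} at the four points r/12, with `chi_eq_cos`. In effect this is the
functional equation of L(χ, s) at a negative odd integer. -/
theorem hasSum_moment_odd (k : ℕ) :
    HasSum (fun n : ℕ => ((2 * k + 1).factorial : ℂ) * (-1) ^ k * ((Real.sqrt 3 : ℂ) / 3)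
      * (6 / Real.pi) ^ (2 * k + 2) * (chi n / (n : ℂ) ^ (2 * k + 2))) (moment (2 * k + 1)) := by
  have ev : ∀ q : ℚ, Polynomial.eval (q : ℝ) (Polynomial.map (algebraMap ℚ ℝ)
      (Polynomial.bernoulli (2 * (k + 1))))
      = (((Polynomial.bernoulli (2 * k + 2)).eval q : ℚ) : ℝ) := by
    intro q
    rw [Polynomial.eval_map]
    exact Polynomial.eval₂_at_apply (algebraMap ℚ ℝ) q
  have H : ∀ q : ℚ, 0 ≤ q → q ≤ 1 → _ := fun q h0 h1 =>
    hasSum_one_div_nat_pow_mul_cos (k := k + 1) (Nat.succ_ne_zero k) (x := (q : ℝ))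
      ⟨by exact_mod_cast h0, by exact_mod_cast h1⟩
  simp only [ev] at H
  have h1 := H (1 / 12) (by norm_num) (by norm_num)
  have h5 := H (5 / 12) (by norm_num) (by norm_num)
  have h7 := H (7 / 12) (by norm_num) (by norm_num)
  have h11 := H (11 / 12) (by norm_num) (by norm_num)
  have hs := ((h1.sub h5).sub h7).add h11
  have hs2 := (Complex.hasSum_ofReal.mpr hs).mul_left
    (((2 * k + 1).factorial : ℂ) * (-1) ^ k / 6 * (6 / Real.pi) ^ (2 * k + 2))
  have hpi : (Real.pi : ℂ) ≠ 0 := by exact_mod_cast Real.pi_ne_zero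
  have h3 : (Real.sqrt 3 : ℂ) * (Real.sqrt 3 : ℂ) = 3 := by
    rw [← Complex.ofReal_mul, Real.mul_self_sqrt (by norm_num)]; norm_num
  refine hs2.of_eq (fun n => ?_) ?_
  · have hc := chi_eq_cos n
    push_cast at hc ⊢
    linear_combination (((2 * k + 1).factorial : ℂ) * (-1) ^ k / 6 * (6 / Real.pi) ^ (2 * k + 2))
      * (1 / (n : ℂ) ^ (2 * (k + 1))) * hc
  · symm
    rw [moment, bernoulliChi]
    have hf : (((2 * k + 2).factorial : ℕ) : ℂ) = (2 * k + 2) * (2 * k + 1).factorial := by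
      rw [Nat.factorial_succ]; push_cast; ring
    have hf2 : ((2 * k + 1).factorial : ℂ) ≠ 0 := by exact_mod_cast Nat.factorial_ne_zero _
    have hk : (2 * (k : ℂ) + 2) ≠ 0 := by exact_mod_cast Nat.succ_ne_zero (2 * k + 1)
    have hk1 : ((k : ℂ) + 1) ≠ 0 := by exact_mod_cast Nat.succ_ne_zero k
    have hpow : (-1 : ℂ) ^ (k + 1 + 1) = (-1) ^ k := by ring
    have h12 : (-12 : ℂ) ^ (2 * k + 1 + 1) = 6 ^ (2 * k + 2) * 2 ^ (2 * k + 2) := by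
      rw [← mul_pow, show 2 * k + 1 + 1 = 2 * (k + 1) by ring,
        pow_mul, pow_mul]
      norm_num
    have hsq : (-1 : ℂ) ^ k * (-1) ^ k = 1 := by rw [← mul_pow]; norm_num
    have hcast : (((2 * k + 1 : ℕ) : ℂ) + 1) = 2 * k + 2 := by push_cast; ring
    rw [hcast, h12, show 2 * (k + 1) = 2 * k + 2 by ring]
    push_cast [hf]
    rw [hpow, div_pow, mul_pow, show 2 * k + 1 + 1 = 2 * k + 2 by ring]
    generalize ((Polynomial.eval (1 / 12) (Polynomial.bernoulli (2 * k + 2)) : ℚ) : ℂ) = b1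
    generalize ((Polynomial.eval (5 / 12) (Polynomial.bernoulli (2 * k + 2)) : ℚ) : ℂ) = b5
    generalize ((Polynomial.eval (7 / 12) (Polynomial.bernoulli (2 * k + 2)) : ℚ) : ℂ) = b7
    generalize ((Polynomial.eval (11 / 12) (Polynomial.bernoulli (2 * k + 2)) : ℚ) : ℂ) = b11
    have hpm : (Real.pi : ℂ) ^ (2 * k + 2) ≠ 0 := pow_ne_zero _ hpi
    generalize (Real.pi : ℂ) ^ (2 * k + 2) = p at *
    generalize (6 : ℂ) ^ (2 * k + 2) = s
    generalize (2 : ℂ) ^ (2 * k + 2) = t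
    generalize (-1 : ℂ) ^ k = e at *
    generalize ((2 * k + 1).factorial : ℂ) = f at *
    field_simp
    linear_combination -12 * s * t * (b1 - b5 - b7 + b11) * hsq

theorem hasSum_coeff_F (k : ℕ) :
    HasSum (fun n : ℕ => ((2 * k + 1).factorial : ℂ) / (2 * k.factorial * 24 ^ k)
      * ((Real.sqrt 3 : ℂ) / 3) * (6 / Real.pi) ^ (2 * k + 2) * (chi n / (n : ℂ) ^ (2 * k + 2)))
      (PowerSeries.coeff k F) := by
  rw [coeff_F_eq moment moment_generating_function, moment_even, zero_add]
  have h := (hasSum_moment_odd k).mul_left ((-1 / 24) ^ k / (2 * k.factorial : ℂ))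
  have hsq : (-1 : ℂ) ^ k * (-1) ^ k = 1 := by rw [← mul_pow]; norm_num
  have hf2 : (k.factorial : ℂ) ≠ 0 := by exact_mod_cast Nat.factorial_ne_zero _
  refine h.of_eq (fun n => ?_) (by ring)
  · rw [div_pow (-1 : ℂ)]
    linear_combination (((2 * k + 1).factorial : ℂ) / (2 * k.factorial * 24 ^ k)
      * ((Real.sqrt 3 : ℂ) / 3) * (6 / Real.pi) ^ (2 * k + 2)
      * (chi n / (n : ℂ) ^ (2 * k + 2))) * hsq

/-! ### The Borel transform as a sum of powers (1 - 6p/(π² n²))^{-5/2}. -/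

theorem norm_chi_le (n : ℕ) : ‖chi n‖ ≤ 1 := by
  unfold chi
  split_ifs <;> simp

theorem chi_zero : chi 0 = 0 := by simp [chi]

/-- The `n`-th Taylor coefficient of `(1 - z)^{-5/2}`. -/
noncomputable def fiveHalvesCoeff (n : ℕ) : ℝ :=
  2 / 3 * (2 * n + 3).factorial / ((n + 1).factorial * n.factorial * 4 ^ (n + 1))

theorem fiveHalvesCoeff_pos (n : ℕ) : 0 < fiveHalvesCoeff n := by
  unfold fiveHalvesCoeff; positivity

theorem fiveHalvesCoeff_succ (n : ℕ) :
    (n + 1) * fiveHalvesCoeff (n + 1) = (5 / 2 + n) * fiveHalvesCoeff n := by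
  unfold fiveHalvesCoeff
  have e : (2 * (n + 1) + 3).factorial = (2 * n + 5) * ((2 * n + 4) * (2 * n + 3).factorial) := by
    rw [show 2 * (n + 1) + 3 = (2 * n + 3) + 1 + 1 by ring, Nat.factorial_succ, Nat.factorial_succ]
  rw [e, Nat.factorial_succ (n + 1), Nat.factorial_succ n]
  have h1 : (n.factorial : ℝ) ≠ 0 := by exact_mod_cast n.factorial_ne_zero
  push_cast
  field_simp
  ring

theorem choose_eq_fiveHalvesCoeff (n : ℕ) :
    Ring.choose ((5 / 2 : ℂ) + n - 1) n = (fiveHalvesCoeff n : ℂ) := by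
  rw [← Ring.multichoose_eq]
  have h := Ring.factorial_nsmul_multichoose_eq_ascPochhammer (5 / 2 : ℂ) n
  rw [Polynomial.ascPochhammer_smeval_eq_eval, nsmul_eq_mul] at h
  have h0 : (n.factorial : ℂ) ≠ 0 := by exact_mod_cast n.factorial_ne_zero
  have h2 : ∀ m : ℕ, Polynomial.eval (5 / 2 : ℂ) (ascPochhammer ℂ m)
      = m.factorial * (fiveHalvesCoeff m : ℂ) := by
    intro m
    induction m with
    | zero => norm_num [fiveHalvesCoeff, Nat.factorial]
    | succ m ih =>
      have := fiveHalvesCoeff_succ m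
      have h3 : ((m : ℂ) + 1) * (fiveHalvesCoeff (m + 1) : ℂ)
          = (5 / 2 + m) * (fiveHalvesCoeff m : ℂ) := by
        have := congrArg (fun x : ℝ => (x : ℂ)) this
        push_cast at this
        exact this
      rw [ascPochhammer_succ_eval, ih, Nat.factorial_succ]
      push_cast
      linear_combination -(m.factorial : ℂ) * h3
  rw [h2] at h
  exact mul_left_cancel₀ h0 h

theorem hasSum_fiveHalves {z : ℂ} (hz : ‖z‖ < 1) :
    HasSum (fun n => (fiveHalvesCoeff n : ℂ) * z ^ n) ((1 - z) ^ (-((5 / 2 : ℝ) : ℂ))) := by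
  have h := (Complex.one_div_one_sub_cpow_hasFPowerSeriesOnBall_zero (5 / 2)).hasSum
    (y := z) (by
      rw [Metric.mem_eball, edist_zero_right, ← ofReal_norm]
      exact ENNReal.ofReal_lt_one.mpr hz)
  refine h.of_eq (fun n => ?_) ?_
  · rw [FormalMultilinearSeries.ofScalars_apply_eq, choose_eq_fiveHalvesCoeff, smul_eq_mul]
  · rw [zero_add, Complex.cpow_neg, one_div]
    push_cast
    rfl

theorem summable_fiveHalvesCoeff :
    Summable fun n => fiveHalvesCoeff n * (1 / 2 : ℝ) ^ n := by
  have h := (hasSum_fiveHalves (z := ((1 / 2 : ℝ) : ℂ)) (by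
    rw [Complex.norm_real]; norm_num)).summable
  have h2 : Summable fun n => ((fiveHalvesCoeff n * (1 / 2 : ℝ) ^ n : ℝ) : ℂ) := by
    simpa using h
  exact Complex.summable_ofReal.mp h2

/-- The inverses `6 / (π² n²)` of the branch points of the Borel transform. -/
noncomputable def invBranch (n : ℕ) : ℝ := 6 / (Real.pi ^ 2 * (n : ℝ) ^ 2)

theorem invBranch_nonneg (n : ℕ) : 0 ≤ invBranch n := by unfold invBranch; positivity

/-- All branch points lie outside the open unit disc because π² > 6. At n = 0 division by zero makes
the value 0, which is harmless since χ(0) = 0. -/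
theorem invBranch_le_one (n : ℕ) : invBranch n ≤ 1 := by
  rcases Nat.eq_zero_or_pos n with rfl | hn
  · simp [invBranch]
  · have h1 : (1 : ℝ) ≤ n := by exact_mod_cast hn
    have h3 := Real.pi_gt_three
    rw [invBranch, div_le_one (by positivity)]
    nlinarith [mul_le_mul h3.le h3.le (by norm_num) (by positivity),
      mul_le_mul h1 h1 (by norm_num) (by positivity), Real.pi_pos,
      sq_nonneg Real.pi, sq_nonneg (n : ℝ)]

/-- The `n`-th term of the Borel transform. -/
noncomputable def borelTerm (n : ℕ) (p : ℂ) : ℂ :=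
  (54 * (Real.sqrt 3 : ℂ) / (Real.pi : ℂ) ^ 4) * (chi n / (n : ℂ) ^ 4)
    * (1 - invBranch n * p) ^ (-((5 / 2 : ℝ) : ℂ))

/-- The analytic continuation of the Borel transform. -/
noncomputable def borelSum (p : ℂ) : ℂ := ∑' n, borelTerm n p

/-- The constant `54 √3 / π⁴`. -/
noncomputable def borelConst : ℝ := 54 * Real.sqrt 3 / Real.pi ^ 4

theorem borelConst_nonneg : 0 ≤ borelConst := by unfold borelConst; positivity

theorem norm_borelTerm (n : ℕ) (p : ℂ) :
    ‖borelTerm n p‖ = borelConst * (‖chi n‖ / (n : ℝ) ^ 4)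
      * ‖1 - invBranch n * p‖ ^ (-(5 / 2) : ℝ) := by
  have h : (54 * (Real.sqrt 3 : ℂ) / (Real.pi : ℂ) ^ 4) = (borelConst : ℂ) := by
    rw [borelConst]; push_cast; rfl
  rw [borelTerm, h, norm_mul, norm_mul, Complex.norm_real, Real.norm_of_nonneg borelConst_nonneg,
    norm_div, norm_pow, Complex.norm_natCast, ← Complex.ofReal_neg, Complex.norm_cpow_real]

theorem norm_borelTerm_le {n : ℕ} {p : ℂ} {κ : ℝ} (hκ : 0 < κ)
    (h : κ ≤ ‖1 - invBranch n * p‖) :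
    ‖borelTerm n p‖ ≤ borelConst * κ ^ (-(5 / 2) : ℝ) * (1 / (n : ℝ) ^ 4) := by
  rw [norm_borelTerm]
  have h1 : ‖1 - invBranch n * p‖ ^ (-(5 / 2) : ℝ) ≤ κ ^ (-(5 / 2) : ℝ) :=
    Real.rpow_le_rpow_of_nonpos hκ h (by norm_num)
  have h2 : ‖chi n‖ / (n : ℝ) ^ 4 ≤ 1 / (n : ℝ) ^ 4 := by
    gcongr; exact norm_chi_le n
  calc _ ≤ borelConst * (1 / (n : ℝ) ^ 4) * κ ^ (-(5 / 2) : ℝ) := by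
        have := borelConst_nonneg
        gcongr
    _ = _ := by ring

theorem summable_borel_bound (κ : ℝ) :
    Summable fun n : ℕ => borelConst * κ ^ (-(5 / 2) : ℝ) * (1 / (n : ℝ) ^ 4) :=
  (Real.summable_one_div_nat_pow.mpr (by norm_num)).mul_left _

theorem norm_borelSum_le {p : ℂ} {κ : ℝ} (hκ : 0 < κ) (h : ∀ n, κ ≤ ‖1 - invBranch n * p‖) :
    ‖borelSum p‖ ≤ ∑' n : ℕ, borelConst * κ ^ (-(5 / 2) : ℝ) * (1 / (n : ℝ) ^ 4) :=
  tsum_of_norm_bounded (summable_borel_bound κ).hasSum fun n => norm_borelTerm_le hκ (h n)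

theorem differentiableOn_borelSum {U : Set ℂ} (hU : IsOpen U) {κ : ℝ} (hκ : 0 < κ)
    (h : ∀ p ∈ U, ∀ n, κ ≤ ‖1 - invBranch n * p‖)
    (hs : ∀ p ∈ U, ∀ n, 1 - invBranch n * p ∈ Complex.slitPlane) :
    DifferentiableOn ℂ borelSum U := by
  refine Complex.differentiableOn_tsum_of_summable_norm (summable_borel_bound κ) (fun n => ?_) hU
    (fun n p hp => norm_borelTerm_le hκ (h p hp n))
  intro p hp
  refine DifferentiableAt.differentiableWithinAt ?_
  unfold borelTerm
  refine DifferentiableAt.const_mul ?_ _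
  exact DifferentiableAt.cpow_const (by fun_prop) (hs p hp n)

/-- The distance from `1` to a line through `0`. -/
theorem abs_im_le_norm_mul (c : ℝ) (p : ℂ) : |p.im| ≤ ‖1 - c * p‖ * ‖p‖ := by
  have h : ((1 - c * p) * (starRingEnd ℂ) p).im = -p.im := by
    simp only [Complex.mul_im, Complex.sub_re, Complex.sub_im, Complex.conj_re, Complex.conj_im,
      Complex.one_re, Complex.one_im, Complex.mul_re, Complex.ofReal_re, Complex.ofReal_im]
    ring
  have h2 := Complex.abs_im_le_norm ((1 - c * p) * (starRingEnd ℂ) p)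
  rwa [h, abs_neg, norm_mul, RCLike.norm_conj] at h2

theorem mem_slitPlane_of_im_ne_zero {c : ℝ} {p : ℂ} (hp : p.im ≠ 0) :
    1 - c * p ∈ Complex.slitPlane := by
  rw [Complex.mem_slitPlane_iff]
  by_cases hc : c = 0
  · left; simp [hc]
  · right; simp [hc, hp]

theorem differentiableOn_borelSum_halfPlane (s : ℝ) :
    DifferentiableOn ℂ borelSum {p : ℂ | 0 < s * p.im} := by
  intro p0 hp0
  have hp0' : 0 < s * p0.im := hp0
  have him : p0.im ≠ 0 := fun h => by simp [h] at hp0'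
  have hn : 0 < ‖p0‖ := norm_pos_iff.mpr fun h => him (by simp [h])
  set κ := |p0.im| / ‖p0‖ / 2 with hκ
  have hκ0 : 0 < κ := by have := abs_pos.mpr him; positivity
  -- On this double cone `abs_im_le_norm_mul` bounds all terms by the same κ. Half the ratio |Im p|
  -- / ‖p‖ at p0 is chosen so that p0 lies inside.
  have hU : IsOpen {p : ℂ | κ * ‖p‖ < |p.im|} :=
    isOpen_lt (by fun_prop) (Complex.continuous_im.abs)
  have hmem : p0 ∈ {p : ℂ | κ * ‖p‖ < |p.im|} := by
    have : κ * ‖p0‖ = |p0.im| / 2 := by rw [hκ]; field_simp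
    change κ * ‖p0‖ < |p0.im|
    rw [this]
    have := abs_pos.mpr him
    linarith
  refine ((differentiableOn_borelSum hU hκ0 (fun p hp n => ?_)
    (fun p hp n => ?_)).differentiableAt (hU.mem_nhds hmem)).differentiableWithinAt
  · have h1 := abs_im_le_norm_mul (invBranch n) p
    have h2 : κ * ‖p‖ < |p.im| := hp
    by_contra hlt
    push Not at hlt
    have := mul_le_mul_of_nonneg_right hlt.le (norm_nonneg p)
    linarith
  · have h2 : κ * ‖p‖ < |p.im| := hp
    exact mem_slitPlane_of_im_ne_zero fun h => by
      rw [h, abs_zero] at h2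
      have := mul_nonneg hκ0.le (norm_nonneg p)
      linarith

theorem differentiableOn_borelSum_ball :
    DifferentiableOn ℂ borelSum (Metric.ball 0 (1 / 2)) := by
  have key : ∀ p ∈ Metric.ball (0 : ℂ) (1 / 2), ∀ n, ‖(invBranch n : ℂ) * p‖ ≤ 1 / 2 := by
    intro p hp n
    have hp' : ‖p‖ < 1 / 2 := by simpa using hp
    rw [norm_mul, Complex.norm_real, Real.norm_of_nonneg (invBranch_nonneg n)]
    have := mul_le_mul (invBranch_le_one n) hp'.le (norm_nonneg p) zero_le_one
    linarith
  refine differentiableOn_borelSum Metric.isOpen_ball (κ := 1 / 2) (by norm_num) ?_ ?_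
  · intro p hp n
    have h1 := norm_sub_norm_le (1 : ℂ) (invBranch n * p)
    rw [norm_one] at h1
    linarith [key p hp n]
  · intro p hp n
    rw [Complex.mem_slitPlane_iff]
    left
    have := (Complex.abs_re_le_norm _).trans (key p hp n)
    have := (abs_le.mp this).2
    rw [Complex.sub_re, Complex.one_re]
    linarith

/-- The terms of the double series for the Borel transform. -/
noncomputable def borelDouble (p : ℂ) (x : ℕ × ℕ) : ℂ :=
  (54 * (Real.sqrt 3 : ℂ) / (Real.pi : ℂ) ^ 4)
    * (chi x.1 / (x.1 : ℂ) ^ 4) * ((fiveHalvesCoeff x.2 : ℂ) * (invBranch x.1 * p) ^ x.2)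

theorem norm_invBranch_mul_le {p : ℂ} (hp : ‖p‖ < 1 / 2) (n : ℕ) :
    ‖(invBranch n : ℂ) * p‖ ≤ 1 / 2 := by
  rw [norm_mul, Complex.norm_real, Real.norm_of_nonneg (invBranch_nonneg n)]
  have := mul_le_mul (invBranch_le_one n) hp.le (norm_nonneg p) zero_le_one
  linarith

theorem summable_borelDouble {p : ℂ} (hp : ‖p‖ < 1 / 2) : Summable (borelDouble p) := by
  have h1 : Summable fun n : ℕ => borelConst * (1 / (n : ℝ) ^ 4) :=
    (Real.summable_one_div_nat_pow.mpr (by norm_num)).mul_left _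
  have h2 := h1.mul_of_nonneg summable_fiveHalvesCoeff
    (fun n => by have := borelConst_nonneg; positivity)
    (fun n => by have := fiveHalvesCoeff_pos n; positivity)
  refine Summable.of_norm_bounded h2 fun x => ?_
  have h : (54 * (Real.sqrt 3 : ℂ) / (Real.pi : ℂ) ^ 4) = (borelConst : ℂ) := by
    rw [borelConst]; push_cast; rfl
  rw [borelDouble, h, norm_mul, norm_mul, norm_mul, Complex.norm_real, Complex.norm_real, norm_pow,
    Real.norm_of_nonneg borelConst_nonneg, Real.norm_of_nonneg (fiveHalvesCoeff_pos _).le,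
    norm_div, norm_pow, Complex.norm_natCast]
  have := borelConst_nonneg
  have := fiveHalvesCoeff_pos x.2
  have h3 := norm_chi_le x.1
  have h4 := norm_invBranch_mul_le hp x.1
  gcongr

/-- At k = 0 the coefficient is 3!/(2·24) · √3/3 · (6/π)⁴ = 54√3/π⁴. Relative to it, the dependence
on k is the Taylor coefficient of (1 - z)^{-5/2} at z = 6p/(π² n²). -/
theorem borel_coeff_term (p : ℂ) (n k : ℕ) :
    ((2 * (k + 1) + 1).factorial : ℂ) / (2 * (k + 1).factorial * 24 ^ (k + 1))
      * ((Real.sqrt 3 : ℂ) / 3) * (6 / Real.pi) ^ (2 * (k + 1) + 2)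
      * (chi n / (n : ℂ) ^ (2 * (k + 1) + 2)) / (k.factorial : ℂ) * p ^ k
      = borelDouble p (n, k) := by
  have hpi : (Real.pi : ℂ) ≠ 0 := by exact_mod_cast Real.pi_ne_zero
  have hk : (k.factorial : ℂ) ≠ 0 := by exact_mod_cast k.factorial_ne_zero
  have hk1 : ((k + 1).factorial : ℂ) ≠ 0 := by exact_mod_cast (k + 1).factorial_ne_zero
  simp only [borelDouble, fiveHalvesCoeff, invBranch]
  rcases Nat.eq_zero_or_pos n with rfl | hn
  · simp [chi_zero]
  have hn0 : (n : ℂ) ≠ 0 := by exact_mod_cast hn.ne'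
  rw [show 2 * (k + 1) + 1 = 2 * k + 3 by ring, show 2 * (k + 1) + 2 = 2 * k + 4 by ring]
  push_cast
  have h24 : (24 : ℂ) ^ (k + 1) = 4 ^ (k + 1) * (6 ^ k * 6) := by
    rw [← pow_succ, ← mul_pow]; norm_num
  have h6 : (6 : ℂ) ^ (2 * k + 4) = 6 ^ k * 6 ^ k * 6 ^ 4 := by ring
  have hpp : (Real.pi : ℂ) ^ (2 * k + 4) = (Real.pi ^ 2) ^ k * Real.pi ^ 4 := by
    rw [← pow_mul, ← pow_add]
  have hnn : (n : ℂ) ^ (2 * k + 4) = (n ^ 2) ^ k * n ^ 4 := by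
    rw [← pow_mul, ← pow_add]
  rw [h24, div_pow, mul_pow, div_pow, mul_pow, h6, hpp, hnn]
  have e6 : (6 : ℂ) ^ k ≠ 0 := pow_ne_zero _ (by norm_num)
  have e1 : ((Real.pi : ℂ) ^ 2) ^ k ≠ 0 := pow_ne_zero _ (pow_ne_zero _ hpi)
  have e2 : ((n : ℂ) ^ 2) ^ k ≠ 0 := pow_ne_zero _ (pow_ne_zero _ hn0)
  have e4 : (4 : ℂ) ^ (k + 1) ≠ 0 := pow_ne_zero _ (by norm_num)
  generalize (6 : ℂ) ^ k = x6 at *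
  generalize ((Real.pi : ℂ) ^ 2) ^ k = x1 at *
  generalize ((n : ℂ) ^ 2) ^ k = x2 at *
  generalize (4 : ℂ) ^ (k + 1) = x4 at *
  generalize (((2 * k + 3).factorial : ℕ) : ℂ) = f3 at *
  generalize (((k + 1).factorial : ℕ) : ℂ) = f1 at *
  generalize ((k.factorial : ℕ) : ℂ) = f0 at *
  field_simp
  ring

theorem hasSum_borelDouble_row {p : ℂ} (hp : ‖p‖ < 1 / 2) (n : ℕ) :
    HasSum (fun k => borelDouble p (n, k)) (borelTerm n p) := by
  have h0 : ‖(invBranch n : ℂ) * p‖ < 1 := (norm_invBranch_mul_le hp n).trans_lt (by norm_num)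
  have h := (hasSum_fiveHalves h0).mul_left
    ((54 * (Real.sqrt 3 : ℂ) / (Real.pi : ℂ) ^ 4) * (chi n / (n : ℂ) ^ 4))
  unfold borelTerm
  refine h.of_eq (fun k => ?_) ?_
  · simp only [borelDouble]
  · simp only []

theorem hasSum_borelDouble_col (p : ℂ) (k : ℕ) :
    HasSum (fun n => borelDouble p (n, k)) (PowerSeries.coeff k (borel F) * p ^ k) := by
  have h := ((hasSum_coeff_F (k + 1)).div_const (k.factorial : ℂ)).mul_right (p ^ k)
  simp only [borel_coeff_term] at h
  have e : PowerSeries.coeff k (borel F) = PowerSeries.coeff (k + 1) F / (k.factorial : ℂ) := by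
    unfold borel
    exact PowerSeries.coeff_mk _ _
  rw [e]
  exact h

/-- The double series converges absolutely for ‖p‖ < 1/2: summed over k first it gives the powers,
summed over n first the Taylor coefficients. -/
theorem hasSum_borel {p : ℂ} (hp : p ∈ Metric.ball (0 : ℂ) (1 / 2)) :
    HasSum (fun n : ℕ => PowerSeries.coeff n (borel F) * p ^ n) (borelSum p) := by
  have hp' : ‖p‖ < 1 / 2 := by simpa using hp
  have htot := (summable_borelDouble hp').hasSum
  have h1 := htot.prod_fiberwise (hasSum_borelDouble_row hp')
  have hswap : HasSum (fun x : ℕ × ℕ => borelDouble p (x.2, x.1)) (∑' x, borelDouble p x) :=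
    (Equiv.prodComm ℕ ℕ).hasSum_iff.mpr htot
  rw [borelSum, h1.tsum_eq]
  exact hswap.prod_fiberwise (hasSum_borelDouble_col p)

theorem isContinuation_borelSum (s : ℝ) :
    IsContinuation (borel F) {p : ℂ | 0 < s * p.im} borelSum := by
  refine ⟨1 / 2, by norm_num, ?_, fun p hp => hasSum_borel hp⟩
  have hopen : IsOpen {p : ℂ | 0 < s * p.im} :=
    isOpen_lt continuous_const (by fun_prop)
  rintro p (hp | hp)
  · exact (differentiableOn_borelSum_ball.differentiableAt
      (Metric.isOpen_ball.mem_nhds hp)).differentiableWithinAt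
  · exact ((differentiableOn_borelSum_halfPlane s).differentiableAt
      (hopen.mem_nhds hp)).differentiableWithinAt

/-- Two continuations of the same germ agree on a half-plane. -/
theorem IsContinuation.eqOn {B : PowerSeries ℂ} {s : ℝ} (hs : s ≠ 0) {g₁ g₂ : ℂ → ℂ}
    (h₁ : IsContinuation B {p : ℂ | 0 < s * p.im} g₁)
    (h₂ : IsContinuation B {p : ℂ | 0 < s * p.im} g₂) :
    Set.EqOn g₁ g₂ {p : ℂ | 0 < s * p.im} := by
  obtain ⟨r₁, hr₁, hd₁, hs₁⟩ := h₁
  obtain ⟨r₂, hr₂, hd₂, hs₂⟩ := h₂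
  set H : Set ℂ := {p : ℂ | 0 < s * p.im} with hH
  have hopen : IsOpen H := isOpen_lt continuous_const (by fun_prop)
  have hconv : Convex ℝ H := by
    intro x hx y hy a b ha hb hab
    have hx' : 0 < s * x.im := hx
    have hy' : 0 < s * y.im := hy
    change 0 < s * (a • x + b • y).im
    have e : s * (a • x + b • y).im = a * (s * x.im) + b * (s * y.im) := by
      simp; ring
    rw [e]
    rcases ha.eq_or_lt with h0 | h0
    · rw [← h0] at hab ⊢
      have : b = 1 := by linarith
      rw [this]; simpa using hy'
    · have := mul_pos h0 hx'
      have := mul_nonneg hb hy'.le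
      linarith
  set r := min r₁ r₂ with hr
  have hr0 : 0 < r := lt_min hr₁ hr₂
  -- A point of the half-plane inside both discs, where the identity theorem can start.
  set p0 : ℂ := Complex.I * ((r / 2 * SignType.sign s : ℝ) : ℂ) with hp0
  have hsign : s * (r / 2 * SignType.sign s) = |s| * (r / 2) := by
    rw [← self_mul_sign s]; ring
  have hp0H : p0 ∈ H := by
    change 0 < s * p0.im
    have : p0.im = r / 2 * SignType.sign s := by simp [hp0]
    rw [this, hsign]
    have := abs_pos.mpr hs
    positivity
  have hp0n : ‖p0‖ < r := by
    have hs1 : |((SignType.sign s : SignType) : ℝ)| = 1 := by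
      rcases lt_or_gt_of_ne hs with h | h
      · simp [sign_neg h]
      · simp [sign_pos h]
    rw [hp0, norm_mul, Complex.norm_I, one_mul, Complex.norm_real, Real.norm_eq_abs, abs_mul, hs1,
      abs_of_pos (by positivity)]
    linarith
  refine AnalyticOnNhd.eqOn_of_preconnected_of_eventuallyEq
    ((hd₁.mono Set.subset_union_right).analyticOnNhd hopen)
    ((hd₂.mono Set.subset_union_right).analyticOnNhd hopen) hconv.isPreconnected hp0H ?_
  have hball : Metric.ball (0 : ℂ) r ∈ nhds p0 :=
    Metric.isOpen_ball.mem_nhds (by simpa using hp0n)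
  filter_upwards [hball] with p hp
  exact (hs₁ p (Metric.ball_subset_ball (min_le_left _ _) hp)).unique
    (hs₂ p (Metric.ball_subset_ball (min_le_right _ _) hp))

/-! ### Laplace transforms of (1 - cp)^{-s} along rays off the real axis. -/

section Laplace

open MeasureTheory Complex Filter Topology Set

/-- The integrand of the Laplace transform of `(1 - c p)^{-s}` along the ray of direction `u`. -/
noncomputable def lapIntegrand (s c : ℝ) (u x : ℂ) (t : ℝ) : ℂ :=
  exp (-(x * (t * u))) * (1 - c * (t * u)) ^ (-(s : ℂ)) * u

/-- The Laplace transform of `(1 - c p)^{-s}` along the ray of direction `u`. -/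
noncomputable def lapInt (s c : ℝ) (u x : ℂ) : ℂ := ∫ t in Ioi (0 : ℝ), lapIntegrand s c u x t

theorem one_sub_mul_mem_slitPlane {u : ℂ} (hu : u.im ≠ 0) (c t : ℝ) :
    1 - (c : ℂ) * (t * u) ∈ slitPlane := by
  have := mem_slitPlane_of_im_ne_zero (c := c * t) hu
  rwa [ofReal_mul, mul_assoc] at this

/-- The bound is uniform in c and t, so it serves all branch points at once. -/
theorem abs_im_le_norm_one_sub {u : ℂ} (hu1 : ‖u‖ = 1) (c t : ℝ) :
    |u.im| ≤ ‖1 - (c : ℂ) * (t * u)‖ := by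
  have := abs_im_le_norm_mul (c * t) u
  rwa [ofReal_mul, mul_assoc, hu1, mul_one] at this

theorem norm_cpow_le {u : ℂ} (hu1 : ‖u‖ = 1) (hu : u.im ≠ 0) {s : ℝ} (hs : 0 ≤ s) (c t : ℝ) :
    ‖(1 - (c : ℂ) * (t * u)) ^ (-(s : ℂ))‖ ≤ |u.im| ^ (-s) := by
  rw [← ofReal_neg, norm_cpow_real]
  exact Real.rpow_le_rpow_of_nonpos (abs_pos.mpr hu) (abs_im_le_norm_one_sub hu1 c t) (by linarith)

theorem norm_exp_ray (x u : ℂ) (t : ℝ) :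
    ‖exp (-(x * (t * u)))‖ = Real.exp (-(x * u).re * t) := by
  rw [norm_exp]
  congr 1
  have : x * (t * u) = (t : ℂ) * (x * u) := by ring
  rw [this, neg_re, re_ofReal_mul]
  ring

theorem norm_lapIntegrand_le {u : ℂ} (hu1 : ‖u‖ = 1) (hu : u.im ≠ 0) {s : ℝ} (hs : 0 ≤ s)
    (c : ℝ) (x : ℂ) (t : ℝ) :
    ‖lapIntegrand s c u x t‖ ≤ |u.im| ^ (-s) * Real.exp (-(x * u).re * t) := by
  rw [lapIntegrand, norm_mul, norm_mul, hu1, mul_one, norm_exp_ray, mul_comm]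
  gcongr
  exact norm_cpow_le hu1 hu hs c t

theorem continuous_lapIntegrand {u : ℂ} (hu : u.im ≠ 0) (s c : ℝ) (x : ℂ) :
    Continuous (lapIntegrand s c u x) := by
  unfold lapIntegrand
  refine Continuous.mul (Continuous.mul (by fun_prop) ?_) continuous_const
  exact Continuous.cpow (by fun_prop) continuous_const fun t => one_sub_mul_mem_slitPlane hu c t

theorem integrableOn_lapIntegrand {u : ℂ} (hu1 : ‖u‖ = 1) (hu : u.im ≠ 0) {s : ℝ} (hs : 0 ≤ s)
    (c : ℝ) {x : ℂ} (hx : 0 < (x * u).re) :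
    IntegrableOn (lapIntegrand s c u x) (Ioi 0) := by
  refine Integrable.mono' ((exp_neg_integrableOn_Ioi 0 hx).const_mul (|u.im| ^ (-s)))
    (continuous_lapIntegrand hu s c x).aestronglyMeasurable ?_
  exact Eventually.of_forall fun t => norm_lapIntegrand_le hu1 hu hs c x t

theorem hasDerivAt_ray_cpow {u : ℂ} (hu : u.im ≠ 0) (s c t : ℝ) :
    HasDerivAt (fun t : ℝ => (1 - (c : ℂ) * (t * u)) ^ (-(s : ℂ)))
      (s * c * u * (1 - (c : ℂ) * (t * u)) ^ (-((s + 1 : ℝ) : ℂ))) t := by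
  have h1 : HasDerivAt (fun z : ℂ => 1 - (c : ℂ) * (z * u)) (-(c * u)) (t : ℂ) := by
    have := (((hasDerivAt_id (t : ℂ)).mul_const u).const_mul (c : ℂ)).const_sub 1
    simpa using this
  have h2 := (h1.cpow_const (c := -(s : ℂ)) (one_sub_mul_mem_slitPlane hu c t)).comp_ofReal
  refine h2.congr_deriv ?_
  have : (-(s : ℂ) - 1) = -((s + 1 : ℝ) : ℂ) := by push_cast; ring
  rw [this]
  ring

/-- Integration by parts. -/
theorem mul_lapInt {u : ℂ} (hu1 : ‖u‖ = 1) (hu : u.im ≠ 0) {s : ℝ} (hs : 0 ≤ s)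
    (c : ℝ) {x : ℂ} (hx : 0 < (x * u).re) :
    x * lapInt s c u x = 1 + s * c * lapInt (s + 1) c u x := by
  have hi0 := integrableOn_lapIntegrand hu1 hu hs c hx
  have hi1 := integrableOn_lapIntegrand hu1 hu (add_nonneg hs zero_le_one) c hx
  have hder : ∀ t : ℝ, HasDerivAt
      (fun t : ℝ => exp (-(x * (t * u))) * (1 - (c : ℂ) * (t * u)) ^ (-(s : ℂ)))
      (s * c * lapIntegrand (s + 1) c u x t - x * lapIntegrand s c u x t) t := by
    intro t
    have h1 : HasDerivAt (fun z : ℂ => -(x * (z * u))) (-(x * u)) (t : ℂ) := by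
      have := (((hasDerivAt_id' (t : ℂ)).mul_const u).const_mul x).fun_neg
      exact this.congr_deriv (by ring)
    refine (h1.cexp.comp_ofReal.mul (hasDerivAt_ray_cpow hu s c t)).congr_deriv ?_
    unfold lapIntegrand
    ring
  have hlim : Tendsto (fun t : ℝ => exp (-(x * (t * u))) * (1 - (c : ℂ) * (t * u)) ^ (-(s : ℂ)))
      atTop (𝓝 0) := by
    have hb : Tendsto (fun t : ℝ => |u.im| ^ (-s) * Real.exp (-(x * u).re * t)) atTop (𝓝 0) := by
      rw [← mul_zero (|u.im| ^ (-s))]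
      refine Tendsto.const_mul _ (Real.tendsto_exp_atBot.comp ?_)
      exact tendsto_id.const_mul_atTop_of_neg (by linarith)
    refine squeeze_zero_norm (fun t => ?_) hb
    rw [norm_mul, norm_exp_ray, mul_comm]
    gcongr
    exact norm_cpow_le hu1 hu hs c t
  have key := integral_Ioi_of_hasDerivAt_of_tendsto (a := 0) (hder 0).continuousAt.continuousWithinAt
    (fun t _ => hder t) ((hi1.const_mul (s * c : ℂ)).sub (hi0.const_mul x)) hlim
  have e : ∫ t in Ioi (0 : ℝ), (s * c * lapIntegrand (s + 1) c u x t - x * lapIntegrand s c u x t)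
      = s * c * lapInt (s + 1) c u x - x * lapInt s c u x := by
    rw [integral_sub (hi1.const_mul (s * c : ℂ)) (hi0.const_mul x), integral_const_mul,
      integral_const_mul]
    rfl
  rw [e] at key
  simp only [ofReal_zero, zero_mul, mul_zero, neg_zero, exp_zero, sub_zero, one_cpow, one_mul]
    at key
  linear_combination -key

/-- Differentiating in x brings down -p, and -p (1 - cp)^{-s} = ((1 - cp)^{-(s-1)} - (1 -
cp)^{-s})/c. -/
theorem hasDerivAt_lapInt {u : ℂ} (hu1 : ‖u‖ = 1) (hu : u.im ≠ 0) {s : ℝ} (hs : 1 ≤ s)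
    {c : ℝ} (hc : c ≠ 0) {x : ℂ} (hx : 0 < (x * u).re) :
    HasDerivAt (lapInt s c u) ((lapInt (s - 1) c u x - lapInt s c u x) / c) x := by
  have hs0 : 0 ≤ s := by linarith
  set b := (x * u).re with hb
  have hF' : ∀ y t, HasDerivAt (fun y => lapIntegrand s c u y t)
      (-(t * u) * lapIntegrand s c u y t) y := by
    intro y t
    have h1 : HasDerivAt (fun y : ℂ => -(y * (t * u))) (-(t * u)) y := by
      exact ((hasDerivAt_id' y).mul_const (t * u)).fun_neg.congr_deriv (by ring)
    have h2 := (h1.cexp.mul_const ((1 - (c : ℂ) * (t * u)) ^ (-(s : ℂ)))).mul_const u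
    refine h2.congr_deriv ?_
    unfold lapIntegrand
    ring
  have hball : ∀ y ∈ Metric.ball x (b / 2), b / 2 ≤ (y * u).re := by
    intro y hy
    have h1 : |((x - y) * u).re| ≤ ‖x - y‖ := by
      have := abs_re_le_norm ((x - y) * u)
      rwa [norm_mul, hu1, mul_one] at this
    have h2 : ‖x - y‖ < b / 2 := by rw [← dist_eq_norm, dist_comm]; exact hy
    have h3 := (abs_le.mp h1).2
    rw [sub_mul, sub_re] at h3
    linarith
  -- The decay rate is at least b/2 on the ball. One factor e^{-bt/4} absorbs t, the other remains
  -- as an integrable majorant.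
  have hbound : ∀ t ∈ Ioi (0 : ℝ), ∀ y ∈ Metric.ball x (b / 2),
      ‖-(t * u) * lapIntegrand s c u y t‖ ≤
        |u.im| ^ (-s) * (4 / b) * Real.exp (-(b / 4) * t) := by
    intro t ht y hy
    have ht0 : 0 < t := ht
    have h1 : ‖-((t : ℂ) * u)‖ = t := by
      rw [norm_neg, norm_mul, hu1, mul_one, norm_real, Real.norm_of_nonneg ht0.le]
    have h2 := norm_lapIntegrand_le hu1 hu hs0 c y t
    have h3 : Real.exp (-(y * u).re * t) ≤ Real.exp (-(b / 4) * t) * Real.exp (-(b / 4) * t) := by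
      rw [← Real.exp_add]
      apply Real.exp_le_exp.mpr
      nlinarith [hball y hy]
    have h4 : t * Real.exp (-(b / 4) * t) ≤ 4 / b := by
      have := Real.add_one_le_exp (b / 4 * t)
      rw [neg_mul, Real.exp_neg, ← div_eq_mul_inv, div_le_div_iff₀ (Real.exp_pos _) hx]
      nlinarith
    rw [norm_mul, h1]
    have hk : 0 ≤ |u.im| ^ (-s) := Real.rpow_nonneg (abs_nonneg _) _
    calc t * ‖lapIntegrand s c u y t‖
        ≤ t * (|u.im| ^ (-s) * (Real.exp (-(b / 4) * t) * Real.exp (-(b / 4) * t))) := by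
          gcongr
          exact h2.trans (by gcongr)
      _ = |u.im| ^ (-s) * (t * Real.exp (-(b / 4) * t)) * Real.exp (-(b / 4) * t) := by ring
      _ ≤ _ := by gcongr
  have key := hasDerivAt_integral_of_dominated_loc_of_deriv_le (μ := volume.restrict (Ioi (0 : ℝ)))
    (F := fun y t => lapIntegrand s c u y t) (x₀ := x)
    (F' := fun y t => -(t * u) * lapIntegrand s c u y t)
    (bound := fun t => |u.im| ^ (-s) * (4 / b) * Real.exp (-(b / 4) * t))
    (Metric.ball_mem_nhds x (half_pos hx))
    (Eventually.of_forall fun y => (continuous_lapIntegrand hu s c y).aestronglyMeasurable)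
    (integrableOn_lapIntegrand hu1 hu hs0 c hx)
    (Continuous.aestronglyMeasurable (by
      have := continuous_lapIntegrand hu s c x
      fun_prop))
    ((ae_restrict_mem measurableSet_Ioi).mono hbound)
    ((exp_neg_integrableOn_Ioi 0 (by positivity)).const_mul _)
    (Eventually.of_forall fun t y _ => hF' y t)
  refine key.2.congr_deriv ?_
  have hc' : (c : ℂ) ≠ 0 := by exact_mod_cast hc
  have hi0 := integrableOn_lapIntegrand hu1 hu hs0 c hx
  have hi1 := integrableOn_lapIntegrand hu1 hu (s := s - 1) (by linarith) c hx
  rw [lapInt, lapInt, ← integral_sub hi1 hi0, ← integral_div]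
  congr 1
  funext t
  have h1 : (1 - (c : ℂ) * (t * u)) ^ (-((s - 1 : ℝ) : ℂ))
      = (1 - (c : ℂ) * (t * u)) * (1 - (c : ℂ) * (t * u)) ^ (-(s : ℂ)) := by
    have e : (-((s - 1 : ℝ) : ℂ)) = 1 + -(s : ℂ) := by push_cast; ring
    rw [e, cpow_add _ _ (slitPlane_ne_zero (one_sub_mul_mem_slitPlane hu c t)), cpow_one]
  unfold lapIntegrand
  rw [h1]
  field_simp
  ring

end Laplace

/-! ### The jump of the Laplace transform of (1 - cp)^{-5/2} across the cut. -/

section Jump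

open MeasureTheory Complex Filter Topology Set

theorem ofReal_mul_cpow {r : ℝ} (hr : 0 < r) {z : ℂ} (hz : z ≠ 0) (a : ℂ) :
    ((r : ℂ) * z) ^ a = (r : ℂ) ^ a * z ^ a := by
  have hr' : (r : ℂ) ≠ 0 := by exact_mod_cast hr.ne'
  rw [cpow_def_of_ne_zero (mul_ne_zero hr' hz), cpow_def_of_ne_zero hr', cpow_def_of_ne_zero hz,
    log_ofReal_mul hr hz, ← exp_add, ← ofReal_log hr.le]
  congr 1
  ring

/-- The substitution t ↦ t² turns the integrand into a Gaussian. -/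
theorem integral_rpow_neg_half_exp {u : ℂ} (hu : 0 < u.re) :
    ∫ t in Ioi (0 : ℝ), exp (-(t * u)) * ((t ^ (-(1 / 2) : ℝ) : ℝ) : ℂ)
      = ((Real.pi : ℂ) / u) ^ (1 / 2 : ℂ) := by
  have h := integral_comp_rpow_Ioi_of_pos
    (g := fun t : ℝ => exp (-(t * u)) * ((t ^ (-(1 / 2) : ℝ) : ℝ) : ℂ)) (p := 2) (by norm_num)
  rw [← h]
  have h2 : ∀ t ∈ Ioi (0 : ℝ), ((2 : ℝ) * t ^ ((2 : ℝ) - 1)) •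
      (exp (-(((t ^ (2 : ℝ) : ℝ) : ℂ) * u)) * (((t ^ (2 : ℝ)) ^ (-(1 / 2) : ℝ) : ℝ) : ℂ))
      = 2 * exp (-u * (t : ℂ) ^ 2) := by
    intro t ht
    have ht0 : (0 : ℝ) < t := ht
    have e1 : (t ^ (2 : ℝ)) ^ (-(1 / 2) : ℝ) = t⁻¹ := by
      rw [← Real.rpow_mul ht0.le, show (2 : ℝ) * -(1 / 2) = -1 by norm_num, Real.rpow_neg_one]
    have e2 : t ^ (2 : ℝ) = t ^ 2 := by rw [← Real.rpow_natCast]; norm_num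
    have e3 : t ^ ((2 : ℝ) - 1) = t := by rw [show (2 : ℝ) - 1 = 1 by norm_num, Real.rpow_one]
    have ht' : (t : ℂ) ≠ 0 := by exact_mod_cast ht0.ne'
    rw [e1, e2, e3, real_smul]
    push_cast
    rw [show -((t : ℂ) ^ 2 * u) = -u * (t : ℂ) ^ 2 by ring]
    field_simp
  rw [setIntegral_congr_fun measurableSet_Ioi h2, integral_const_mul,
    integral_gaussian_complex_Ioi hu]
  ring

/-- The side of the real axis on which a direction lies, as a sign. -/
noncomputable def raySign (u : ℂ) : ℂ := if 0 < u.im then 1 else -1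

theorem raySign_of_pos {u : ℂ} (h : 0 < u.im) : raySign u = 1 := if_pos h

theorem raySign_of_neg {u : ℂ} (h : u.im < 0) : raySign u = -1 := if_neg h.not_gt

/-- Here log(-u) = log u ∓ πi, with the sign given by the side of the real axis. The side enters the
jump only through this branch choice. -/
theorem neg_cpow_mul {u : ℂ} (hu : u.im ≠ 0) :
    (-u) ^ (-(1 / 2) : ℂ) * u * (1 / u) ^ (1 / 2 : ℂ) = raySign u * I := by
  have hu0 : u ≠ 0 := fun h => hu (by simp [h])
  have harg : u.arg ≠ Real.pi := fun h => hu (arg_eq_pi_iff.mp h).2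
  rw [one_div u, inv_cpow _ _ harg, ← cpow_neg, cpow_def_of_ne_zero (neg_ne_zero.mpr hu0),
    cpow_def_of_ne_zero hu0]
  nth_rw 2 [← exp_log hu0]
  rw [← exp_add, ← exp_add]
  rcases lt_or_gt_of_ne hu with h | h
  · have key : log (-u) = log u + Real.pi * I := by
      rw [log, log, norm_neg, arg_neg_eq_arg_add_pi_of_im_neg h]
      push_cast
      ring
    rw [key, raySign_of_neg h, show (log u + Real.pi * I) * (-(1 / 2)) + log u
      + log u * (-(1 / 2)) = -(Real.pi / 2 * I) by ring, exp_neg, exp_pi_div_two_mul_I, inv_I]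
    ring
  · have key : log (-u) = log u - Real.pi * I := by
      rw [log, log, norm_neg, arg_neg_eq_arg_sub_pi_of_im_pos h]
      push_cast
      ring
    rw [key, raySign_of_pos h, show (log u - Real.pi * I) * (-(1 / 2)) + log u
      + log u * (-(1 / 2)) = Real.pi / 2 * I by ring, exp_pi_div_two_mul_I]
    ring

/-- With τ = yt the bracket becomes y - cτu, and in the limit only (-cτu)^{-1/2} remains. The
exponent 1/2 keeps this integrable at τ = 0, which would fail for 3/2 or 5/2. -/
theorem tendsto_sqrt_mul_lapInt {u : ℂ} (hu1 : ‖u‖ = 1) (hu : u.im ≠ 0) (hre : 0 < u.re)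
    {c : ℝ} (hc : 0 < c) :
    Tendsto (fun y : ℝ => (y : ℂ) ^ (1 / 2 : ℂ) * lapInt (1 / 2) c u y) (𝓝[>] 0)
      (𝓝 (raySign u * I * (c : ℂ) ^ (-(1 / 2) : ℂ)
        * (Real.pi : ℂ) ^ (1 / 2 : ℂ))) := by
  have hu0 : u ≠ 0 := fun h => hu (by simp [h])
  have him : ∀ y τ : ℝ, ((y : ℂ) - c * τ * u).im = -(c * τ * u.im) := by
    intro y τ
    rw [← ofReal_mul, sub_im, ofReal_im, im_ofReal_mul, zero_sub]
  have hslit : ∀ y τ : ℝ, 0 < τ → (y : ℂ) - c * τ * u ∈ slitPlane := by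
    intro y τ hτ
    rw [mem_slitPlane_iff]
    right
    rw [him]
    exact neg_ne_zero.mpr (mul_ne_zero (mul_pos hc hτ).ne' hu)
  have hscale : ∀ y : ℝ, 0 < y → (y : ℂ) ^ (1 / 2 : ℂ) * lapInt (1 / 2) c u y
      = ∫ τ in Ioi (0 : ℝ), exp (-(τ * u)) * ((y : ℂ) - c * τ * u) ^ (-(1 / 2) : ℂ) * u := by
    intro y hy
    have hy' : (y : ℂ) ≠ 0 := by exact_mod_cast hy.ne'
    have h := integral_comp_mul_left_Ioi
      (fun τ : ℝ => exp (-(τ * u)) * ((y : ℂ) - c * τ * u) ^ (-(1 / 2) : ℂ) * u) 0 hy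
    rw [mul_zero] at h
    have h2 : ∀ t ∈ Ioi (0 : ℝ), exp (-(((y * t : ℝ) : ℂ) * u))
        * ((y : ℂ) - c * ((y * t : ℝ) : ℂ) * u) ^ (-(1 / 2) : ℂ) * u
        = (y : ℂ) ^ (-(1 / 2) : ℂ) * lapIntegrand (1 / 2) c u y t := by
      intro t _
      rw [lapIntegrand]
      have e1 : (y : ℂ) - c * ((y * t : ℝ) : ℂ) * u = (y : ℂ) * (1 - c * (t * u)) := by
        push_cast; ring
      rw [e1, ofReal_mul_cpow hy (slitPlane_ne_zero (one_sub_mul_mem_slitPlane hu c t))]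
      push_cast
      rw [mul_assoc (y : ℂ) t u]
      ring
    rw [setIntegral_congr_fun measurableSet_Ioi h2, integral_const_mul] at h
    have h3 : ∫ τ in Ioi (0 : ℝ), exp (-(τ * u)) * ((y : ℂ) - c * τ * u) ^ (-(1 / 2) : ℂ) * u
        = (y : ℂ) * ((y : ℂ) ^ (-(1 / 2) : ℂ) * lapInt (1 / 2) c u y) := by
      rw [lapInt, h, real_smul, ofReal_inv, mul_inv_cancel_left₀ hy']
    rw [h3, ← mul_assoc]
    congr 1
    nth_rw 2 [← cpow_one (y : ℂ)]
    rw [← cpow_add _ _ hy']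
    norm_num
  have hlim : ∫ τ in Ioi (0 : ℝ), exp (-(τ * u)) * (-(c * τ * u)) ^ (-(1 / 2) : ℂ) * u
      = raySign u * I * (c : ℂ) ^ (-(1 / 2) : ℂ)
        * (Real.pi : ℂ) ^ (1 / 2 : ℂ) := by
    have h2 : ∀ τ ∈ Ioi (0 : ℝ), exp (-(τ * u)) * (-(c * τ * u)) ^ (-(1 / 2) : ℂ) * u
        = ((c : ℂ) ^ (-(1 / 2) : ℂ) * (-u) ^ (-(1 / 2) : ℂ) * u)
          * (exp (-(τ * u)) * ((τ ^ (-(1 / 2) : ℝ) : ℝ) : ℂ)) := by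
      intro τ hτ
      have hτ0 : (0 : ℝ) < τ := hτ
      have e1 : -((c : ℂ) * τ * u) = (c : ℂ) * ((τ : ℂ) * (-u)) := by ring
      have hτ' : (τ : ℂ) ≠ 0 := by exact_mod_cast hτ0.ne'
      rw [e1, ofReal_mul_cpow hc (mul_ne_zero hτ' (neg_ne_zero.mpr hu0)),
        ofReal_mul_cpow hτ0 (neg_ne_zero.mpr hu0), ofReal_cpow hτ0.le]
      push_cast
      ring
    rw [setIntegral_congr_fun measurableSet_Ioi h2, integral_const_mul,
      integral_rpow_neg_half_exp hre, ← neg_cpow_mul hu, div_eq_mul_one_div (Real.pi : ℂ) u,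
      ofReal_mul_cpow Real.pi_pos (one_div_ne_zero hu0)]
    ring
  rw [← hlim]
  refine Tendsto.congr' (f₁ := fun y : ℝ => ∫ τ in Ioi (0 : ℝ),
    exp (-(τ * u)) * ((y : ℂ) - c * τ * u) ^ (-(1 / 2) : ℂ) * u) ?_ ?_
  · filter_upwards [self_mem_nhdsWithin] with y hy
    exact (hscale y hy).symm
  · refine tendsto_integral_filter_of_dominated_convergence
      (fun τ => (c * |u.im|) ^ (-(1 / 2) : ℝ) * (τ ^ (-(1 / 2) : ℝ) * Real.exp (-u.re * τ ^ (1 : ℝ))))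
      ?_ ?_ ?_ ?_
    · refine Eventually.of_forall fun y => ?_
      refine ContinuousOn.aestronglyMeasurable ?_ measurableSet_Ioi
      refine ContinuousOn.mul (ContinuousOn.mul (by fun_prop) ?_) continuousOn_const
      exact ContinuousOn.cpow (by fun_prop) continuousOn_const fun τ hτ => hslit y τ hτ
    · refine Eventually.of_forall fun y => (ae_restrict_mem measurableSet_Ioi).mono fun τ hτ => ?_
      have hτ0 : (0 : ℝ) < τ := hτ
      have hpos : 0 < c * |u.im| := mul_pos hc (abs_pos.mpr hu)
      have e1 : ‖((y : ℂ) - c * τ * u) ^ (-(1 / 2) : ℂ)‖ ≤ (c * |u.im| * τ) ^ (-(1 / 2) : ℝ) := by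
        have : (-(1 / 2) : ℂ) = ((-(1 / 2) : ℝ) : ℂ) := by push_cast; rfl
        rw [this, norm_cpow_real]
        refine Real.rpow_le_rpow_of_nonpos (mul_pos hpos hτ0) ?_ (by norm_num)
        have h1 := abs_im_le_norm ((y : ℂ) - c * τ * u)
        rw [him, abs_neg, abs_mul, abs_mul, abs_of_pos hc, abs_of_pos hτ0] at h1
        linarith
      have e2 : ‖exp (-(τ * u))‖ = Real.exp (-u.re * τ ^ (1 : ℝ)) := by
        rw [norm_exp, neg_re, re_ofReal_mul, Real.rpow_one]
        congr 1
        ring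
      rw [norm_mul, norm_mul, hu1, mul_one, e2, ← mul_assoc, ← Real.mul_rpow hpos.le hτ0.le,
        mul_comm]
      gcongr
    · exact (integrableOn_rpow_mul_exp_neg_mul_rpow (by norm_num) (by norm_num) hre).const_mul _
    · refine (ae_restrict_mem measurableSet_Ioi).mono fun τ hτ => ?_
      have h1 : Tendsto (fun y : ℝ => (y : ℂ) - c * τ * u) (𝓝[>] 0) (𝓝 (-(c * τ * u))) := by
        have : Continuous fun y : ℝ => (y : ℂ) - c * τ * u := by fun_prop
        have h := this.tendsto 0
        rw [ofReal_zero, zero_sub] at h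
        exact h.mono_left nhdsWithin_le_nhds
      have h2 : -((c : ℂ) * τ * u) ∈ slitPlane := by simpa using hslit 0 τ hτ
      exact ((((continuousAt_cpow_const h2).tendsto.comp h1).const_mul _).mul_const _)

/-- The difference of the Laplace transforms of `(1 - c p)^{-5/2}` along two rays. -/
theorem lapInt_sub_lapInt {u v : ℂ} (hu1 : ‖u‖ = 1) (hu : u.im ≠ 0) (hure : 0 < u.re)
    (hv1 : ‖v‖ = 1) (hv : v.im ≠ 0) (hvre : 0 < v.re) {c : ℝ} (hc : 0 < c) {x : ℂ}
    (hx : 0 < x.re) (hxu : 0 < (x * u).re) (hxv : 0 < (x * v).re) :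
    lapInt (5 / 2) c u x - lapInt (5 / 2) c v x
      = (raySign u - raySign v) * (4 / 3 * I)
        * (Real.pi : ℂ) ^ (1 / 2 : ℂ) * (c : ℂ) ^ (-(5 / 2) : ℂ) * x ^ (3 / 2 : ℂ)
        * exp (-(x / c)) := by
  have hc' : (c : ℂ) ≠ 0 := by exact_mod_cast hc.ne'
  set D : ℝ → ℂ → ℂ := fun s x => lapInt s c u x - lapInt s c v x with hD
  set Ω : Set ℂ := {x | 0 < x.re} ∩ ({x | 0 < (x * u).re} ∩ {x | 0 < (x * v).re}) with hΩ
  have hopen : IsOpen Ω :=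
    (isOpen_lt continuous_const continuous_re).inter
      ((isOpen_lt continuous_const (by fun_prop)).inter (isOpen_lt continuous_const (by fun_prop)))
  have hhalf : ∀ w : ℂ, Convex ℝ {x : ℂ | 0 < (x * w).re} := fun w => by
    have : IsLinearMap ℝ fun x : ℂ => (x * w).re :=
      ⟨fun a b => by rw [add_mul, add_re], fun r a => by simp; ring⟩
    exact convex_halfSpace_gt this 0
  have hconv : Convex ℝ Ω := by
    refine Convex.inter ?_ ((hhalf u).inter (hhalf v))
    simpa using hhalf 1
  have hpos : ∀ y : ℝ, 0 < y → (y : ℂ) ∈ Ω := by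
    intro y hy
    refine ⟨by simpa using hy, ?_, ?_⟩
    · change 0 < ((y : ℂ) * u).re
      rw [re_ofReal_mul]; positivity
    · change 0 < ((y : ℂ) * v).re
      rw [re_ofReal_mul]; positivity
  -- The boundary term 1 of the integration by parts cancels in the difference.
  have hparts : ∀ s : ℝ, 0 ≤ s → ∀ x ∈ Ω, x * D s x = s * c * D (s + 1) x := by
    intro s hs x hx
    have h1 := mul_lapInt hu1 hu hs c hx.2.1
    have h2 := mul_lapInt hv1 hv hs c hx.2.2
    simp only [hD]
    linear_combination h1 - h2
  have hder : ∀ x ∈ Ω, HasDerivAt (D (5 / 2)) ((D (3 / 2) x - D (5 / 2) x) / c) x := by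
    intro x hx
    have h1 := hasDerivAt_lapInt hu1 hu (s := 5 / 2) (by norm_num) hc.ne' hx.2.1
    have h2 := hasDerivAt_lapInt hv1 hv (s := 5 / 2) (by norm_num) hc.ne' hx.2.2
    rw [show (5 / 2 : ℝ) - 1 = 3 / 2 by norm_num] at h1 h2
    refine (h1.sub h2).congr_deriv ?_
    simp only [hD]
    ring
  -- The derivative formula and `hparts` give D' = (3/(2x) - 1/c) D for D = `D (5 / 2)`; Y is D
  -- times the integrating factor, hence constant.
  set Y : ℂ → ℂ := fun x => exp (x / c) * x ^ (-(3 / 2) : ℂ) * D (5 / 2) x with hY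
  have hYder : ∀ x ∈ Ω, HasDerivAt Y 0 x := by
    intro x hx
    have hxs : x ∈ slitPlane := Or.inl hx.1
    have hx0 : x ≠ 0 := slitPlane_ne_zero hxs
    have h1 : HasDerivAt (fun x : ℂ => exp (x / c)) (exp (x / c) * (1 / c)) x :=
      ((hasDerivAt_id' x).div_const (c : ℂ)).cexp
    have h2 : HasDerivAt (fun x : ℂ => x ^ (-(3 / 2) : ℂ))
        (-(3 / 2) * x ^ (-(3 / 2) - 1 : ℂ) * 1) x :=
      (hasDerivAt_id' x).cpow_const hxs
    refine ((h1.mul h2).mul (hder x hx)).congr_deriv ?_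
    have h3 := hparts (3 / 2) (by norm_num) x hx
    rw [show (3 / 2 : ℝ) + 1 = 5 / 2 by norm_num] at h3
    have h4 : D (3 / 2) x = ((3 / 2 : ℝ) : ℂ) * c * D (5 / 2) x / x := by
      rw [← h3]; field_simp
    rw [h4, cpow_sub _ _ hx0, cpow_one]
    simp only [Pi.mul_apply]
    push_cast
    field_simp
    ring
  have hconst : ∀ y : ℝ, 0 < y → Y y = Y x := fun y hy =>
    hopen.is_const_of_deriv_eq_zero hconv.isPreconnected
      (fun z hz => (hYder z hz).differentiableAt.differentiableWithinAt)
      (fun z hz => (hYder z hz).deriv) (hpos y hy) ⟨hx, hxu, hxv⟩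
  set σ : ℂ := raySign u - raySign v with hσ
  -- The constant is found by letting x → 0 along the positive reals. Two integrations by parts
  -- lower 5/2 to 1/2 and produce y²/((1/2)(3/2)c²) = 4y²/(3c²).
  have hlim : Tendsto (fun y : ℝ => Y y) (𝓝[>] 0)
      (𝓝 (4 / (3 * (c : ℂ) ^ 2) * (σ * I * (c : ℂ) ^ (-(1 / 2) : ℂ)
        * (Real.pi : ℂ) ^ (1 / 2 : ℂ)))) := by
    have h1 := (tendsto_sqrt_mul_lapInt hu1 hu hure hc).sub
      (tendsto_sqrt_mul_lapInt hv1 hv hvre hc)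
    have h2 : Tendsto (fun y : ℝ => exp ((y : ℂ) / c) * (4 / (3 * (c : ℂ) ^ 2)))
        (𝓝[>] 0) (𝓝 (4 / (3 * (c : ℂ) ^ 2))) := by
      have hcont : Continuous fun y : ℝ => exp ((y : ℂ) / c) * (4 / (3 * (c : ℂ) ^ 2)) := by
        fun_prop
      have := hcont.tendsto 0
      rw [ofReal_zero, zero_div, exp_zero, one_mul] at this
      exact this.mono_left nhdsWithin_le_nhds
    have h3 := h2.mul h1
    have e : 4 / (3 * (c : ℂ) ^ 2) * (σ * I * (c : ℂ) ^ (-(1 / 2) : ℂ)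
        * (Real.pi : ℂ) ^ (1 / 2 : ℂ)) = 4 / (3 * (c : ℂ) ^ 2) *
        (raySign u * I * (c : ℂ) ^ (-(1 / 2) : ℂ)
          * (Real.pi : ℂ) ^ (1 / 2 : ℂ) - raySign v * I
          * (c : ℂ) ^ (-(1 / 2) : ℂ) * (Real.pi : ℂ) ^ (1 / 2 : ℂ)) := by
      rw [hσ]; ring
    rw [e]
    refine h3.congr' ?_
    filter_upwards [self_mem_nhdsWithin] with y hy
    have hy0 : (0 : ℝ) < y := hy
    have hy' : (y : ℂ) ≠ 0 := by exact_mod_cast hy0.ne'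
    have p1 := hparts (1 / 2) (by norm_num) y (hpos y hy0)
    have p2 := hparts (3 / 2) (by norm_num) y (hpos y hy0)
    rw [show (1 / 2 : ℝ) + 1 = 3 / 2 by norm_num] at p1
    rw [show (3 / 2 : ℝ) + 1 = 5 / 2 by norm_num] at p2
    push_cast at p1 p2
    have p3 : D (5 / 2) y = 4 / (3 * (c : ℂ) ^ 2) * y ^ 2 * D (1 / 2) y := by
      field_simp
      linear_combination (-4 * (y : ℂ)) * p1 - 2 * c * p2
    have p4 : (y : ℂ) ^ (1 / 2 : ℂ) = (y : ℂ) ^ (-(3 / 2) : ℂ) * y ^ 2 := by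
      rw [← cpow_natCast, ← cpow_add _ _ hy']
      norm_num
    simp only [hY]
    rw [p3, ← mul_sub, p4]
    simp only [hD]
    ring
  have hYx : Y x = 4 / (3 * (c : ℂ) ^ 2) * (σ * I * (c : ℂ) ^ (-(1 / 2) : ℂ)
        * (Real.pi : ℂ) ^ (1 / 2 : ℂ)) := by
    refine tendsto_nhds_unique ?_ hlim
    refine tendsto_const_nhds.congr' ?_
    filter_upwards [self_mem_nhdsWithin] with y hy
    exact (hconst y hy).symm
  have hx0 : x ≠ 0 := fun h => by simp [h] at hx
  have q1 : (c : ℂ) ^ (-(5 / 2) : ℂ) = (c : ℂ) ^ (-(1 / 2) : ℂ) / (c : ℂ) ^ 2 := by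
    rw [eq_div_iff (pow_ne_zero 2 hc'), ← cpow_natCast, ← cpow_add _ _ hc']
    norm_num
  have q2 : x ^ (3 / 2 : ℂ) * x ^ (-(3 / 2) : ℂ) = 1 := by
    rw [← cpow_add _ _ hx0]; simp
  have q3 : exp (-(x / c)) * exp (x / c) = 1 := by rw [← exp_add]; simp
  have q4 : D (5 / 2) x = x ^ (3 / 2 : ℂ) * exp (-(x / c)) * Y x := by
    simp only [hY]
    linear_combination (-(D (5 / 2) x)) * (q2 * exp (-(x / c)) * exp (x / c) + q3)
  change D (5 / 2) x = _
  rw [q4, hYx, q1]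
  field_simp

end Jump

/-! ### Lateral Laplace transforms and the closed formula for δ. -/

section Lateral

open MeasureTheory Complex Filter Topology Set

/-- The Laplace transform of the Borel transform along the ray of direction `u`. -/
noncomputable def rayLaplace (u x : ℂ) : ℂ :=
  ∑' n : ℕ, (54 * (Real.sqrt 3 : ℂ) / (Real.pi : ℂ) ^ 4) * (chi n / (n : ℂ) ^ 4)
    * lapInt (5 / 2) (invBranch n) u x

theorem borelTerm_ray (u x : ℂ) (t : ℝ) (n : ℕ) :
    (54 * (Real.sqrt 3 : ℂ) / (Real.pi : ℂ) ^ 4) * (chi n / (n : ℂ) ^ 4)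
      * lapIntegrand (5 / 2) (invBranch n) u x t
      = exp (-(x * (t * u))) * borelTerm n (t * u) * u := by
  rw [borelTerm, lapIntegrand]
  ring

/-- Termwise integration is justified by the majorant n^{-4} e^{-Re(xu)t}, up to a constant
depending only on Im u. -/
theorem hasSum_rayLaplace {u : ℂ} (hu1 : ‖u‖ = 1) (hu : u.im ≠ 0) {x : ℂ}
    (hx : 0 < (x * u).re) :
    IntegrableOn (fun t : ℝ => exp (-(x * (t * u))) * borelSum (t * u) * u) (Ioi 0) ∧
    HasSum (fun n : ℕ => (54 * (Real.sqrt 3 : ℂ) / (Real.pi : ℂ) ^ 4) * (chi n / (n : ℂ) ^ 4)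
      * lapInt (5 / 2) (invBranch n) u x)
      (∫ t in Ioi (0 : ℝ), exp (-(x * (t * u))) * borelSum (t * u) * u) := by
  have hκ : 0 < |u.im| := abs_pos.mpr hu
  have hnorm : ∀ (t : ℝ) (n : ℕ), ‖exp (-(x * (t * u))) * borelTerm n (t * u) * u‖
      ≤ borelConst * |u.im| ^ (-(5 / 2) : ℝ) * (1 / (n : ℝ) ^ 4) * Real.exp (-(x * u).re * t) := by
    intro t n
    rw [norm_mul, norm_mul, hu1, mul_one, norm_exp_ray, mul_comm]
    gcongr
    exact norm_borelTerm_le hκ (abs_im_le_norm_one_sub hu1 _ t)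
  constructor
  · have hbound : ∀ t : ℝ, ‖exp (-(x * (t * u))) * borelSum (t * u) * u‖
        ≤ (∑' n : ℕ, borelConst * |u.im| ^ (-(5 / 2) : ℝ) * (1 / (n : ℝ) ^ 4))
          * Real.exp (-(x * u).re * t) := by
      intro t
      rw [norm_mul, norm_mul, hu1, mul_one, norm_exp_ray, mul_comm]
      gcongr
      exact norm_borelSum_le hκ fun n => abs_im_le_norm_one_sub hu1 _ t
    refine Integrable.mono' ((exp_neg_integrableOn_Ioi 0 hx).const_mul _) ?_
      (Eventually.of_forall hbound)
    refine ContinuousOn.aestronglyMeasurable ?_ measurableSet_Ioi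
    refine ContinuousOn.mul (ContinuousOn.mul (by fun_prop) ?_) continuousOn_const
    refine (differentiableOn_borelSum_halfPlane u.im).continuousOn.comp (by fun_prop) ?_
    intro t ht
    have ht0 : (0 : ℝ) < t := ht
    change 0 < u.im * ((t : ℂ) * u).im
    rw [im_ofReal_mul]
    have : 0 < u.im * u.im := mul_self_pos.mpr hu
    nlinarith
  · have h := hasSum_integral_of_summable_integral_norm (μ := volume.restrict (Ioi (0 : ℝ)))
      (F := fun (n : ℕ) (t : ℝ) => (54 * (Real.sqrt 3 : ℂ) / (Real.pi : ℂ) ^ 4)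
        * (chi n / (n : ℂ) ^ 4) * lapIntegrand (5 / 2) (invBranch n) u x t)
      (fun n => (integrableOn_lapIntegrand hu1 hu (by norm_num) _ hx).const_mul _) ?_
    · refine h.of_eq (fun n => ?_) ?_
      · rw [integral_const_mul]
        rfl
      · congr 1
        funext t
        simp only [borelTerm_ray]
        rw [tsum_mul_right, tsum_mul_left]
        rfl
    · have hs : Summable fun n : ℕ => borelConst * |u.im| ^ (-(5 / 2) : ℝ) * (1 / (n : ℝ) ^ 4)
          * ∫ t in Ioi (0 : ℝ), Real.exp (-(x * u).re * t) :=
        (summable_borel_bound |u.im|).mul_right _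
      refine Summable.of_nonneg_of_le (fun n => integral_nonneg fun t => norm_nonneg _)
        (fun n => ?_) hs
      rw [← integral_const_mul]
      refine integral_mono_of_nonneg (Eventually.of_forall fun t => norm_nonneg _)
        ((exp_neg_integrableOn_Ioi 0 hx).const_mul _) (Eventually.of_forall fun t => ?_)
      change ‖(54 * (Real.sqrt 3 : ℂ) / (Real.pi : ℂ) ^ 4)
        * (chi n / (n : ℂ) ^ 4) * lapIntegrand (5 / 2) (invBranch n) u x t‖ ≤ _
      rw [borelTerm_ray]
      exact hnorm t n

theorem invBranch_rpow {n : ℕ} (hn : n ≠ 0) :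
    invBranch n ^ (-(5 / 2) : ℝ) = Real.pi ^ 5 * n ^ 5 / (36 * Real.sqrt 6) := by
  have hn' : (0 : ℝ) < n := by exact_mod_cast Nat.pos_of_ne_zero hn
  have h6 : (0 : ℝ) < Real.sqrt 6 := Real.sqrt_pos.mpr (by norm_num)
  have hsq : Real.sqrt 6 ^ 2 = 6 := Real.sq_sqrt (by norm_num)
  set w := Real.pi * n / Real.sqrt 6 with hw
  have hw0 : 0 < w := by have := Real.pi_pos; positivity
  have e1 : invBranch n = w ^ (-2 : ℝ) := by
    rw [Real.rpow_neg hw0.le, show (2 : ℝ) = ((2 : ℕ) : ℝ) by norm_num, Real.rpow_natCast, hw,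
      invBranch, div_pow, hsq, inv_div, mul_pow]
  have e2 : w ^ (5 : ℝ) = w ^ 5 := by
    rw [← Real.rpow_natCast]; norm_num
  rw [e1, ← Real.rpow_mul hw0.le, show (-2 : ℝ) * -(5 / 2) = 5 by norm_num, e2, hw, div_pow,
    mul_pow]
  congr 1
  calc Real.sqrt 6 ^ 5 = (Real.sqrt 6 ^ 2) ^ 2 * Real.sqrt 6 := by ring
    _ = _ := by rw [hsq]; norm_num

/-- The constants combine as 54√3 · (4/3)/(36√6) = √2, and the powers of π as -4 + 1/2 + 5 = 3/2. -/
theorem jump_term (x : ℂ) (hx : x ≠ 0) (n : ℕ) :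
    (54 * (Real.sqrt 3 : ℂ) / (Real.pi : ℂ) ^ 4) * (chi n / (n : ℂ) ^ 4)
      * ((4 / 3 * I) * (Real.pi : ℂ) ^ (1 / 2 : ℂ) * (invBranch n : ℂ) ^ (-(5 / 2) : ℂ)
        * x ^ (3 / 2 : ℂ) * exp (-(x / invBranch n)))
      = I * (Real.sqrt 2 : ℂ) * ((Real.pi : ℂ) * x) ^ (3 / 2 : ℂ)
        * (chi n * n * exp (Real.pi * I * (n : ℂ) ^ 2 * (2 * Real.pi * I * x) / 12)) := by
  rcases Nat.eq_zero_or_pos n with rfl | hn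
  · simp [chi_zero]
  have hn0 : (n : ℂ) ≠ 0 := by exact_mod_cast hn.ne'
  have hpi : (Real.pi : ℂ) ≠ 0 := by exact_mod_cast Real.pi_ne_zero
  have e1 : (invBranch n : ℂ) ^ (-(5 / 2) : ℂ)
      = (Real.pi : ℂ) ^ 5 * n ^ 5 / (36 * (Real.sqrt 6 : ℂ)) := by
    have h := congrArg (fun r : ℝ => (r : ℂ)) (invBranch_rpow hn.ne')
    rw [ofReal_cpow (invBranch_nonneg n)] at h
    push_cast at h
    exact h
  have e2 : exp (-(x / invBranch n))
      = exp (Real.pi * I * (n : ℂ) ^ 2 * (2 * Real.pi * I * x) / 12) := by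
    congr 1
    rw [invBranch]
    push_cast
    field_simp
    linear_combination -12 * I_sq
  have e3 : ((Real.pi : ℂ) * x) ^ (3 / 2 : ℂ)
      = Real.pi * (Real.pi : ℂ) ^ (1 / 2 : ℂ) * x ^ (3 / 2 : ℂ) := by
    rw [ofReal_mul_cpow Real.pi_pos hx]
    congr 1
    nth_rw 2 [← cpow_one (Real.pi : ℂ)]
    rw [← cpow_add _ _ hpi]
    norm_num
  have e4 : (Real.sqrt 6 : ℂ) = Real.sqrt 2 * Real.sqrt 3 := by
    rw [← ofReal_mul, ← Real.sqrt_mul (by norm_num)]; norm_num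
  have e5 : (Real.sqrt 2 : ℂ) * Real.sqrt 2 = 2 := by
    rw [← ofReal_mul, Real.mul_self_sqrt (by norm_num)]; norm_num
  have h2 : (Real.sqrt 2 : ℂ) ≠ 0 := fun h => by rw [h] at e5; norm_num at e5
  have h3 : (Real.sqrt 3 : ℂ) ≠ 0 := by
    exact_mod_cast (Real.sqrt_pos.mpr (by norm_num : (0 : ℝ) < 3)).ne'
  rw [e1, e2, e3, e4]
  field_simp
  linear_combination (-108 * chi n * x ^ (3 / 2 : ℂ)) * e5

theorem rayLaplace_sub {u v : ℂ} (hu1 : ‖u‖ = 1) (hu : u.im ≠ 0) (hure : 0 < u.re)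
    (hv1 : ‖v‖ = 1) (hv : v.im ≠ 0) (hvre : 0 < v.re) {x : ℂ}
    (hx : 0 < x.re) (hxu : 0 < (x * u).re) (hxv : 0 < (x * v).re) :
    rayLaplace u x - rayLaplace v x = (raySign u - raySign v) *
      (I * (Real.sqrt 2 : ℂ) * ((Real.pi : ℂ) * x) ^ (3 / 2 : ℂ)
        * etaTilde (2 * Real.pi * I * x)) := by
  have hx0 : x ≠ 0 := fun h => by simp [h] at hx
  rw [rayLaplace, rayLaplace, ← (hasSum_rayLaplace hu1 hu hxu).2.summable.tsum_sub
    (hasSum_rayLaplace hv1 hv hxv).2.summable, etaTilde, ← tsum_mul_left, ← tsum_mul_left]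
  congr 1
  funext n
  rw [← jump_term x hx0 n, ← mul_sub]
  -- For n = 0 the parameter c is 0 and the jump formula does not apply, but χ(0) = 0.
  rcases Nat.eq_zero_or_pos n with rfl | hn
  · simp [chi_zero]
  have hc : 0 < invBranch n := by
    have : (0 : ℝ) < n := by exact_mod_cast hn
    have := Real.pi_pos
    unfold invBranch
    positivity
  rw [lapInt_sub_lapInt hu1 hu hure hv1 hv hvre hc hx hxu hxv]
  ring

theorem exp_I_mul_re (θ : ℝ) : (exp (I * θ)).re = Real.cos θ := by
  rw [mul_comm, exp_ofReal_mul_I_re]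

theorem exp_I_mul_im (θ : ℝ) : (exp (I * θ)).im = Real.sin θ := by
  rw [mul_comm, exp_ofReal_mul_I_im]

theorem norm_exp_I_mul (θ : ℝ) : ‖exp (I * θ)‖ = 1 := by
  rw [mul_comm, norm_exp_ofReal_mul_I]

theorem hasRayLaplace_borelSum {θ : ℝ} (hθ : Real.sin θ ≠ 0) {x : ℂ}
    (hx : 0 < (x * exp (I * θ)).re) :
    HasRayLaplace borelSum θ x (rayLaplace (exp (I * θ)) x) := by
  have h := hasSum_rayLaplace (norm_exp_I_mul θ) (by rwa [exp_I_mul_im]) hx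
  exact ⟨h.1, h.2.tsum_eq.symm⟩

theorem exists_small_angle {x : ℂ} (hx : 0 < x.re) :
    ∃ θ ∈ Ioo (0 : ℝ) (Real.pi / 2), ∀ s : ℝ, s = 1 ∨ s = -1 →
      0 < (x * exp (I * ((s * θ : ℝ) : ℂ))).re := by
  have h : ∀ s : ℝ, ∀ᶠ θ : ℝ in 𝓝 0, 0 < (x * exp (I * ((s * θ : ℝ) : ℂ))).re := by
    intro s
    have hc : Continuous fun θ : ℝ => (x * exp (I * ((s * θ : ℝ) : ℂ))).re := by fun_prop
    exact (hc.tendsto 0).eventually (lt_mem_nhds (by simpa using hx))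
  have h2 : ∀ᶠ θ : ℝ in 𝓝[>] 0, θ ∈ Ioo (0 : ℝ) (Real.pi / 2) :=
    Ioo_mem_nhdsGT (by positivity)
  obtain ⟨θ, ⟨h1, h3⟩, h4⟩ := ((((h 1).and (h (-1))).filter_mono nhdsWithin_le_nhds).and h2).exists
  exact ⟨θ, h4, fun s hs => by rcases hs with rfl | rfl <;> assumption⟩

/-- The Borel transform has lateral Laplace transforms on the right half-plane, and these are the
only ones. -/
theorem hasLateralLaplace_iff {s : ℝ} (hs : s = 1 ∨ s = -1) {x : ℂ} (hx : 0 < x.re) {θ : ℝ}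
    (hθ : θ ∈ Ioo (0 : ℝ) (Real.pi / 2)) (hxθ : 0 < (x * exp (I * ((s * θ : ℝ) : ℂ))).re) (L : ℂ) :
    HasLateralLaplace F s x L ↔ L = rayLaplace (exp (I * ((s * θ : ℝ) : ℂ))) x := by
  have hs0 : s ≠ 0 := by rcases hs with rfl | rfl <;> norm_num
  have hss : s * s = 1 := by rcases hs with rfl | rfl <;> norm_num
  have hsin : ∀ θ ∈ Ioo (0 : ℝ) (Real.pi / 2), 0 < s * Real.sin (s * θ) := by
    intro θ hθ
    have := Real.sin_pos_of_pos_of_lt_pi hθ.1 (by linarith [hθ.2, Real.pi_pos])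
    rcases hs with rfl | rfl
    · simpa using this
    · simpa using this
  have hcos : ∀ θ ∈ Ioo (0 : ℝ) (Real.pi / 2), 0 < Real.cos (s * θ) := by
    intro θ hθ
    have := Real.cos_pos_of_mem_Ioo (x := θ) ⟨by linarith [hθ.1, Real.pi_pos], hθ.2⟩
    rcases hs with rfl | rfl
    · simpa using this
    · simpa using this
  have hne : ∀ θ ∈ Ioo (0 : ℝ) (Real.pi / 2), Real.sin (s * θ) ≠ 0 := fun θ hθ h => by
    have := hsin θ hθ
    rw [h, mul_zero] at this
    exact lt_irrefl _ this
  have hsign : ∀ θ ∈ Ioo (0 : ℝ) (Real.pi / 2),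
      raySign (exp (I * ((s * θ : ℝ) : ℂ))) = s := by
    intro θ hθ
    have h := hsin θ hθ
    rcases hs with rfl | rfl
    · rw [raySign_of_pos (by rw [exp_I_mul_im]; linarith), ofReal_one]
    · rw [raySign_of_neg (by rw [exp_I_mul_im]; linarith), ofReal_neg, ofReal_one]
  constructor
  · rintro ⟨g, hg, h⟩
    obtain ⟨-, h2⟩ := h θ hθ hxθ
    -- For uniqueness a single angle is enough, since any other continuation agrees with `borelSum`
    -- along that ray.
    have heq := hg.eqOn hs0 (isContinuation_borelSum s)
    rw [← h2, ← (hasRayLaplace_borelSum (hne θ hθ) hxθ).2]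
    refine setIntegral_congr_fun measurableSet_Ioi fun t ht => ?_
    have ht0 : (0 : ℝ) < t := ht
    have hmem : (t : ℂ) * exp (I * ((s * θ : ℝ) : ℂ)) ∈ {p : ℂ | 0 < s * p.im} := by
      change 0 < s * ((t : ℂ) * exp (I * ((s * θ : ℝ) : ℂ))).im
      rw [im_ofReal_mul, exp_I_mul_im, mul_left_comm]
      exact mul_pos ht0 (hsin θ hθ)
    simp only [heq hmem]
  · rintro rfl
    refine ⟨borelSum, isContinuation_borelSum s, fun θ' hθ' hxθ' => ?_⟩
    -- Both rays lie on the same side, so the jump factor is 0 and the transform does not depend on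
    -- the angle.
    have hd := rayLaplace_sub (norm_exp_I_mul (s * θ))
      (by rw [exp_I_mul_im]; exact hne θ hθ) (by rw [exp_I_mul_re]; exact hcos θ hθ)
      (norm_exp_I_mul (s * θ')) (by rw [exp_I_mul_im]; exact hne θ' hθ')
      (by rw [exp_I_mul_re]; exact hcos θ' hθ') hx hxθ hxθ'
    rw [hsign θ hθ, hsign θ' hθ', sub_self, zero_mul, sub_eq_zero] at hd
    rw [hd]
    exact hasRayLaplace_borelSum (hne θ' hθ') hxθ'

theorem isAssociatedDirichletSeries_iff (δ : ℂ → ℂ) :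
    IsAssociatedDirichletSeries F δ ↔ ∀ x : ℂ, 0 < x.re →
      δ x = I * (Real.sqrt 2 : ℂ) * ((Real.pi : ℂ) * x) ^ (3 / 2 : ℂ)
        * etaTilde (2 * Real.pi * I * x) := by
  refine forall₂_congr fun x hx => ?_
  obtain ⟨θ, hθ, h⟩ := exists_small_angle hx
  have h1 := h 1 (Or.inl rfl)
  have h2 := h (-1) (Or.inr rfl)
  have hsin := Real.sin_pos_of_pos_of_lt_pi hθ.1 (by linarith [hθ.2, Real.pi_pos])
  have hcos := Real.cos_pos_of_mem_Ioo (x := θ) ⟨by linarith [hθ.1, Real.pi_pos], hθ.2⟩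
  have i1 : 0 < (exp (I * ((1 * θ : ℝ) : ℂ))).im := by rw [exp_I_mul_im, one_mul]; exact hsin
  have i2 : (exp (I * ((-1 * θ : ℝ) : ℂ))).im < 0 := by
    rw [exp_I_mul_im, neg_one_mul, Real.sin_neg]; linarith
  have hd := rayLaplace_sub (norm_exp_I_mul (1 * θ)) i1.ne'
    (by rw [exp_I_mul_re, one_mul]; exact hcos) (norm_exp_I_mul (-1 * θ)) i2.ne
    (by rw [exp_I_mul_re, neg_one_mul, Real.cos_neg]; exact hcos) hx h1 h2
  -- The signs differ by 2, which the factor 1/2 in the definition of δ removes.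
  rw [raySign_of_pos i1, raySign_of_neg i2] at hd
  simp only [hasLateralLaplace_iff (Or.inl rfl) hx hθ h1,
    hasLateralLaplace_iff (Or.inr rfl) hx hθ h2]
  constructor
  · rintro ⟨_, _, rfl, rfl, h3⟩
    rw [h3, hd]
    ring
  · intro h3
    refine ⟨_, _, rfl, rfl, ?_⟩
    rw [h3, hd]
    ring

end Lateral

/-! ### Gaussian regularization of ∑ n c(n) for periodic c. -/

section Regularization

open Filter Topology Set

/-- The mean value inequality, applied once for each order; the constants are not sharp. -/
theorem taylor_bounds {h h₁ h₂ h₃ : ℝ → ℝ} (d₀ : ∀ y, HasDerivAt h (h₁ y) y)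
    (d₁ : ∀ y, HasDerivAt h₁ (h₂ y) y) (d₂ : ∀ y, HasDerivAt h₂ (h₃ y) y) {a b C : ℝ}
    (hC : ∀ y ∈ Icc a b, |h₃ y| ≤ C) {y : ℝ} (hy : y ∈ Icc a b) :
    |h₁ y - h₁ a - h₂ a * (y - a)| ≤ C * (b - a) ^ 2 ∧
    |h y - h a - h₁ a * (y - a) - h₂ a * (y - a) ^ 2 / 2| ≤ C * (b - a) ^ 3 := by
  have ha : a ∈ Icc a b := ⟨le_rfl, hy.1.trans hy.2⟩
  have hab : 0 ≤ b - a := by linarith [hy.1, hy.2]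
  have hC0 : 0 ≤ C := (abs_nonneg _).trans (hC a ha)
  have step : ∀ {f f' : ℝ → ℝ} {K : ℝ}, (∀ y, HasDerivAt f (f' y) y) → 0 ≤ K →
      (∀ y ∈ Icc a b, |f' y| ≤ K) → ∀ y ∈ Icc a b, |f y - f a| ≤ K * (b - a) := by
    intro f f' K hd hK hb y hy
    have := (convex_Icc a b).norm_image_sub_le_of_norm_hasDerivWithin_le
      (fun y _ => (hd y).hasDerivWithinAt) hb ha hy
    have e : |y - a| = y - a := abs_of_nonneg (by linarith [hy.1])
    rw [Real.norm_eq_abs, Real.norm_eq_abs, e] at this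
    exact this.trans (mul_le_mul_of_nonneg_left (by linarith [hy.2]) hK)
  have s2 := step d₂ hC0 hC
  have s1 : ∀ y ∈ Icc a b, |h₁ y - h₁ a - h₂ a * (y - a)| ≤ C * (b - a) * (b - a) := by
    intro y hy
    have := step (f := fun y => h₁ y - h₂ a * (y - a)) (f' := fun y => h₂ y - h₂ a)
      (fun y => ((d₁ y).sub (((hasDerivAt_id' y).sub_const a).const_mul (h₂ a))).congr_deriv
        (by ring)) (by positivity) s2 y hy
    convert! this using 2
    ring
  have s0 := step (f := fun y => h y - h₁ a * (y - a) - h₂ a * (y - a) ^ 2 / 2)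
      (f' := fun y => h₁ y - h₁ a - h₂ a * (y - a))
      (fun y => (((d₀ y).sub (((hasDerivAt_id' y).sub_const a).const_mul (h₁ a))).sub
        (((((hasDerivAt_id' y).sub_const a).pow 2).const_mul (h₂ a)).div_const 2)).congr_deriv
        (by push_cast; ring)) (by positivity) s1 y hy
  refine ⟨(s1 y hy).trans_eq (by ring), ?_⟩
  refine Eq.trans_le ?_ (s0.trans_eq (by ring : C * (b - a) * (b - a) * (b - a) = _))
  congr 1
  ring

/-- Expanding h at a, the vanishing moments remove h(a) and h'(a). The second moment leaves Mγ
h''(a), which is γ(h'(a + M) - h'(a)) up to third-order terms; in this form consecutive blocks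
telescope. -/
theorem norm_block_le {c : ℕ → ℂ} {M : ℕ}
    (hc0 : ∑ r ∈ Finset.range M, c r = 0) (hc1 : ∑ r ∈ Finset.range M, c r * r = 0)
    {γ : ℂ} (hγ : ∑ r ∈ Finset.range M, c r * (r : ℂ) ^ 2 = 2 * M * γ)
    {h h₁ h₂ h₃ : ℝ → ℝ} (d₀ : ∀ y, HasDerivAt h (h₁ y) y)
    (d₁ : ∀ y, HasDerivAt h₁ (h₂ y) y) (d₂ : ∀ y, HasDerivAt h₂ (h₃ y) y) {a C : ℝ}
    (hC : ∀ y ∈ Icc a (a + M), |h₃ y| ≤ C) :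
    ‖∑ r ∈ Finset.range M, c r * (h (a + r) : ℂ) - γ * ((h₁ (a + M) : ℂ) - h₁ a)‖
      ≤ C * ((∑ r ∈ Finset.range M, ‖c r‖) * M ^ 3 + ‖γ‖ * M ^ 2) := by
  have hmem : ∀ r : ℕ, r ≤ M → a + r ∈ Icc a (a + M) := fun r hr => by
    have : (r : ℝ) ≤ M := by exact_mod_cast hr
    exact ⟨by linarith [(Nat.cast_nonneg r : (0 : ℝ) ≤ r)], by linarith⟩
  set R : ℕ → ℝ := fun r => h (a + r) - h a - h₁ a * r - h₂ a * (r : ℝ) ^ 2 / 2 with hR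
  have hRb : ∀ r ∈ Finset.range M, |R r| ≤ C * M ^ 3 := by
    intro r hr
    have := (taylor_bounds d₀ d₁ d₂ hC (hmem r (Finset.mem_range.mp hr).le)).2
    simpa [hR] using this
  set S : ℝ := h₁ (a + M) - h₁ a - h₂ a * M with hS
  have hSb : |S| ≤ C * M ^ 2 := by
    have := (taylor_bounds d₀ d₁ d₂ hC (hmem M le_rfl)).1
    simpa [hS] using this
  have e : ∑ r ∈ Finset.range M, c r * (h (a + r) : ℂ) - γ * ((h₁ (a + M) : ℂ) - h₁ a)
      = ∑ r ∈ Finset.range M, c r * (R r : ℂ) - γ * (S : ℂ) := by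
    have e1 : ∀ r, c r * (R r : ℂ) = c r * (h (a + r) : ℂ) - (h a : ℂ) * c r
        - (h₁ a : ℂ) * (c r * r) - (h₂ a : ℂ) / 2 * (c r * (r : ℂ) ^ 2) := by
      intro r
      simp only [hR]
      push_cast
      ring
    rw [Finset.sum_congr rfl fun r _ => e1 r, Finset.sum_sub_distrib, Finset.sum_sub_distrib,
      Finset.sum_sub_distrib, ← Finset.mul_sum, ← Finset.mul_sum, ← Finset.mul_sum, hc0, hc1, hγ,
      hS]
    push_cast
    ring
  rw [e]
  refine (norm_sub_le _ _).trans ?_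
  have b1 : ‖∑ r ∈ Finset.range M, c r * (R r : ℂ)‖ ≤ (∑ r ∈ Finset.range M, ‖c r‖) * (C * M ^ 3) := by
    rw [Finset.sum_mul]
    refine (norm_sum_le _ _).trans (Finset.sum_le_sum fun r hr => ?_)
    rw [norm_mul, Complex.norm_real, Real.norm_eq_abs]
    exact mul_le_mul_of_nonneg_left (hRb r hr) (norm_nonneg _)
  have b2 : ‖γ * (S : ℂ)‖ ≤ ‖γ‖ * (C * M ^ 2) := by
    rw [norm_mul, Complex.norm_real, Real.norm_eq_abs]
    exact mul_le_mul_of_nonneg_left hSb (norm_nonneg _)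
  linarith

theorem gauss_derivs (t y : ℝ) :
    HasDerivAt (fun y => y * Real.exp (-t * y ^ 2))
      ((1 - 2 * t * y ^ 2) * Real.exp (-t * y ^ 2)) y ∧
    HasDerivAt (fun y => (1 - 2 * t * y ^ 2) * Real.exp (-t * y ^ 2))
      ((-6 * t * y + 4 * t ^ 2 * y ^ 3) * Real.exp (-t * y ^ 2)) y ∧
    HasDerivAt (fun y => (-6 * t * y + 4 * t ^ 2 * y ^ 3) * Real.exp (-t * y ^ 2))
      ((-6 * t + 24 * t ^ 2 * y ^ 2 - 8 * t ^ 3 * y ^ 4) * Real.exp (-t * y ^ 2)) y := by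
  have he : HasDerivAt (fun y => Real.exp (-t * y ^ 2))
      (Real.exp (-t * y ^ 2) * (-t * (2 * y))) y := by
    refine (((hasDerivAt_id' y).pow 2).const_mul (-t)).exp.congr_deriv ?_
    simp
  refine ⟨?_, ?_, ?_⟩
  · exact ((hasDerivAt_id' y).mul he).congr_deriv (by ring)
  · have h1 : HasDerivAt (fun y => 1 - 2 * t * y ^ 2) (-(2 * t * (2 * y))) y :=
      ((((hasDerivAt_id' y).pow 2).const_mul (2 * t)).const_sub 1).congr_deriv (by simp)
    exact (h1.mul he).congr_deriv (by ring)
  · have h1 : HasDerivAt (fun y => -6 * t * y + 4 * t ^ 2 * y ^ 3)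
        (-6 * t + 4 * t ^ 2 * (3 * y ^ 2)) y :=
      (((hasDerivAt_id' y).const_mul (-6 * t)).add
        (((hasDerivAt_id' y).pow 3).const_mul (4 * t ^ 2))).congr_deriv (by simp)
    exact (h1.mul he).congr_deriv (by ring)

theorem pow_mul_exp_neg_le {s : ℝ} (hs : 0 ≤ s) (n : ℕ) :
    s ^ n * Real.exp (-s) ≤ n.factorial := by
  have h := Real.pow_div_factorial_le_exp s hs n
  rw [div_le_iff₀ (by exact_mod_cast n.factorial_pos)] at h
  rw [Real.exp_neg, ← div_eq_mul_inv, div_le_iff₀ (Real.exp_pos s), mul_comm]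
  exact h

/-- Uniformity in t ≤ 1 makes this a dominating bound. With s = ty², the inequalities s^n e^{-s} ≤
n! give 46 for the factor 1 and 102 for the factor y², in total 148. -/
theorem gauss_third_deriv_le {t : ℝ} (ht : 0 < t) (ht1 : t ≤ 1) (y : ℝ) :
    |(-6 * t + 24 * t ^ 2 * y ^ 2 - 8 * t ^ 3 * y ^ 4) * Real.exp (-t * y ^ 2)|
      ≤ 148 / (1 + y ^ 2) := by
  set s := t * y ^ 2 with hs
  have hs0 : 0 ≤ s := by positivity
  have p0 := pow_mul_exp_neg_le hs0 0
  have p1 := pow_mul_exp_neg_le hs0 1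
  have p2 := pow_mul_exp_neg_le hs0 2
  have p3 := pow_mul_exp_neg_le hs0 3
  norm_num [Nat.factorial] at p0 p1 p2 p3
  have he : Real.exp (-t * y ^ 2) = Real.exp (-s) := by rw [hs]; ring_nf
  set E := Real.exp (-s) with hE
  have hE0 : 0 < E := Real.exp_pos _
  have hE1 : E ≤ 1 := Real.exp_le_one_iff.mpr (by linarith)
  rw [he, le_div_iff₀ (by positivity), abs_mul, abs_of_pos hE0]
  have hb : |-6 * t + 24 * t ^ 2 * y ^ 2 - 8 * t ^ 3 * y ^ 4| ≤ t * (6 + 24 * s + 8 * s ^ 2) := by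
    have e : -6 * t + 24 * t ^ 2 * y ^ 2 - 8 * t ^ 3 * y ^ 4 = t * (-6 + 24 * s - 8 * s ^ 2) := by
      rw [hs]; ring
    rw [e, abs_mul, abs_of_pos ht]
    refine mul_le_mul_of_nonneg_left ?_ ht.le
    rw [abs_le]
    constructor <;> nlinarith [sq_nonneg s]
  calc |-6 * t + 24 * t ^ 2 * y ^ 2 - 8 * t ^ 3 * y ^ 4| * E * (1 + y ^ 2)
      ≤ t * (6 + 24 * s + 8 * s ^ 2) * E * (1 + y ^ 2) := by gcongr
    _ = t * (6 * E + 24 * (s * E) + 8 * (s ^ 2 * E))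
        + (6 * (s * E) + 24 * (s ^ 2 * E) + 8 * (s ^ 3 * E)) := by rw [hs]; ring
    _ ≤ 1 * (6 * 1 + 24 * 1 + 8 * 2) + (6 * 1 + 24 * 2 + 8 * 6) := by gcongr
    _ = 148 := by norm_num

theorem sum_range_mul_add (f : ℕ → ℂ) (M K : ℕ) :
    ∑ n ∈ Finset.range (K * M), f n = ∑ k ∈ Finset.range K, ∑ r ∈ Finset.range M, f (k * M + r) := by
  induction K with
  | zero => simp
  | succ K ih => rw [Nat.succ_mul, Finset.sum_range_add, ih, Finset.sum_range_succ]

theorem tendsto_gauss_deriv {t : ℝ} (ht : 0 < t) :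
    Tendsto (fun y : ℝ => (1 - 2 * t * y ^ 2) * Real.exp (-t * y ^ 2)) atTop (𝓝 0) := by
  have hs : Tendsto (fun y : ℝ => t * y ^ 2) atTop atTop :=
    (tendsto_pow_atTop two_ne_zero).const_mul_atTop ht
  have h0 := (Real.tendsto_pow_mul_exp_neg_atTop_nhds_zero 0).comp hs
  have h1 := (Real.tendsto_pow_mul_exp_neg_atTop_nhds_zero 1).comp hs
  have h := h0.sub (h1.const_mul 2)
  rw [mul_zero, sub_zero] at h
  refine h.congr fun y => ?_
  simp only [Function.comp_apply, pow_zero, pow_one, neg_mul]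
  ring

theorem summable_mul_gauss {c : ℕ → ℂ} (hc : ∀ n, ‖c n‖ ≤ 1) {t : ℝ} (ht : 0 < t) :
    Summable fun n : ℕ => c n * ((n * Real.exp (-t * (n : ℝ) ^ 2) : ℝ) : ℂ) := by
  refine Summable.of_norm_bounded (Real.summable_pow_mul_exp_neg_nat_mul 1 ht) fun n => ?_
  rw [norm_mul, Complex.norm_real, Real.norm_of_nonneg (by positivity), pow_one]
  have h1 : (n : ℝ) ≤ (n : ℝ) ^ 2 := by exact_mod_cast Nat.le_self_pow two_ne_zero n
  have h2 : Real.exp (-t * (n : ℝ) ^ 2) ≤ Real.exp (-t * n) :=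
    Real.exp_le_exp.mpr (by nlinarith)
  calc ‖c n‖ * (n * Real.exp (-t * (n : ℝ) ^ 2)) ≤ 1 * (n * Real.exp (-t * n)) :=
        mul_le_mul (hc n) (mul_le_mul_of_nonneg_left h2 (Nat.cast_nonneg n)) (by positivity)
          zero_le_one
    _ = _ := one_mul _

/-- The regularized value of `∑ n c(n)` for periodic `c` with vanishing moments of order `0`
and `1`. -/
theorem tendsto_tsum_mul_gauss {c : ℕ → ℂ} {M : ℕ} (hM : 0 < M) (hper : ∀ n, c (n + M) = c n)
    (hc : ∀ n, ‖c n‖ ≤ 1)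
    (hc0 : ∑ r ∈ Finset.range M, c r = 0) (hc1 : ∑ r ∈ Finset.range M, c r * r = 0)
    {γ : ℂ} (hγ : ∑ r ∈ Finset.range M, c r * (r : ℂ) ^ 2 = 2 * M * γ) :
    Tendsto (fun t : ℝ => ∑' n : ℕ, c n * ((n * Real.exp (-t * (n : ℝ) ^ 2) : ℝ) : ℂ))
      (𝓝[>] 0) (𝓝 (-γ)) := by
  set h : ℝ → ℝ → ℝ := fun t y => y * Real.exp (-t * y ^ 2) with hh
  set h₁ : ℝ → ℝ → ℝ := fun t y => (1 - 2 * t * y ^ 2) * Real.exp (-t * y ^ 2) with hh1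
  -- The error of the k-th block after its telescoping part is removed. It is O(1/(1 + k²))
  -- uniformly in t.
  set R : ℝ → ℕ → ℂ := fun t k => ∑ r ∈ Finset.range M, c r * (h t ((k * M : ℕ) + r) : ℂ)
    - γ * ((h₁ t ((k * M : ℕ) + M) : ℂ) - h₁ t (k * M : ℕ)) with hR
  set B : ℝ := (∑ r ∈ Finset.range M, ‖c r‖) * M ^ 3 + ‖γ‖ * M ^ 2 with hB
  have hB0 : 0 ≤ B := by positivity
  have hper' : ∀ k r, c (k * M + r) = c r := by
    intro k r
    induction k with
    | zero => simp
    | succ k ih => rw [← ih, ← hper (k * M + r)]; congr 1; ring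
  have hRb : ∀ t : ℝ, 0 < t → t ≤ 1 → ∀ k, ‖R t k‖ ≤ 148 * B * (1 / (1 + (k : ℝ) ^ 2)) := by
    intro t ht ht1 k
    have := norm_block_le hc0 hc1 hγ (fun y => (gauss_derivs t y).1)
      (fun y => (gauss_derivs t y).2.1) (fun y => (gauss_derivs t y).2.2)
      (a := ((k * M : ℕ) : ℝ)) (C := 148 / (1 + (k : ℝ) ^ 2)) (fun y hy => ?_)
    · refine this.trans_eq ?_
      rw [← hB]
      ring
    · refine (gauss_third_deriv_le ht ht1 y).trans ?_
      have hk : (k : ℝ) ≤ y := by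
        refine le_trans ?_ hy.1
        exact_mod_cast Nat.le_mul_of_pos_right k hM
      gcongr
  have hsumB : Summable fun k : ℕ => 148 * B * (1 / (1 + (k : ℝ) ^ 2)) := by
    refine Summable.mul_left _ ?_
    refine Summable.of_nonneg_of_le (fun k => by positivity) (fun k => ?_)
      ((summable_nat_add_iff 1).mpr
        ((Real.summable_one_div_nat_pow.mpr one_lt_two).mul_left 2))
    push_cast
    rw [mul_one_div, div_le_div_iff₀ (by positivity) (by positivity)]
    nlinarith [sq_nonneg ((k : ℝ) - 1)]
  have hformula : ∀ t : ℝ, 0 < t → t ≤ 1 →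
      ∑' n : ℕ, c n * ((n * Real.exp (-t * (n : ℝ) ^ 2) : ℝ) : ℂ) = ∑' k, R t k - γ * h₁ t 0 := by
    intro t ht ht1
    have hs := (summable_mul_gauss hc ht).hasSum.tendsto_sum_nat
    have hmul : Tendsto (fun K : ℕ => K * M) atTop atTop :=
      tendsto_id.atTop_mul_const' hM
    have hs' := hs.comp hmul
    have hRs : Summable (R t) := Summable.of_norm_bounded hsumB (hRb t ht ht1)
    have hend : Tendsto (fun K : ℕ => (h₁ t (K * M : ℕ) : ℂ)) atTop (𝓝 ((0 : ℝ) : ℂ)) :=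
      (Complex.continuous_ofReal.tendsto 0).comp
        ((tendsto_gauss_deriv ht).comp (tendsto_natCast_atTop_atTop.comp hmul))
    have hlim := hRs.hasSum.tendsto_sum_nat.add ((hend.sub_const (h₁ t 0 : ℂ)).const_mul γ)
    rw [Complex.ofReal_zero, zero_sub, mul_neg, ← sub_eq_add_neg] at hlim
    refine tendsto_nhds_unique hs' (hlim.congr fun K => ?_)
    simp only [Function.comp_apply]
    rw [sum_range_mul_add]
    -- The telescoped part tends to -γ `h₁ t 0`, and `h₁ t 0` = 1; this is where the limit -γ comes
    -- from.
    have tel : (h₁ t (K * M : ℕ) : ℂ) - h₁ t 0 = ∑ k ∈ Finset.range K,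
        ((h₁ t ((k * M : ℕ) + M) : ℂ) - h₁ t (k * M : ℕ)) := by
      have := Finset.sum_range_sub (fun k => (h₁ t (k * M : ℕ) : ℂ)) K
      rw [Nat.zero_mul, Nat.cast_zero] at this
      rw [← this]
      refine Finset.sum_congr rfl fun k _ => ?_
      rw [Nat.succ_mul, Nat.cast_add (k * M) M]
    rw [tel, Finset.mul_sum, ← Finset.sum_add_distrib]
    refine Finset.sum_congr rfl fun k _ => ?_
    simp only [hR, sub_add_cancel]
    refine Finset.sum_congr rfl fun r _ => ?_
    rw [hper']
    simp only [hh]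
    push_cast
    rfl
  have hev : ∀ᶠ t : ℝ in 𝓝[>] 0, 0 < t ∧ t ≤ 1 := by
    filter_upwards [Ioo_mem_nhdsGT (zero_lt_one' ℝ)] with t ht
    exact ⟨ht.1, ht.2.le⟩
  have hh_lim : ∀ y : ℝ, Tendsto (fun t => (h t y : ℂ)) (𝓝[>] 0) (𝓝 (y : ℂ)) := by
    intro y
    have hc : Continuous fun t : ℝ => (h t y : ℂ) := by simp only [hh]; fun_prop
    have := hc.tendsto 0
    simp only [hh, neg_zero, zero_mul, Real.exp_zero, mul_one] at this
    exact this.mono_left nhdsWithin_le_nhds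
  have hh1_lim : ∀ y : ℝ, Tendsto (fun t => (h₁ t y : ℂ)) (𝓝[>] 0) (𝓝 1) := by
    intro y
    have hc : Continuous fun t : ℝ => (h₁ t y : ℂ) := by simp only [hh1]; fun_prop
    have := hc.tendsto 0
    simp only [hh1, neg_zero, zero_mul, mul_zero, sub_zero, Real.exp_zero, mul_one,
      Complex.ofReal_one] at this
    exact this.mono_left nhdsWithin_le_nhds
  -- As t → 0, h becomes the linear function y, which the two vanishing moments annihilate, and h'
  -- becomes constant.
  have hRlim : ∀ k, Tendsto (fun t => R t k) (𝓝[>] 0) (𝓝 0) := by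
    intro k
    have h1 := (tendsto_finsetSum (Finset.range M) fun r _ =>
      (hh_lim ((k * M : ℕ) + r)).const_mul (c r)).sub
      (((hh1_lim ((k * M : ℕ) + M)).sub (hh1_lim (k * M : ℕ))).const_mul γ)
    have e : ∑ r ∈ Finset.range M, c r * (((k * M : ℕ) + r : ℝ) : ℂ) - γ * (1 - 1) = 0 := by
      have : ∀ r, c r * (((k * M : ℕ) + r : ℝ) : ℂ) = ((k * M : ℕ) : ℂ) * c r + c r * r := by
        intro r; push_cast; ring
      rw [Finset.sum_congr rfl fun r _ => this r, Finset.sum_add_distrib, ← Finset.mul_sum, hc0,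
        hc1]
      ring
    rw [e] at h1
    exact h1
  have hT := tendsto_tsum_of_dominated_convergence hsumB hRlim
    (hev.mono fun t ht k => hRb t ht.1 ht.2 k)
  have hfin := hT.sub ((hh1_lim 0).const_mul γ)
  rw [tsum_zero, zero_sub, mul_one] at hfin
  exact hfin.congr' (hev.mono fun t ht => (hformula t ht.1 ht.2).symm)

end Regularization

/-! ### Moments at roots of unity and the radial limits of η̃. -/

section RootOfUnity

open Polynomial Finset

variable {R : Type*} [CommRing R]

/-- The substitution x ↦ qx permutes the N factors cyclically. -/
theorem qShift_mul_of_pow_eq_one {q : R} {N : ℕ} (hN : 0 < N) (hq : q ^ N = 1) (x : R) :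
    qShift q (q * x) N = qShift q x N := by
  obtain ⟨m, rfl⟩ := Nat.exists_eq_succ_of_ne_zero hN.ne'
  unfold qShift
  rw [prod_range_succ, prod_range_succ' (fun k => 1 - q ^ (k + 1) * x)]
  congr 1
  · exact prod_congr rfl fun k _ => by ring
  · rw [Nat.succ_eq_add_one] at hq
    linear_combination (-(q * x)) * hq

theorem qShift_pow_mul_of_pow_eq_one {q : R} {N : ℕ} (hN : 0 < N) (hq : q ^ N = 1) (x : R)
    (k : ℕ) : qShift q (q ^ k * x) N = qShift q x N := by
  induction k with
  | zero => simp
  | succ k ih => rw [pow_succ', mul_assoc, qShift_mul_of_pow_eq_one hN hq, ih]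

/-- The pentagonal number `i (3 i + 1) / 2`. -/
def pent (i : ℕ) : ℕ := ∑ j ∈ range i, (3 * j + 2)

theorem two_mul_pent (i : ℕ) : 2 * pent i = i * (3 * i + 1) := by
  induction i with
  | zero => rfl
  | succ i ih =>
    rw [pent, sum_range_succ, mul_add, ← pent, ih]
    ring

/-- The remainder factor is invariant under x ↦ qx, so it can be pulled out. The factors -q²(q^j x)³
accumulate to (-1)^k q^{∑(3j+2)} x^{3k}, whence `pent`. -/
theorem zagierSum_eq_iterate {q : R} {N : ℕ} (hN : 0 < N) (hq : q ^ N = 1) (x : R) (k : ℕ) :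
    zagierSum q x N = (1 - qShift q x N * x ^ N) * ∑ i ∈ range k,
        (-1) ^ i * q ^ pent i * (x ^ (3 * i) - q ^ (2 * i + 1) * x ^ (3 * i + 2))
      + (-1) ^ k * q ^ pent k * x ^ (3 * k) * zagierSum q (q ^ k * x) N := by
  induction k with
  | zero => simp [pent]
  | succ k ih =>
    have hx : (q ^ k * x) ^ N = x ^ N := by rw [mul_pow, ← pow_mul, mul_comm k, pow_mul, hq]; simp
    have h := zagierSum_add q (q ^ k * x) N
    rw [qShift_pow_mul_of_pow_eq_one hN hq, hx, pow_succ q N, hq, ← mul_assoc q, ← pow_succ'] at h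
    have hp : pent (k + 1) = pent k + (3 * k + 2) := sum_range_succ _ _
    rw [sum_range_succ, hp, ih]
    linear_combination (-1) ^ k * q ^ pent k * x ^ (3 * k) * h

/-- After 2N steps the argument returns to x, the sign is 1 and q^{N(6N+1)} = 1, so the iterated
equation can be solved for the sum. -/
theorem zagierSum_mul_one_sub_pow {q : R} {N : ℕ} (hN : 0 < N) (hq : q ^ N = 1) (x : R) :
    zagierSum q x N * (1 - x ^ (6 * N)) = (1 - qShift q x N * x ^ N) * ∑ i ∈ range (2 * N),
        (-1) ^ i * q ^ pent i * (x ^ (3 * i) - q ^ (2 * i + 1) * x ^ (3 * i + 2)) := by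
  have h := zagierSum_eq_iterate hN hq x (2 * N)
  have hp : pent (2 * N) = N * (6 * N + 1) := by
    have := two_mul_pent (2 * N)
    nlinarith
  have h1 : q ^ (2 * N) = 1 := by rw [mul_comm, pow_mul, hq, one_pow]
  have h2 : q ^ pent (2 * N) = 1 := by rw [hp, pow_mul, hq, one_pow]
  have h3 : (-1 : R) ^ (2 * N) = 1 := by rw [pow_mul]; simp
  rw [h1, h2, h3, one_mul, one_mul, one_mul, ← mul_assoc 3 2 N] at h
  linear_combination h

theorem eval_one_derivatives {B Q H : ℂ[X]} (h : (1 - X) ^ 2 * H = B * Q) (hB : B.eval 1 = 1) :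
    Q.eval 1 = 0 ∧ (derivative Q).eval 1 = 0 ∧
      (derivative (derivative Q)).eval 1 = 2 * H.eval 1 := by
  have h0 := congrArg (eval 1) h
  have h1 := congrArg (fun P => eval 1 (derivative P)) h
  have h2 := congrArg (fun P => eval 1 (derivative (derivative P))) h
  simp [derivative_mul, derivative_pow, hB] at h0 h1 h2
  refine ⟨h0.symm, ?_, ?_⟩
  · simpa [← h0] using h1.symm
  · have h1' : eval 1 (derivative Q) = 0 := by simpa [← h0] using h1.symm
    rw [← h0, h1'] at h2
    linear_combination -h2

theorem eval_one_C_mul_X_pow (a : ℂ) (n : ℕ) :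
    eval 1 (derivative (C a * X ^ n)) = a * n ∧
    eval 1 (derivative (derivative (C a * X ^ n))) = a * ((n : ℂ) ^ 2 - n) := by
  constructor
  · simp [derivative_X_pow]
  · cases n with
    | zero => simp
    | succ n =>
      simp only [derivative_C_mul, derivative_X_pow, eval_mul, eval_pow, eval_X,
        eval_C, one_pow, Nat.add_sub_cancel]
      push_cast
      ring

/-- The left side of `zagierSum_mul_one_sub_pow` has a double zero at x = 1: one factor from S, one
from 1 - x^{6N}. On the right, the cofactor of the theta polynomial Q is 1 there because (ζ)_N = 0.
So Q(1) = Q'(1) = 0 and Q''(1) = 2 · 6N · ∑ (ζ)_n. -/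
theorem sum_moments {ζ : ℂ} {N : ℕ} (hN : 0 < N) (hζ : ζ ^ N = 1) :
    (∑ i ∈ range (2 * N), (-1) ^ i * ζ ^ pent i * (1 - ζ ^ (2 * i + 1)) = 0) ∧
    (∑ i ∈ range (2 * N), (-1) ^ i * ζ ^ pent i *
      ((3 * i : ℕ) - ζ ^ (2 * i + 1) * (3 * i + 2 : ℕ)) = 0) ∧
    (∑ i ∈ range (2 * N), (-1) ^ i * ζ ^ pent i *
      ((3 * i : ℕ) ^ 2 - ζ ^ (2 * i + 1) * (3 * i + 2 : ℕ) ^ 2)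
      = 12 * N * ∑ n ∈ range N, qFactorial ζ n) := by
  have hq : (C ζ : ℂ[X]) ^ N = 1 := by rw [← C_pow, hζ, C_1]
  have key := zagierSum_mul_one_sub_pow hN hq (X : ℂ[X])
  set B : ℂ[X] := 1 - qShift (C ζ) X N * X ^ N with hB
  set T : ℂ[X] := ∑ n ∈ range N, qShift (C ζ) X n * X ^ n with hT
  set G : ℂ[X] := ∑ i ∈ range (6 * N), X ^ i with hG
  set a : ℕ → ℂ := fun i => (-1) ^ i * ζ ^ pent i with ha
  set b : ℕ → ℂ := fun i => (-1) ^ i * ζ ^ pent i * ζ ^ (2 * i + 1) with hb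
  set Q : ℂ[X] := ∑ i ∈ range (2 * N), (C (a i) * X ^ (3 * i) - C (b i) * X ^ (3 * i + 2)) with hQ
  have evq : ∀ n, eval 1 (qShift (C ζ) X n) = qFactorial ζ n := by
    intro n
    simp [qShift, qFactorial, eval_prod]
  have hfac : qFactorial ζ N = 0 := by
    refine prod_eq_zero (mem_range.mpr (Nat.sub_lt hN one_pos)) ?_
    rw [Nat.sub_one_add_one hN.ne', hζ, sub_self]
  have h : (1 - X) ^ 2 * (T * G) = B * Q := by
    have e1 : (1 - X) * G = 1 - X ^ (6 * N) := mul_neg_geom_sum X (6 * N)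
    have e2 : Q = ∑ i ∈ range (2 * N), (-1) ^ i * C ζ ^ pent i *
        (X ^ (3 * i) - C ζ ^ (2 * i + 1) * X ^ (3 * i + 2)) := by
      refine sum_congr rfl fun i _ => ?_
      simp only [ha, hb, map_mul, map_pow, map_neg, map_one]
      ring
    rw [e2, ← key, ← e1, zagierSum]
    ring
  have hB1 : B.eval 1 = 1 := by
    rw [hB]
    simp [evq, hfac]
  obtain ⟨m0, m1, m2⟩ := eval_one_derivatives h hB1
  have hH : (T * G).eval 1 = (∑ n ∈ range N, qFactorial ζ n) * (6 * N) := by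
    rw [eval_mul, hT, hG]
    simp [eval_finsetSum, evq]
  rw [hH] at m2
  simp only [hQ, eval_finsetSum, derivative_sum, derivative_sub, eval_sub,
    (eval_one_C_mul_X_pow _ _).1, (eval_one_C_mul_X_pow _ _).2] at m0 m1 m2
  have c0 : ∑ i ∈ range (2 * N), (-1) ^ i * ζ ^ pent i * (1 - ζ ^ (2 * i + 1)) = 0 := by
    rw [← m0]
    refine sum_congr rfl fun i _ => ?_
    simp [ha, hb]
    ring
  have c1 : ∑ i ∈ range (2 * N), (-1) ^ i * ζ ^ pent i *
      ((3 * i : ℕ) - ζ ^ (2 * i + 1) * (3 * i + 2 : ℕ)) = 0 := by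
    rw [← m1]
    exact sum_congr rfl fun i _ => by ring
  refine ⟨c0, c1, ?_⟩
  -- The second derivative yields e² - e for an exponent e; the vanishing first moment supplies the
  -- missing e.
  rw [← add_zero (∑ i ∈ range (2 * N), _), ← neg_zero, ← c1] 
  rw [← sub_eq_add_neg, sub_eq_iff_eq_add,
    show (12 : ℂ) * N * ∑ n ∈ range N, qFactorial ζ n
      = 2 * ((∑ n ∈ range N, qFactorial ζ n) * (6 * N)) by ring, ← m2, ← sum_add_distrib]
  exact sum_congr rfl fun i _ => by ring

theorem fRoot_eq_sum {ζ : ℂ} {N : ℕ} (hN : 0 < N) (hζ : ζ ^ N = 1) :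
    fRoot ζ = ∑ n ∈ range N, qFactorial ζ n := by
  refine tsum_eq_sum fun n hn => ?_
  rw [mem_range, not_lt] at hn
  refine prod_eq_zero (mem_range.mpr ((Nat.sub_lt hN one_pos).trans_le hn)) ?_
  rw [Nat.sub_one_add_one hN.ne', hζ, sub_self]

theorem chi_six_mul_add (i : ℕ) :
    chi (i * 6 + 0) = 0 ∧ chi (i * 6 + 1) = (-1) ^ i ∧ chi (i * 6 + 2) = 0 ∧
    chi (i * 6 + 3) = 0 ∧ chi (i * 6 + 4) = 0 ∧ chi (i * 6 + 5) = -(-1) ^ i := by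
  obtain ⟨j, rfl | rfl⟩ := i.even_or_odd'
  · have e : ∀ r, (2 * j * 6 + r) % 12 = r % 12 := fun r => by omega
    simp only [chi, e, pow_mul]
    norm_num
  · have e : ∀ r, ((2 * j + 1) * 6 + r) % 12 = (6 + r) % 12 := fun r => by omega
    simp only [chi, e, pow_add, pow_mul]
    norm_num

/-- The coefficients of `η̃` along the vertical line through `β`. -/
noncomputable def twist (β : ℂ) (n : ℕ) : ℂ :=
  chi n * Complex.exp (Real.pi * Complex.I * (n : ℂ) ^ 2 * β / 12)

theorem exp_sq_add (β : ℂ) (n m : ℕ) (h : n ^ 2 = 24 * m + 1) :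
    Complex.exp (Real.pi * Complex.I * (n : ℂ) ^ 2 * β / 12)
      = Complex.exp (Real.pi * Complex.I * β / 12)
        * Complex.exp (2 * Real.pi * Complex.I * β) ^ m := by
  have h' : (n : ℂ) ^ 2 = 24 * m + 1 := by exact_mod_cast h
  rw [h', ← Complex.exp_nat_mul, ← Complex.exp_add]
  congr 1
  ring

/-- The character χ lives on n = 6i + 1 and n = 6i + 5 with signs ±(-1)^i. There (n² - 1)/24 equals
`pent i` and `pent i` + 2i + 1, the exponents met in the functional equation. -/
theorem sum_twist_mul (β : ℂ) (w : ℕ → ℂ) (N : ℕ) :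
    ∑ n ∈ range (12 * N), twist β n * w n
      = Complex.exp (Real.pi * Complex.I * β / 12) * ∑ i ∈ range (2 * N),
        (-1) ^ i * Complex.exp (2 * Real.pi * Complex.I * β) ^ pent i *
          (w (i * 6 + 1) - Complex.exp (2 * Real.pi * Complex.I * β) ^ (2 * i + 1)
            * w (i * 6 + 5)) := by
  rw [show 12 * N = 2 * N * 6 by ring, sum_range_mul_add, mul_sum]
  refine sum_congr rfl fun i _ => ?_
  obtain ⟨h0, h1, h2, h3, h4, h5⟩ := chi_six_mul_add i
  have hp := two_mul_pent i
  have e1 := exp_sq_add β (i * 6 + 1) (pent i) (by nlinarith)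
  have e5 := exp_sq_add β (i * 6 + 5) (pent i + (2 * i + 1)) (by nlinarith)
  simp only [sum_range_succ, sum_range_zero, twist, h0, h1, h2, h3, h4, h5, e1, e5]
  ring

theorem exp_pow_den (β : ℚ) :
    Complex.exp (2 * Real.pi * Complex.I * (β : ℂ)) ^ β.den = 1 := by
  rw [← Complex.exp_nat_mul]
  have h : (β : ℂ) * β.den = β.num := by exact_mod_cast Rat.mul_den_eq_num β
  rw [show (β.den : ℂ) * (2 * Real.pi * Complex.I * (β : ℂ))
    = (β.num : ℂ) * (2 * Real.pi * Complex.I) by rw [← h]; ring]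
  exact Complex.exp_int_mul_two_pi_mul_I _

theorem twist_add (β : ℚ) (n : ℕ) : twist β (n + 12 * β.den) = twist β n := by
  have h1 : chi (n + 12 * β.den) = chi n := by simp [chi]
  have h2 : Complex.exp (Real.pi * Complex.I * ((n + 12 * β.den : ℕ) : ℂ) ^ 2 * β / 12)
      = Complex.exp (Real.pi * Complex.I * (n : ℂ) ^ 2 * β / 12)
        * (Complex.exp (2 * Real.pi * Complex.I * (β : ℂ)) ^ β.den) ^ (n + 6 * β.den) := by
    rw [← pow_mul, ← Complex.exp_nat_mul, ← Complex.exp_add]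
    congr 1
    push_cast
    ring
  rw [twist, h1, h2, exp_pow_den, one_pow, mul_one, twist]

theorem norm_twist_le (β : ℚ) (n : ℕ) : ‖twist β n‖ ≤ 1 := by
  have e : (Real.pi * Complex.I * (n : ℂ) ^ 2 * (β : ℂ) / 12)
      = ((Real.pi * (n : ℝ) ^ 2 * (β : ℝ) / 12 : ℝ) : ℂ) * Complex.I := by
    push_cast
    ring
  rw [twist, norm_mul, e, Complex.norm_exp_ofReal_mul_I, mul_one]
  exact norm_chi_le n

open Filter Topology in
/-- The radial limits of `η̃` at rational points. -/
theorem tendsto_etaTilde (β : ℚ) :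
    Tendsto (fun t : ℝ => etaTilde (β + Complex.I * t)) (𝓝[>] 0) (𝓝 (-(2 * phi β))) := by
  set ζ := Complex.exp (2 * Real.pi * Complex.I * (β : ℂ)) with hζ
  have hN : 0 < β.den := β.den_pos
  obtain ⟨m0, m1, m2⟩ := sum_moments hN (exp_pow_den β)
  rw [← hζ] at m0 m1 m2
  have s0 : ∑ n ∈ range (12 * β.den), twist β n = 0 := by
    have := sum_twist_mul β (fun _ => 1) β.den
    simp only [mul_one] at this
    rw [this, m0, mul_zero]
  have s1 : ∑ n ∈ range (12 * β.den), twist β n * n = 0 := by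
    rw [sum_twist_mul β (fun n => n) β.den, ← hζ]
    refine mul_eq_zero_of_right _ ?_
    have := congrArg₂ (· + ·) (congrArg (2 * ·) m1) m0
    simp only [mul_sum, ← sum_add_distrib, mul_zero, add_zero] at this
    rw [← this]
    refine sum_congr rfl fun i _ => ?_
    push_cast
    ring
  -- Since n = 2e + 1 with e = 3i or 3i + 2, the second moment in n is 4·(second) + 4·(first) +
  -- (zeroth) moment in e.
  have s2 : ∑ n ∈ range (12 * β.den), twist β n * (n : ℂ) ^ 2
      = 2 * (12 * β.den : ℕ) * (2 * phi β) := by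
    rw [sum_twist_mul β (fun n => (n : ℂ) ^ 2) β.den, ← hζ, phi, ← hζ,
      fRoot_eq_sum hN (exp_pow_den β)]
    have := congrArg₂ (· + ·) (congrArg₂ (· + ·) (congrArg (4 * ·) m2) (congrArg (4 * ·) m1)) m0
    simp only [mul_sum (range (2 * β.den)), ← sum_add_distrib, mul_zero, add_zero] at this
    have e : ∀ u v : ℂ, u = v →
        Complex.exp (Real.pi * Complex.I * β / 12) * u
          = Complex.exp (Real.pi * Complex.I * β / 12) * v := fun u v h => by rw [h]
    refine (e _ _ (Eq.trans (sum_congr rfl fun i _ => ?_) this)).trans ?_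
    · push_cast
      ring
    · push_cast
      ring
  have key := tendsto_tsum_mul_gauss (by omega : 0 < 12 * β.den) (twist_add β) (norm_twist_le β)
    s0 s1 s2
  have hscale : Tendsto (fun t : ℝ => Real.pi / 12 * t) (𝓝[>] 0) (𝓝[>] 0) := by
    refine tendsto_nhdsWithin_iff.mpr ⟨?_, ?_⟩
    · have : Continuous fun t : ℝ => Real.pi / 12 * t := by fun_prop
      have h := this.tendsto 0
      rw [mul_zero] at h
      exact h.mono_left nhdsWithin_le_nhds
    · filter_upwards [self_mem_nhdsWithin] with t ht
      have ht0 : 0 < t := ht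
      exact mul_pos (by positivity) ht0
  refine (key.comp hscale).congr fun t => ?_
  rw [Function.comp_apply, etaTilde]
  refine tsum_congr fun n => ?_
  have e : Complex.exp (Real.pi * Complex.I * (n : ℂ) ^ 2 * (β + Complex.I * t) / 12)
      = Complex.exp (Real.pi * Complex.I * (n : ℂ) ^ 2 * β / 12)
        * Complex.exp ((-(Real.pi / 12 * t) * (n : ℝ) ^ 2 : ℝ) : ℂ) := by
    rw [← Complex.exp_add]
    congr 1
    push_cast
    linear_combination (Real.pi * (n : ℂ) ^ 2 * t / 12) * Complex.I_sq
  rw [e, twist]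
  push_cast
  ring

end RootOfUnity

/-! ### Radial limits of δ and the branch of the power. -/

section RadialLimits

open Filter Topology Complex

theorem etaTilde_limit_mul (β : ℚ) :
    HasRadialLimit (fun x => I * (Real.sqrt 2 : ℂ) * ((Real.pi : ℂ) * x) ^ (3 / 2 : ℂ)
        * etaTilde (2 * Real.pi * I * x)) ((β : ℂ) / (2 * Real.pi * I))
      (I * (Real.sqrt 2 : ℂ) * (-(β * I / 2)) ^ (3 / 2 : ℂ) * (-(2 * phi β))) := by
  have hpi : (Real.pi : ℂ) ≠ 0 := by exact_mod_cast Real.pi_ne_zero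
  have hscale : Tendsto (fun t : ℝ => 2 * Real.pi * t) (𝓝[>] 0) (𝓝[>] 0) := by
    refine tendsto_nhdsWithin_iff.mpr ⟨?_, ?_⟩
    · have : Continuous fun t : ℝ => 2 * Real.pi * t := by fun_prop
      have h := this.tendsto 0
      rw [mul_zero] at h
      exact h.mono_left nhdsWithin_le_nhds
    · filter_upwards [self_mem_nhdsWithin] with t ht
      have ht0 : 0 < t := ht
      exact mul_pos (by positivity) ht0
  have h1 := (tendsto_etaTilde β).comp hscale
  have hre : (-((β : ℂ) * I / 2)).re = 0 := by
    have : (-((β : ℂ) * I / 2)) = ((-(β / 2) : ℝ) : ℂ) * I := by push_cast; ring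
    rw [this, re_ofReal_mul]
    simp
  have h2 : Tendsto (fun t : ℝ => ((Real.pi : ℂ) * (β / (2 * Real.pi * I) + t)) ^ (3 / 2 : ℂ))
      (𝓝[>] 0) (𝓝 ((-(β * I / 2)) ^ (3 / 2 : ℂ))) := by
    -- The exponent has positive real part, so the power is continuous on the closed right
    -- half-plane including 0; this covers β = 0.
    have hc := continuousAt_cpow_const_of_re_pos (z := -((β : ℂ) * I / 2)) (w := 3 / 2)
      (Or.inl hre.ge) (by norm_num)
    refine hc.tendsto.comp (Tendsto.mono_left ?_ nhdsWithin_le_nhds)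
    have : Continuous fun t : ℝ => (Real.pi : ℂ) * (β / (2 * Real.pi * I) + t) := by fun_prop
    convert! this.tendsto 0 using 2
    rw [ofReal_zero, add_zero]
    field_simp
    rw [I_sq]
    ring
  refine ((h2.const_mul (I * (Real.sqrt 2 : ℂ))).mul h1).congr fun t => ?_
  simp only [Function.comp_apply]
  congr 2
  push_cast
  field_simp

theorem inv_two_mul_cpow {a : ℝ} (ha : 0 < a) :
    (((2 * a)⁻¹ : ℝ) : ℂ) ^ (3 / 2 : ℂ)
      = (a : ℂ) ^ (-(3 / 2) : ℂ) * (2 * (Real.sqrt 2 : ℂ))⁻¹ := by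
  have e1 : (((2 * a)⁻¹ : ℝ) : ℂ) ^ (3 / 2 : ℂ) = (((2 * a)⁻¹ ^ (3 / 2 : ℝ) : ℝ) : ℂ) := by
    rw [ofReal_cpow (by positivity)]
    push_cast
    rfl
  have e2 : (a : ℂ) ^ (-(3 / 2) : ℂ) = ((a ^ (-(3 / 2) : ℝ) : ℝ) : ℂ) := by
    rw [ofReal_cpow ha.le]
    push_cast
    rfl
  have e3 : (2 : ℝ) ^ (3 / 2 : ℝ) = 2 * Real.sqrt 2 := by
    rw [Real.sqrt_eq_rpow, show (3 / 2 : ℝ) = 1 + 1 / 2 by norm_num,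
      Real.rpow_add two_pos, Real.rpow_one]
  rw [e1, e2, Real.inv_rpow (by positivity), Real.mul_rpow two_pos.le ha.le, e3,
    Real.rpow_neg ha.le]
  push_cast
  rw [mul_inv]
  ring

theorem I_cpow (s : ℂ) : I ^ s = exp (Real.pi * I / 2 * s) := by
  rw [cpow_def_of_ne_zero I_ne_zero, log_I]
  congr 1
  ring

theorem neg_I_cpow (s : ℂ) : (-I) ^ s = exp (-(Real.pi * I / 2) * s) := by
  rw [cpow_def_of_ne_zero (neg_ne_zero.mpr I_ne_zero), log_neg_I]
  congr 1
  ring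

theorem neg_one_cpow (s : ℂ) : (-1 : ℂ) ^ s = exp (Real.pi * I * s) := by
  rw [cpow_def_of_ne_zero (neg_ne_zero.mpr one_ne_zero), log_neg_one]

/-- Branch bookkeeping: α < 0 has argument π, while I/(2α) has argument ±π/2 according to the sign
of α. Both cases give the same eighth root of unity. -/
theorem radial_constant {α : ℝ} (hα : α ≠ 0) :
    I * (Real.sqrt 2 : ℂ) * (I / (2 * α)) ^ (3 / 2 : ℂ) * (-2)
      = zeta 24 ^ 3 * (α : ℂ) ^ (-(3 / 2) : ℂ) := by
  have hs : (Real.sqrt 2 : ℂ) ≠ 0 := by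
    exact_mod_cast (Real.sqrt_pos.mpr two_pos).ne'
  have hss : (Real.sqrt 2 : ℂ) * (2 * (Real.sqrt 2 : ℂ))⁻¹ = 1 / 2 := by field_simp
  have hz : zeta 24 ^ 3 = exp (Real.pi * I / 4) := by
    rw [zeta, ← exp_nat_mul]
    congr 1
    push_cast
    ring
  have hI : I = exp (Real.pi * I / 2) := by
    rw [mul_div_right_comm, exp_pi_div_two_mul_I]
  have hm : -1 = exp (-(Real.pi * I)) := by rw [exp_neg, exp_pi_mul_I]; norm_num
  rcases hα.lt_or_gt with h | h
  · have ha : 0 < -α := neg_pos.mpr h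
    have e1 : I / (2 * α) = (((2 * -α)⁻¹ : ℝ) : ℂ) * -I := by
      push_cast
      field_simp
    have e2 : (α : ℂ) = ((-α : ℝ) : ℂ) * -1 := by push_cast; ring
    rw [e1, ofReal_mul_cpow (by positivity) (neg_ne_zero.mpr I_ne_zero), inv_two_mul_cpow ha]
    have e4 : (α : ℂ) ^ (-(3 / 2) : ℂ)
        = ((-α : ℝ) : ℂ) ^ (-(3 / 2) : ℂ) * exp (Real.pi * I * -(3 / 2)) := by
      rw [← neg_one_cpow, ← ofReal_mul_cpow ha (neg_ne_zero.mpr one_ne_zero), ← e2]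
    rw [e4, neg_I_cpow, hz]
    have e3 : I * exp (-(Real.pi * I / 2) * (3 / 2)) * (-1)
        = exp (Real.pi * I / 4) * exp (Real.pi * I * -(3 / 2)) := by
      nth_rw 1 [hI]
      rw [hm, ← exp_add, ← exp_add, ← exp_add]
      congr 1
      ring
    linear_combination ((-α : ℝ) : ℂ) ^ (-(3 / 2) : ℂ) * e3 - 2 * I
      * ((-α : ℝ) : ℂ) ^ (-(3 / 2) : ℂ) * exp (-(Real.pi * I / 2) * (3 / 2)) * hss
  · have e1 : I / (2 * α) = (((2 * α)⁻¹ : ℝ) : ℂ) * I := by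
      push_cast
      field_simp
    rw [e1, ofReal_mul_cpow (by positivity) I_ne_zero, inv_two_mul_cpow h, I_cpow, hz]
    have e3 : I * exp (Real.pi * I / 2 * (3 / 2)) * (-1) = exp (Real.pi * I / 4) := by
      nth_rw 1 [hI]
      rw [hm, ← exp_add, ← exp_add]
      congr 1
      ring
    linear_combination (α : ℂ) ^ (-(3 / 2) : ℂ) * e3 - 2 * I
      * (α : ℂ) ^ (-(3 / 2) : ℂ) * exp (Real.pi * I / 2 * (3 / 2)) * hss

theorem HasRadialLimit.congr {δ δ' : ℂ → ℂ} {ξ L : ℂ} (h : HasRadialLimit δ ξ L) (hξ : ξ.re = 0)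
    (hδ : ∀ x : ℂ, 0 < x.re → δ x = δ' x) : HasRadialLimit δ' ξ L := by
  refine Tendsto.congr' ?_ h
  filter_upwards [self_mem_nhdsWithin] with t ht
  have ht0 : 0 < t := ht
  exact hδ _ (by simpa [hξ] using ht0)

theorem re_div_two_pi_I (β : ℚ) : ((β : ℂ) / (2 * Real.pi * I)).re = 0 := by
  have : (β : ℂ) / (2 * Real.pi * I) = ((-(β / (2 * Real.pi)) : ℝ) : ℂ) * I := by
    have hpi : (Real.pi : ℂ) ≠ 0 := by exact_mod_cast Real.pi_ne_zero
    push_cast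
    field_simp
    rw [I_sq]
    ring
  rw [this, re_ofReal_mul]
  simp

theorem hasRadialLimit {δ : ℂ → ℂ} (h : IsAssociatedDirichletSeries F δ) (β : ℚ) :
    HasRadialLimit δ ((β : ℂ) / (2 * Real.pi * I))
      (I * (Real.sqrt 2 : ℂ) * (-(β * I / 2)) ^ (3 / 2 : ℂ) * (-(2 * phi β))) :=
  (etaTilde_limit_mul β).congr (re_div_two_pi_I β) fun x hx =>
    ((isAssociatedDirichletSeries_iff δ).mp h x hx).symm

theorem hasRadialLimit_neg_inv {δ : ℂ → ℂ} (h : IsAssociatedDirichletSeries F δ) {α : ℚ}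
    (hα : α ≠ 0) :
    HasRadialLimit δ (-1 / (2 * Real.pi * I * (α : ℂ)))
      (zeta 24 ^ 3 * (α : ℂ) ^ (-(3 / 2) : ℂ) * phi (-1 / α)) := by
  have hα' : (α : ℂ) ≠ 0 := by exact_mod_cast hα
  have e := radial_constant (α := (α : ℝ)) (by exact_mod_cast hα)
  have key := hasRadialLimit h (-1 / α)
  rw [ofReal_ratCast] at e
  rw [← e]
  convert! key using 1
  · push_cast
    rw [div_div, mul_comm]
  · have : (-(((-1 / α : ℚ) : ℂ) * I / 2)) = I / (2 * α) := by
      push_cast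
      field_simp
    rw [this]
    ring

end RadialLimits

/-! ### Lacunarity and the natural boundary. -/

section Boundary

open Filter Topology Complex Set

/-- The exponents of the Dirichlet series `η̃(2 π i x)`. -/
noncomputable def freq (n : ℕ) : ℝ := Real.pi ^ 2 * n ^ 2 / 6

theorem etaTilde_eq_tsum (x : ℂ) :
    etaTilde (2 * Real.pi * I * x) = ∑' n : ℕ, chi n * n * exp (-((freq n : ℂ) * x)) := by
  refine tsum_congr fun n => ?_
  congr 2
  rw [freq]
  push_cast
  linear_combination (Real.pi ^ 2 * (n : ℂ) ^ 2 * x / 6) * I_sq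

theorem freq_nonneg (n : ℕ) : 0 ≤ freq n := by unfold freq; positivity

theorem norm_term_le (n : ℕ) {x : ℂ} {σ : ℝ} (hx : σ ≤ x.re) :
    ‖chi n * n * exp (-((freq n : ℂ) * x))‖ ≤ n * Real.exp (-(freq n * σ)) := by
  rw [norm_mul, norm_mul, norm_exp, norm_natCast, neg_re, re_ofReal_mul]
  refine mul_le_mul ?_ (Real.exp_le_exp.mpr ?_) (Real.exp_pos _).le (Nat.cast_nonneg n)
  · exact mul_le_of_le_one_left (Nat.cast_nonneg n) (norm_chi_le n)
  · exact neg_le_neg (mul_le_mul_of_nonneg_left hx (freq_nonneg n))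

theorem sq_le_freq (n : ℕ) : (n : ℝ) ^ 2 ≤ freq n := by
  rw [freq]
  nlinarith [Real.pi_gt_three, sq_nonneg (n : ℝ), mul_nonneg (sq_nonneg (n : ℝ))
    (by nlinarith [Real.pi_gt_three] : 0 ≤ Real.pi ^ 2 - 6)]

theorem summable_mul_exp_freq {σ : ℝ} (hσ : 0 < σ) :
    Summable fun n : ℕ => (n : ℝ) * Real.exp (-(freq n * σ)) := by
  refine Summable.of_nonneg_of_le (fun n => by positivity) (fun n => ?_)
    (Real.summable_pow_mul_exp_neg_nat_mul 1 hσ)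
  rw [pow_one]
  refine mul_le_mul_of_nonneg_left (Real.exp_le_exp.mpr ?_) (Nat.cast_nonneg n)
  have h1 : (n : ℝ) ≤ (n : ℝ) ^ 2 := by exact_mod_cast Nat.le_self_pow two_ne_zero n
  nlinarith [sq_le_freq n]

theorem summable_term {x : ℂ} (hx : 0 < x.re) :
    Summable fun n : ℕ => chi n * n * exp (-((freq n : ℂ) * x)) :=
  Summable.of_norm_bounded (summable_mul_exp_freq hx) fun n => norm_term_le n le_rfl

theorem differentiableOn_etaTilde :
    DifferentiableOn ℂ (fun x => etaTilde (2 * Real.pi * I * x)) {x : ℂ | 0 < x.re} := by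
  intro x hx
  have hx0 : 0 < x.re := hx
  have hopen : IsOpen {y : ℂ | x.re / 2 < y.re} := isOpen_lt continuous_const continuous_re
  have h : DifferentiableOn ℂ (fun y => ∑' n : ℕ, chi n * n * exp (-((freq n : ℂ) * y)))
      {y : ℂ | x.re / 2 < y.re} :=
    differentiableOn_tsum_of_summable_norm (summable_mul_exp_freq (half_pos hx0))
      (fun n => by fun_prop) hopen fun n y hy => norm_term_le n (le_of_lt hy)
  have hmem : {y : ℂ | x.re / 2 < y.re} ∈ 𝓝 x := hopen.mem_nhds (half_lt_self hx0)
  exact ((h.differentiableAt hmem).congr_of_eventuallyEq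
    (Eventually.of_forall etaTilde_eq_tsum)).differentiableWithinAt

theorem differentiableOn_delta :
    DifferentiableOn ℂ (fun x => I * (Real.sqrt 2 : ℂ) * ((Real.pi : ℂ) * x) ^ (3 / 2 : ℂ)
      * etaTilde (2 * Real.pi * I * x)) {x : ℂ | 0 < x.re} := by
  refine DifferentiableOn.mul (DifferentiableOn.const_mul ?_ _) differentiableOn_etaTilde
  refine DifferentiableOn.cpow_const (by fun_prop) fun x hx => Or.inl ?_
  rw [re_ofReal_mul]
  exact mul_pos Real.pi_pos hx

/-- The integers prime to `6` in increasing order. -/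
def primeToSix (k : ℕ) : ℕ := 3 * k + 1 + k % 2

theorem strictMono_primeToSix : StrictMono primeToSix :=
  strictMono_nat_of_lt_succ fun k => by unfold primeToSix; omega

theorem chi_primeToSix_ne_zero (k : ℕ) : chi (primeToSix k) ≠ 0 := by
  have h : primeToSix k % 12 = 1 ∨ primeToSix k % 12 = 11 ∨ primeToSix k % 12 = 5 ∨
      primeToSix k % 12 = 7 := by
    unfold primeToSix; omega
  unfold chi
  rcases h with h | h | h | h <;> simp [h]

theorem chi_eq_zero_of_notMem {n : ℕ} (h : n ∉ range primeToSix) : chi n = 0 := by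
  by_contra hn
  refine h ⟨n / 3, ?_⟩
  have : n % 12 = 1 ∨ n % 12 = 11 ∨ n % 12 = 5 ∨ n % 12 = 7 := by
    by_contra hc
    push Not at hc
    exact hn (by simp [chi, hc])
  unfold primeToSix
  omega

theorem isLacunary_etaTilde {A : ℂ} (hA : A ≠ 0) {D : ℂ → ℂ}
    (hD : ∀ x : ℂ, 0 < x.re → D x = A * etaTilde (2 * Real.pi * I * x)) :
    IsLacunaryDirichletSeries D := by
  -- Consecutive integers prime to 6 differ by at least 2, so their squares differ by at least k,
  -- and π²/6 ≥ 1.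
  have hfreq : ∀ k, freq (primeToSix k) + k ≤ freq (primeToSix (k + 1)) := by
    intro k
    have h1 : primeToSix k + 2 ≤ primeToSix (k + 1) := by unfold primeToSix; omega
    have h2 : k ≤ primeToSix k := by unfold primeToSix; omega
    have h1' : (primeToSix k : ℝ) + 2 ≤ primeToSix (k + 1) := by exact_mod_cast h1
    have h2' : (k : ℝ) ≤ primeToSix k := by exact_mod_cast h2
    have hk : (0 : ℝ) ≤ k := Nat.cast_nonneg k
    have h3 : (k : ℝ) ≤ (primeToSix (k + 1) : ℝ) ^ 2 - (primeToSix k : ℝ) ^ 2 := by nlinarith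
    have hp : 6 ≤ Real.pi ^ 2 := by nlinarith [Real.pi_gt_three]
    unfold freq
    nlinarith
  have hmono : StrictMono fun k => freq (primeToSix k) := by
    refine strictMono_nat_of_lt_succ fun k => ?_
    have h1 : (primeToSix k : ℝ) < primeToSix (k + 1) := by
      exact_mod_cast strictMono_primeToSix k.lt_succ_self
    unfold freq
    gcongr
  refine ⟨fun k => A * (chi (primeToSix k) * primeToSix k), fun k => freq (primeToSix k),
    fun k => ?_, freq_nonneg _, hmono, ?_, fun x hx => ?_⟩
  · refine mul_ne_zero hA (mul_ne_zero (chi_primeToSix_ne_zero k) ?_)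
    have : primeToSix k ≠ 0 := by unfold primeToSix; omega
    exact_mod_cast this
  · refine tendsto_atTop_mono (fun k => ?_) tendsto_natCast_atTop_atTop
    linarith [hfreq k]
  · have h := (summable_term hx).hasSum
    rw [← etaTilde_eq_tsum, ← strictMono_primeToSix.injective.hasSum_iff fun n hn => by
      rw [chi_eq_zero_of_notMem hn, zero_mul, zero_mul]] at h
    rw [hD x hx]
    refine (h.mul_left A).of_eq (fun k => ?_) rfl
    simp only [Function.comp_apply]
    ring

/-- The weight y(L - y) vanishes at both ends, so the boundary terms of order 1/μ disappear and the
decay is quadratic. -/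
theorem integral_window {L : ℝ} (hL : 0 < L) (μ : ℝ) (hμ : 1 ≤ |μ|) :
    ‖∫ y in (0 : ℝ)..L, ((y * (L - y) : ℝ) : ℂ) * exp (I * μ * y)‖ ≤ (2 * L + 4) / μ ^ 2 := by
  have hμ0 : μ ≠ 0 := by rintro rfl; norm_num at hμ
  set w : ℂ := I * μ with hw
  have hw0 : w ≠ 0 := mul_ne_zero I_ne_zero (by exact_mod_cast hμ0)
  have hwn : ‖w‖ = |μ| := by rw [hw, norm_mul, norm_I, one_mul, norm_real, Real.norm_eq_abs]
  set G : ℝ → ℂ := fun y => exp (w * y) *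
    (((y * (L - y) : ℝ) : ℂ) / w - ((L - 2 * y : ℝ) : ℂ) / w ^ 2 - 2 / w ^ 3) with hG
  have hd : ∀ y : ℝ, HasDerivAt G (((y * (L - y) : ℝ) : ℂ) * exp (w * y)) y := by
    intro y
    have e1 : HasDerivAt (fun y : ℝ => exp (w * y)) (exp (w * y) * w) y := by
      have : HasDerivAt (fun y : ℝ => w * (y : ℂ)) w y :=
        ((hasDerivAt_id' y).ofReal_comp.const_mul w).congr_deriv (by simp)
      exact this.cexp
    have e2 : HasDerivAt (fun y : ℝ => ((y * (L - y) : ℝ) : ℂ)) ((L - 2 * y : ℝ) : ℂ) y :=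
      (((hasDerivAt_id' y).mul ((hasDerivAt_id' y).const_sub L)).congr_deriv
        (by ring : _ = L - 2 * y)).ofReal_comp
    have e3 : HasDerivAt (fun y : ℝ => ((L - 2 * y : ℝ) : ℂ)) ((-2 : ℝ) : ℂ) y :=
      ((((hasDerivAt_id' y).const_mul 2).const_sub L).congr_deriv
        (by ring : _ = (-2 : ℝ))).ofReal_comp
    refine (e1.mul (((e2.div_const w).sub (e3.div_const (w ^ 2))).sub_const
      (2 / w ^ 3))).congr_deriv ?_
    simp only [Pi.sub_apply]
    push_cast
    field_simp
    ring
  have hint : ∫ y in (0 : ℝ)..L, ((y * (L - y) : ℝ) : ℂ) * exp (w * y) = G L - G 0 := by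
    refine intervalIntegral.integral_eq_sub_of_hasDerivAt (fun y _ => hd y) ?_
    exact Continuous.intervalIntegrable (by fun_prop) _ _
  have hb : ∀ s : ℝ, |s| = L → ‖(s : ℂ) / w ^ 2 + 2 / w ^ 3‖ ≤ (L + 2) / μ ^ 2 := by
    intro s hs
    refine (norm_add_le _ _).trans ?_
    rw [norm_div, norm_div, norm_pow, norm_pow, hwn, norm_real, Real.norm_eq_abs, hs, sq_abs,
      norm_ofNat, add_div]
    gcongr
    rw [← sq_abs μ]
    exact pow_le_pow_right₀ hμ (by norm_num)
  have hexp : ‖exp (w * L)‖ = 1 := by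
    rw [hw, norm_exp]
    simp
  have e : G L - G 0 = exp (w * L) * -(((-L : ℝ) : ℂ) / w ^ 2 + 2 / w ^ 3)
      + ((L : ℂ) / w ^ 2 + 2 / w ^ 3) := by
    simp only [hG]
    push_cast
    rw [mul_zero, exp_zero]
    ring
  rw [hint, e]
  refine (norm_add_le _ _).trans ?_
  rw [norm_mul, hexp, one_mul, norm_neg]
  have b1 := hb (-L) (by rw [abs_neg, abs_of_pos hL])
  have b2 := hb L (abs_of_pos hL)
  calc _ ≤ (L + 2) / μ ^ 2 + (L + 2) / μ ^ 2 := add_le_add b1 b2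
    _ = _ := by ring

theorem integral_window_zero (L : ℝ) :
    ∫ y in (0 : ℝ)..L, ((y * (L - y) : ℝ) : ℂ) = ((L ^ 3 / 6 : ℝ) : ℂ) := by
  rw [intervalIntegral.integral_ofReal]
  congr 1
  have : ∀ y ∈ uIcc 0 L, HasDerivAt (fun y : ℝ => L * y ^ 2 / 2 - y ^ 3 / 3) (y * (L - y)) y := by
    intro y _
    refine (((((hasDerivAt_id' y).pow 2).const_mul L).div_const 2).sub
      (((hasDerivAt_id' y).pow 3).div_const 3)).congr_deriv ?_
    push_cast
    ring
  rw [intervalIntegral.integral_eq_sub_of_hasDerivAt this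
    (Continuous.intervalIntegrable (by fun_prop) _ _)]
  ring

/-- From m² - n² = (m - n)(m + n) and (m + n)² ≥ n. The factor n is what cancels the coefficient n
of the n-th term of η̃. -/
theorem one_le_freq_sub {m n : ℕ} (h : n ≠ m) :
    ((n : ℝ) - m) ^ 2 * n ≤ (freq m - freq n) ^ 2 ∧ 1 ≤ |freq m - freq n| := by
  have hz : (1 : ℤ) ≤ ((n : ℤ) - m) ^ 2 := by
    have : (n : ℤ) - m ≠ 0 := sub_ne_zero.mpr (by exact_mod_cast h)
    have := sq_pos_of_ne_zero this
    omega
  have hd : (1 : ℝ) ≤ ((n : ℝ) - m) ^ 2 := by exact_mod_cast hz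
  have hs : (1 : ℝ) ≤ (n : ℝ) + m := by
    have : 1 ≤ n + m := by omega
    exact_mod_cast this
  have hn : (n : ℝ) ≤ (n : ℝ) ^ 2 := by exact_mod_cast Nat.le_self_pow two_ne_zero n
  have hn0 : (0 : ℝ) ≤ n := Nat.cast_nonneg n
  have hm0 : (0 : ℝ) ≤ m := Nat.cast_nonneg m
  have hp : 1 ≤ (Real.pi ^ 2 / 6) ^ 2 := by
    refine one_le_pow₀ ?_
    nlinarith [Real.pi_gt_three]
  have e : (freq m - freq n) ^ 2
      = (Real.pi ^ 2 / 6) ^ 2 * (((n : ℝ) - m) ^ 2 * ((n : ℝ) + m) ^ 2) := by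
    unfold freq; ring
  have h1 : ((n : ℝ) - m) ^ 2 * ((n : ℝ) + m) ^ 2 ≤ (freq m - freq n) ^ 2 := by
    rw [e]
    exact le_mul_of_one_le_left (by positivity) hp
  constructor
  · refine le_trans (mul_le_mul_of_nonneg_left ?_ (sq_nonneg _)) h1
    nlinarith
  · rw [← one_le_sq_iff_one_le_abs]
    refine le_trans ?_ h1
    nlinarith [one_le_pow₀ hs (n := 2)]

/-- Integrating η̃ against the window times e^{iλ_m y} isolates the m-th term. The other terms
contribute at most (2L + 4)/(n - m)² each, so their total is bounded uniformly in m and σ. -/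
theorem coeff_mul_exp_le {C L y₀ σ : ℝ} (hL : 0 < L) (hσ : 0 < σ)
    (hC : ∀ y ∈ Icc 0 L, ‖etaTilde (2 * Real.pi * I * (σ + I * (y₀ + y : ℝ)))‖ ≤ C) {m : ℕ}
    (hm : chi m = 1) :
    m * Real.exp (-(freq m * σ)) * (L ^ 3 / 6)
      ≤ L ^ 3 * C + (2 * L + 4) * ∑' k : ℤ, 1 / (k : ℝ) ^ 2 := by
  set x : ℝ → ℂ := fun y => σ + I * (y₀ + y : ℝ) with hx
  have hxre : ∀ y, (x y).re = σ := fun y => by simp [hx]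
  set f : ℕ → ℝ → ℂ := fun n y => ((y * (L - y) : ℝ) : ℂ) * exp (I * freq m * y) *
    (chi n * n * exp (-((freq n : ℂ) * x y))) with hf
  have hwin : ∀ y ∈ Icc 0 L, ‖((y * (L - y) : ℝ) : ℂ) * exp (I * freq m * y)‖ ≤ L ^ 2 := by
    intro y hy
    have e : ‖exp (I * freq m * y)‖ = 1 := by rw [norm_exp]; simp
    rw [norm_mul, e, mul_one, norm_real, Real.norm_of_nonneg (mul_nonneg hy.1 (by linarith [hy.2]))]
    nlinarith [hy.1, hy.2]
  have hfb : ∀ n, ∀ y ∈ Icc 0 L, ‖f n y‖ ≤ L ^ 2 * (n * Real.exp (-(freq n * σ))) := by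
    intro n y hy
    rw [hf, norm_mul]
    exact mul_le_mul (hwin y hy) (norm_term_le n (hxre y).ge) (norm_nonneg _) (sq_nonneg L)
  have hsub : uIoc 0 L ⊆ Icc 0 L := by rw [uIoc_of_le hL.le]; exact Ioc_subset_Icc_self
  have hsum := intervalIntegral.hasSum_integral_of_dominated_convergence (μ := MeasureTheory.volume)
    (a := 0) (b := L) (F := f)
    (f := fun y => ((y * (L - y) : ℝ) : ℂ) * exp (I * freq m * y) *
      etaTilde (2 * Real.pi * I * x y))
    (fun n _ => L ^ 2 * (n * Real.exp (-(freq n * σ))))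
    (fun n => (by simp only [hf, hx]; fun_prop : Continuous (f n)).aestronglyMeasurable)
    (fun n => Eventually.of_forall fun y hy => hfb n y (hsub hy))
    (Eventually.of_forall fun y _ => (summable_mul_exp_freq hσ).mul_left _)
    intervalIntegrable_const
    (Eventually.of_forall fun y _ => by
      rw [etaTilde_eq_tsum]
      exact (summable_term (by rw [hxre]; exact hσ)).hasSum.mul_left _)
  have hterm : ∀ n, ∫ y in (0 : ℝ)..L, f n y = chi n * n * exp (-((freq n : ℂ) * x 0)) *
      ∫ y in (0 : ℝ)..L, ((y * (L - y) : ℝ) : ℂ) * exp (I * (freq m - freq n : ℝ) * y) := by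
    intro n
    rw [← intervalIntegral.integral_const_mul]
    congr 1
    ext y
    have : exp (I * freq m * y) * exp (-((freq n : ℂ) * x y))
        = exp (-((freq n : ℂ) * x 0)) * exp (I * (freq m - freq n : ℝ) * y) := by
      rw [← exp_add, ← exp_add]
      congr 1
      simp only [hx]
      push_cast
      ring
    simp only [hf]
    linear_combination ((y * (L - y) : ℝ) : ℂ) * (chi n * n) * this
  -- At n = m the right side is 1/0 = 0, consistent with the removed diagonal term.
  have hoff : ∀ n, ‖if n = m then 0 else ∫ y in (0 : ℝ)..L, f n y‖
      ≤ (2 * L + 4) * (1 / (((n : ℤ) - m : ℤ) : ℝ) ^ 2) := by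
    intro n
    split_ifs with hnm
    · rw [norm_zero]; positivity
    obtain ⟨h1, h2⟩ := one_le_freq_sub hnm
    have hJ := integral_window hL _ h2
    have hc := norm_term_le n (hxre 0).ge
    have hc' : ‖chi n * n * exp (-((freq n : ℂ) * x 0))‖ ≤ n := by
      refine hc.trans (mul_le_of_le_one_right (Nat.cast_nonneg n) (Real.exp_le_one_iff.mpr ?_))
      exact neg_nonpos.mpr (mul_nonneg (freq_nonneg n) hσ.le)
    rw [hterm, norm_mul]
    refine (mul_le_mul hc' hJ (norm_nonneg _) (Nat.cast_nonneg n)).trans ?_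
    have hpos : 0 < (freq m - freq n) ^ 2 := by
      rw [← sq_abs]; positivity
    have hpos' : 0 < ((n : ℝ) - m) ^ 2 :=
      sq_pos_of_ne_zero (sub_ne_zero.mpr (by exact_mod_cast hnm))
    push_cast
    rw [mul_one_div, ← mul_div_assoc, div_le_div_iff₀ hpos hpos']
    nlinarith [mul_le_mul_of_nonneg_left h1 (by positivity : 0 ≤ 2 * L + 4)]
  have hZ : Summable fun k : ℤ => 1 / (k : ℝ) ^ 2 :=
    Real.summable_one_div_int_pow.mpr one_lt_two
  have hinj : Function.Injective fun n : ℕ => (n : ℤ) - m := fun a b h => by simpa using h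
  have hsumoff : Summable fun n : ℕ => (2 * L + 4) * (1 / (((n : ℤ) - m : ℤ) : ℝ) ^ 2) :=
    (hZ.comp_injective hinj).mul_left _
  have htot := hsum.summable.tsum_eq_add_tsum_ite m
  rw [hsum.tsum_eq, ← sub_eq_iff_eq_add] at htot
  have hmain : ‖∫ y in (0 : ℝ)..L, f m y‖ = m * Real.exp (-(freq m * σ)) * (L ^ 3 / 6) := by
    have : ∫ y in (0 : ℝ)..L, ((y * (L - y) : ℝ) : ℂ) * exp (I * (freq m - freq m : ℝ) * y)
        = ((L ^ 3 / 6 : ℝ) : ℂ) := by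
      rw [← integral_window_zero]
      simp
    rw [hterm, this, hm, one_mul, norm_mul, norm_mul, norm_exp, neg_re, re_ofReal_mul, hxre,
      norm_natCast, norm_real, Real.norm_of_nonneg (by positivity)]
  have hint : ‖∫ y in (0 : ℝ)..L, ((y * (L - y) : ℝ) : ℂ) * exp (I * freq m * y) *
      etaTilde (2 * Real.pi * I * x y)‖ ≤ L ^ 3 * C := by
    have := intervalIntegral.norm_integral_le_of_norm_le_const (a := 0) (b := L) (C := L ^ 2 * C)
      (f := fun y => ((y * (L - y) : ℝ) : ℂ) * exp (I * freq m * y) *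
      etaTilde (2 * Real.pi * I * x y)) fun y hy => by
        rw [norm_mul]
        exact mul_le_mul (hwin y (hsub hy)) (hC y (hsub hy)) (norm_nonneg _) (sq_nonneg L)
    rw [sub_zero, abs_of_pos hL] at this
    linarith
  have hrest := tsum_of_norm_bounded hsumoff.hasSum hoff
  rw [tsum_mul_left] at hrest
  have hle : ∑' n : ℕ, 1 / (((n : ℤ) - m : ℤ) : ℝ) ^ 2 ≤ ∑' k : ℤ, 1 / (k : ℝ) ^ 2 :=
    tsum_comp_le_tsum_of_inj hZ (fun k => by positivity) hinj
  rw [← hmain, ← htot]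
  refine (norm_sub_le _ _).trans (add_le_add hint (hrest.trans ?_))
  exact mul_le_mul_of_nonneg_left hle (by positivity)

theorem not_bounded_near (y₀ : ℝ) : ¬ ∃ C : ℝ, ∀ᶠ x in 𝓝[{x : ℂ | 0 < x.re}] (I * y₀),
    ‖etaTilde (2 * Real.pi * I * x)‖ ≤ C := by
  rintro ⟨C, hC⟩
  obtain ⟨ε, hε, hball⟩ := Metric.mem_nhdsWithin_iff.mp hC
  -- With σ < L and y ≤ L, the segment stays within 2L < ε of the boundary point.
  set L := ε / 3 with hL
  have hL0 : 0 < L := by positivity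
  set D := L ^ 3 * C + (2 * L + 4) * ∑' k : ℤ, 1 / (k : ℝ) ^ 2 with hD
  have key : ∀ m, chi m = 1 → m * (L ^ 3 / 6) ≤ D := by
    intro m hm
    have hlim : Tendsto (fun σ : ℝ => m * Real.exp (-(freq m * σ)) * (L ^ 3 / 6)) (𝓝[>] 0)
        (𝓝 (m * (L ^ 3 / 6))) := by
      have hc : Continuous fun σ : ℝ => m * Real.exp (-(freq m * σ)) * (L ^ 3 / 6) := by fun_prop
      have h := hc.tendsto 0
      rw [mul_zero, neg_zero, Real.exp_zero, mul_one] at h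
      exact h.mono_left nhdsWithin_le_nhds
    refine le_of_tendsto hlim ?_
    filter_upwards [Ioo_mem_nhdsGT hL0] with σ hσ
    refine coeff_mul_exp_le (y₀ := y₀) hL0 hσ.1 (fun y hy => hball ⟨?_, ?_⟩) hm
    · rw [mem_ball_iff_norm]
      have e : (σ : ℂ) + I * (y₀ + y : ℝ) - I * y₀ = (σ : ℂ) + (y : ℂ) * I := by
        push_cast; ring
      rw [e]
      refine (norm_add_le _ _).trans_lt ?_
      rw [norm_mul, norm_I, mul_one, norm_real, norm_real, Real.norm_of_nonneg hσ.1.le,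
        Real.norm_of_nonneg hy.1]
      linarith [hσ.2, hy.2]
    · change 0 < ((σ : ℂ) + I * (y₀ + y : ℝ)).re
      simpa using hσ.1
  -- The bound D does not depend on m, whereas χ(m) = 1 for arbitrarily large m.
  obtain ⟨k, hk⟩ := exists_nat_gt (D / (L ^ 3 / 6))
  rw [div_lt_iff₀ (by positivity)] at hk
  have h1 : chi (12 * k + 1) = 1 := by
    have : (12 * k + 1) % 12 = 1 := by omega
    simp [chi, this]
  have h2 := key _ h1
  have h3 : (k : ℝ) ≤ (12 * k + 1 : ℕ) := by
    have : k ≤ 12 * k + 1 := by omega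
    exact_mod_cast this
  have h4 := mul_le_mul_of_nonneg_right h3 (by positivity : 0 ≤ L ^ 3 / 6)
  linarith

/-- Away from 0 the factor (πx)^{3/2} is continuous and nonzero at the boundary point, so a
continuation of δ would bound η̃ near it. -/
theorem not_continuable_of_ne_zero {A : ℂ} (hA : A ≠ 0) {δ g : ℂ → ℂ}
    (hδ : ∀ x : ℂ, 0 < x.re → δ x = A * ((Real.pi : ℂ) * x) ^ (3 / 2 : ℂ)
      * etaTilde (2 * Real.pi * I * x)) {y₀ : ℝ} (hy : y₀ ≠ 0) (hg : AnalyticAt ℂ g (I * y₀))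
    (hgδ : ∀ᶠ x in 𝓝[{x : ℂ | 0 < x.re}] (I * y₀), g x = δ x) : False := by
  have hpi : (Real.pi : ℂ) ≠ 0 := by exact_mod_cast Real.pi_ne_zero
  have hslit : (Real.pi : ℂ) * (I * y₀) ∈ slitPlane := by
    refine mem_slitPlane_iff.mpr (Or.inr ?_)
    rw [im_ofReal_mul, I_mul_im, ofReal_re]
    exact mul_ne_zero Real.pi_ne_zero hy
  have hP : ContinuousAt (fun x : ℂ => A * ((Real.pi : ℂ) * x) ^ (3 / 2 : ℂ)) (I * y₀) := by
    have : ContinuousAt (fun x : ℂ => (Real.pi : ℂ) * x) (I * y₀) := by fun_prop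
    exact ((continuousAt_cpow_const hslit).comp' this).const_mul A
  have hPne : ∀ x : ℂ, x ≠ 0 → A * ((Real.pi : ℂ) * x) ^ (3 / 2 : ℂ) ≠ 0 := fun x hx =>
    mul_ne_zero hA (by
      rw [Ne, cpow_eq_zero_iff]
      exact fun h => mul_ne_zero hpi hx h.1)
  have hy' : I * (y₀ : ℂ) ≠ 0 := mul_ne_zero I_ne_zero (by exact_mod_cast hy)
  have hq := (hg.continuousAt.div hP (hPne _ hy')).norm
  obtain ⟨C, hC⟩ := exists_gt ‖g (I * y₀) / (A * ((Real.pi : ℂ) * (I * y₀)) ^ (3 / 2 : ℂ))‖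
  have hb := Filter.Tendsto.eventually_le_const hC hq
  refine not_bounded_near y₀ ⟨C, ?_⟩
  filter_upwards [hgδ, hb.filter_mono nhdsWithin_le_nhds, self_mem_nhdsWithin] with x hx1 hx2 hx3
  have hx0 : 0 < x.re := hx3
  have hxne : x ≠ 0 := by rintro rfl; simp at hx0
  refine le_of_eq_of_le ?_ hx2
  simp only [Pi.div_apply]
  rw [hx1, hδ x hx0, mul_div_cancel_left₀ _ (hPne x hxne)]

/-- At ξ = 0 the power factor vanishes and cannot be divided out. Since analyticity and agreement
with δ persist at nearby boundary points, a nonzero one is used instead. -/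
theorem not_continuable {A : ℂ} (hA : A ≠ 0) {δ : ℂ → ℂ}
    (hδ : ∀ x : ℂ, 0 < x.re → δ x = A * ((Real.pi : ℂ) * x) ^ (3 / 2 : ℂ)
      * etaTilde (2 * Real.pi * I * x)) {ξ : ℂ} (hξ : ξ.re = 0) :
    ¬ ∃ g : ℂ → ℂ, AnalyticAt ℂ g ξ ∧ ∀ᶠ x in 𝓝[{x : ℂ | 0 < x.re}] ξ, g x = δ x := by
  rintro ⟨g, hg, hgδ⟩
  have hξ' : ξ = I * (ξ.im : ℂ) := by
    apply Complex.ext <;> simp [hξ]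
  rw [eventually_nhdsWithin_iff] at hgδ
  have h := hg.eventually_analyticAt.and hgδ.eventually_nhds
  have hlim : Tendsto (fun t : ℝ => I * ((ξ.im + t : ℝ) : ℂ)) (𝓝[≠] 0) (𝓝 ξ) := by
    have hc : Continuous fun t : ℝ => I * ((ξ.im + t : ℝ) : ℂ) := by fun_prop
    have h := hc.tendsto 0
    rw [add_zero, ← hξ'] at h
    exact h.mono_left nhdsWithin_le_nhds
  have hne : ∀ᶠ t : ℝ in 𝓝[≠] 0, ξ.im + t ≠ 0 := by
    by_cases h0 : ξ.im = 0
    · filter_upwards [self_mem_nhdsWithin] with t ht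
      rw [h0, zero_add]
      exact ht
    · have hc : Continuous fun t : ℝ => ξ.im + t := by fun_prop
      exact (hc.continuousAt.eventually_ne (by simpa using h0)).filter_mono nhdsWithin_le_nhds
  obtain ⟨t, ⟨h1, h2⟩, h3⟩ := ((hlim.eventually h).and hne).exists
  exact not_continuable_of_ne_zero hA hδ h3 h1 (eventually_nhdsWithin_iff.mpr h2)

end Boundary

end KZ

/-! ### Assembly of the statements about δ. -/

theorem mainTheorem4 :
    (∃ δ : ℂ → ℂ, KZ.IsAssociatedDirichletSeries KZ.F δ) ∧
    ∀ δ : ℂ → ℂ, KZ.IsAssociatedDirichletSeries KZ.F δ →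
      (∀ x : ℂ, 0 < x.re →
        δ x = Complex.I * (Real.sqrt 2 : ℂ) * ((Real.pi : ℂ) * x) ^ (3 / 2 : ℂ)
          * KZ.etaTilde (2 * Real.pi * Complex.I * x)) ∧
      (KZ.IsLacunaryDirichletSeries (fun x => δ x / x ^ (3 / 2 : ℂ)) ∧
        KZ.HasNaturalBoundaryImaginaryAxis δ) ∧
      ((∀ β : ℚ, ∃ L : ℂ, KZ.HasRadialLimit δ ((β : ℂ) / (2 * Real.pi * Complex.I)) L) ∧
        ∀ α : ℚ, α ≠ 0 →
          KZ.HasRadialLimit δ (-1 / (2 * Real.pi * Complex.I * (α : ℂ)))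
            (KZ.zeta 24 ^ 3 * (α : ℂ) ^ (-(3 / 2) : ℂ) * KZ.phi (-1 / α))) := by
  refine ⟨⟨_, (KZ.isAssociatedDirichletSeries_iff _).mpr fun x _ => rfl⟩, fun δ hδ => ?_⟩
  have hA : Complex.I * (Real.sqrt 2 : ℂ) ≠ 0 :=
    mul_ne_zero Complex.I_ne_zero (by exact_mod_cast (Real.sqrt_pos.mpr two_pos).ne')
  have hpi : (Real.pi : ℂ) ≠ 0 := by exact_mod_cast Real.pi_ne_zero
  have ha := (KZ.isAssociatedDirichletSeries_iff δ).mp hδ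
  refine ⟨ha, ⟨?_, KZ.differentiableOn_delta.congr ha, fun ξ hξ => KZ.not_continuable hA ha hξ⟩,
    fun β => ⟨_, KZ.hasRadialLimit hδ β⟩, fun α hα => KZ.hasRadialLimit_neg_inv hδ hα⟩
  have hA' : Complex.I * (Real.sqrt 2 : ℂ) * (Real.pi : ℂ) ^ (3 / 2 : ℂ) ≠ 0 :=
    mul_ne_zero hA (by rw [Ne, Complex.cpow_eq_zero_iff]; exact fun h => hpi h.1)
  refine KZ.isLacunary_etaTilde hA' fun x hx => ?_
  have hx0 : x ≠ 0 := by rintro rfl; simp at hx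
  have hxp : x ^ (3 / 2 : ℂ) ≠ 0 := by
    rw [Ne, Complex.cpow_eq_zero_iff]; exact fun h => hx0 h.1
  rw [ha x hx, KZ.ofReal_mul_cpow Real.pi_pos hx0, div_eq_iff hxp]
  ring
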